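/- Let $\mathbb C_+$ be the open upper half-plane. For $p\in[1,\infty]$ let $\mathcal H^p_a(\mathbb C_+)$ be the space of holomorphic functions $f$ on $\mathbb C_+$ with $\|f\|_{\mathcal H^p_a}<\infty$, where $$\|f\|_{\mathcal H^p_a}=\sup_{y>0}\Big(\int_{-\infty}^\infty|f(x+iy)|^p\,dx\Big)^{1/p}\quad(p<\infty),\qquad \|f\|_{\mathcal H^\infty_a}=\sup_{z\in\mathbb C_+}|f(z)|.$$ Every $f\in\mathcal H^p_a(\mathbb C_+)$ has a boundary value function $f^*\in L^p(\mathbb R)$, $f^*(x)=\lim_{y\to0^+}f(x+iy)$ for a.e. $x\in\mathbb R$. Theorem 1.1. Let $p\in[1,\infty]$ and let $\varphi\ge0$ be a locally integrable function on $(0,\infty)$. Consider the Hausdorff operators $$\mathscr H_\varphi f(z)=\int_0^\infty f\Big(\frac zt\Big)\frac{\varphi(t)}t\,dt\quad(z\in\mathbb C_+),\qquad H_\varphi g(x)=\int_0^\infty g\Big(\frac xt\Big)\frac{\varphi(t)}t\,dt\quad(x\in\mathbb R).$$ Then $\mathscr H_\varphi$ is bounded on $\mathcal H^p_a(\mathbb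 C_+)$ (that is, for every $f\in\mathcal H^p_a(\mathbb C_+)$ the integral defining $\mathscr H_\varphi f(z)$ converges absolutely for all $z\in\mathbb C_+$ and $\mathscr H_\varphi f\in\mathcal H^p_a(\mathbb C_+)$, and there is a finite $C$ with $\|\mathscr H_\varphi f\|_{\mathcal H^p_a}\le C\|f\|_{\mathcal H^p_a}$ for all such $f$) if and only if $$\int_0^\infty t^{1/p-1}\varphi(t)\,dt<\infty,$$ where $1/p=0$ for $p=\infty$. Moreover, in that case, $$\|\mathscr H_\varphi\|_{\mathcal H^p_a(\mathbb C_+)\to\mathcal H^p_a(\mathbb C_+)}=\int_0^\infty t^{1/p-1}\varphi(t)\,dt,$$ and for every $f\in\mathcal H^p_a(\mathbb C_+)$ the integral defining $H_\varphi(f^*)(x)$ converges absolutely for a.e. $x\in\mathbb R$ and $$(\mathscr H_\varphi f)^*=H_\varphi(f^*)\quad\text{a.e. on }\mathbb R.$$ -/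

import Mathlib

open Set Filter Topology MeasureTheory UpperHalfPlane
open scoped ENNReal NNReal

noncomputable section

/-- The Hardy norm of a function `f` on the upper half-plane, with values in `[0, ∞]`: the supremum
of the `L^p` norms over horizontal lines if `p < ∞`, and the supremum of `|f|` if `p = ∞`.
Only the values of `f` on the upper half-plane matter. -/
def hardyNorm (p : ℝ≥0∞) (f : ℂ → ℂ) : ℝ≥0∞ :=
  if p = ∞ then ⨆ z ∈ upperHalfPlaneSet, ‖f z‖ₑ
  else ⨆ y ∈ Ioi (0 : ℝ),
    (∫⁻ x : ℝ, ‖f (x + y * Complex.I)‖ₑ ^ p.toReal) ^ (1 / p.toReal)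

/-- `f` belongs to the holomorphic Hardy space of the upper half-plane. -/
def MemHardy (p : ℝ≥0∞) (f : ℂ → ℂ) : Prop :=
  DifferentiableOn ℂ f upperHalfPlaneSet ∧ hardyNorm p f < ∞

/-- `C` is a bound for the operator `T` on the Hardy space. -/
def IsHardyBound (p : ℝ≥0∞) (T : (ℂ → ℂ) → (ℂ → ℂ)) (C : ℝ≥0) : Prop :=
  ∀ f : ℂ → ℂ, MemHardy p f → hardyNorm p (T f) ≤ C * hardyNorm p f

/-- The operator norm of `T` on the Hardy space: the infimum of all its bounds
(`∞` if there is none). -/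
def hardyOpNorm (p : ℝ≥0∞) (T : (ℂ → ℂ) → (ℂ → ℂ)) : ℝ≥0∞ :=
  ⨅ (C : ℝ≥0) (_ : IsHardyBound p T C), (C : ℝ≥0∞)

/-- The integrand of the complex Hausdorff operator. -/
def hausdorffIntegrand (φ : ℝ → ℝ) (f : ℂ → ℂ) (z : ℂ) (t : ℝ) : ℂ :=
  f (z / t) * ((φ t / t : ℝ) : ℂ)

/-- The complex Hausdorff operator `f ↦ ∫₀^∞ f(z/t) φ(t)/t dt`. -/
def complexHausdorff (φ : ℝ → ℝ) (f : ℂ → ℂ) (z : ℂ) : ℂ :=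
  ∫ t in Ioi (0 : ℝ), hausdorffIntegrand φ f z t

/-- The integrand of the real Hausdorff operator. -/
def realHausdorffIntegrand (φ : ℝ → ℝ) (g : ℝ → ℂ) (x : ℝ) (t : ℝ) : ℂ :=
  g (x / t) * ((φ t / t : ℝ) : ℂ)

/-- The real Hausdorff operator `g ↦ ∫₀^∞ g(x/t) φ(t)/t dt`. -/
def realHausdorff (φ : ℝ → ℝ) (g : ℝ → ℂ) (x : ℝ) : ℂ :=
  ∫ t in Ioi (0 : ℝ), realHausdorffIntegrand φ g x t

/-- The complex Hausdorff operator is (well defined and) bounded on the Hardy space: for every `f`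
in the space the defining integral converges absolutely at every point of the upper half-plane and
gives again an element of the space, and the operator has a finite bound. -/
def HausdorffBoundedOnHardy (p : ℝ≥0∞) (φ : ℝ → ℝ) : Prop :=
  (∀ f : ℂ → ℂ, MemHardy p f →
    (∀ z ∈ upperHalfPlaneSet, IntegrableOn (hausdorffIntegrand φ f z) (Ioi 0)) ∧
      MemHardy p (complexHausdorff φ f)) ∧
  ∃ C : ℝ≥0, IsHardyBound p (complexHausdorff φ) C

/-- The value in `[0, ∞]` of `∫₀^∞ t^(1/p - 1) φ(t) dt`, for nonnegative `φ`
(with `1/p = 0` for `p = ∞`). -/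
def hausdorffWeight (p : ℝ≥0∞) (φ : ℝ → ℝ) : ℝ≥0∞ :=
  ∫⁻ t in Ioi (0 : ℝ), ENNReal.ofReal (t ^ (p⁻¹.toReal - 1) * φ t)

/-- The boundary value function `f^*(x) = lim_{y → 0+} f(x + iy)`; it is meaningful only
at points where this limit exists. -/
def boundaryValue (f : ℂ → ℂ) (x : ℝ) : ℂ :=
  limUnder (𝓝[>] (0 : ℝ)) (fun y : ℝ => f (x + y * Complex.I))

/-- The limit defining the boundary value function exists at almost every real point. -/
def HasBoundaryValue (f : ℂ → ℂ) : Prop :=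
  ∀ᵐ x : ℝ, Tendsto (fun y : ℝ => f (x + y * Complex.I)) (𝓝[>] (0 : ℝ)) (𝓝 (boundaryValue f x))

end

/-! The operator averages the dilations `t^(-1/p) f(·/t)`, each of which preserves the Hardy norm,
against the measure `t^(1/p-1) φ(t) dt`. The upper bound is therefore Minkowski's integral
inequality, obtained in `lintegral_line_complexHausdorff_le` from Hölder, Tonelli and rescaling.
Absolute convergence and holomorphy follow from the growth bound `MemHardy.norm_le`, which gives
`|f(z)| ≤ 2 ‖f‖ (Im z)^(-1/p)`.

For the lower bound with `p < ∞` the test functions are `(z+i)^(-1/p-ε)`, whose norm to the power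
`p` is at most `2 + 2/(εp)`. Since `(x+i)/t + i = t⁻¹ (x + (1+t) i)`, the integrand at height one
differs from a positive one only by the phases `arg (x + (1+t) i)`. For `x > 0` these lie in `[0,
π/2]`, which gives finiteness of the weight at the price of a constant
(`cos_mul_integral_weight_rpow_le`). For a weight living on `[1/n, n]` the phases become constant as
`x → ±∞`, and as `ε → 0` the norm of the test function concentrates at infinity, so the estimate
becomes sharp (`integral_weight_le`). In general the weight, now known to be finite, is split into
its part `W₁` on `[1/n, n]` and the rest `W₂`. A bound `C` for the operator gives `W₁ ≤ C + W₂`,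
that is `2 W₁ ≤ C + W`, and exhaustion gives `W ≤ C`. For `p = ∞` the constant function suffices.

Boundary values are reduced to one `L¹` class by division by `(z+i)³` (`MemHardy.decayingHardyOne`).
There the first primitive has a boundary function of bounded variation, hence differentiable almost
everywhere. The second primitive is continuous up to the axis and inherits a second order Peano
expansion at almost every point. A Phragmén–Lindelöf argument carries the expansion into the
half-plane, and two Cauchy estimates turn it into a vertical limit
(`DecayingHardyOne.exists_tendsto`).

Comparison with outer functions shows that `√|g|`, and then `|g|`, is dominated by the Poisson
integral of its boundary values. Hence no horizontal `L¹` norm exceeds that of the limit, and almost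
everywhere convergence improves to `L¹` convergence
(`DecayingHardyOne.tendsto_integral_norm_sub_limit`). Integrating the resulting local convergence
against `φ(t)/t` identifies the boundary function of the image. -/

/-! ### Parameter integrals, a maximum principle and sub-mean values. -/

/-- Holomorphic dependence of an integral on a parameter, under a local domination of the integrand
only: the domination of the derivative is supplied by the Cauchy estimate. -/
theorem hasDerivAt_integral_of_holomorphic {α : Type*} [MeasurableSpace α] {μ : Measure α}
    {F : ℂ → α → ℂ} {z₀ : ℂ} {R : ℝ} (hR : 0 < R) {bound : α → ℝ}
    (hmeas : ∀ z ∈ Metric.ball z₀ R, AEStronglyMeasurable (F z) μ)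
    (hdiff : ∀ᵐ a ∂μ, DifferentiableOn ℂ (fun z => F z a) (Metric.ball z₀ R))
    (hbound : ∀ᵐ a ∂μ, ∀ z ∈ Metric.ball z₀ R, ‖F z a‖ ≤ bound a) (hint : Integrable bound μ) :
    Integrable (fun a => deriv (fun z => F z a) z₀) μ ∧
      HasDerivAt (fun z => ∫ a, F z a ∂μ) (∫ a, deriv (fun z => F z a) z₀ ∂μ) z₀ := by
  have h0 : z₀ ∈ Metric.ball z₀ R := Metric.mem_ball_self hR
  have hsub : Metric.ball z₀ (R / 2) ⊆ Metric.ball z₀ R := Metric.ball_subset_ball (by linarith)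
  have hderiv : ∀ᵐ a ∂μ, ∀ z ∈ Metric.ball z₀ (R / 2),
      HasDerivAt (fun z => F z a) (deriv (fun z => F z a) z) z := by
    filter_upwards [hdiff] with a ha z hz
    exact (ha.differentiableAt (Metric.isOpen_ball.mem_nhds (hsub hz))).hasDerivAt
  -- Discs of radius `R / 4` centred in the ball of radius `R / 2` stay inside the ball of radius
  -- `R`, so Cauchy's estimate bounds the derivative by `bound a / (R / 4)`.
  refine hasDerivAt_integral_of_dominated_loc_of_deriv_le (F' := fun z a => deriv (fun z => F z a) z)
    (bound := fun a => bound a / (R / 4))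
    (Metric.ball_mem_nhds z₀ (half_pos hR)) ?_ ?_ ?_ ?_ (hint.div_const _) hderiv
  · filter_upwards [Metric.ball_mem_nhds z₀ hR] with z hz using hmeas z hz
  · exact hint.mono' (hmeas z₀ h0) (hbound.mono fun a ha => ha z₀ h0)
  -- The derivative is measurable in the parameter as a limit of difference quotients along a fixed
  -- sequence.
  · have hseq : Tendsto (fun n : ℕ => z₀ + ((R / 2 / (n + 1) : ℝ) : ℂ)) atTop (𝓝[≠] z₀) := by
      refine tendsto_nhdsWithin_iff.2 ⟨?_, Eventually.of_forall fun n => ?_⟩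
      · have : Tendsto (fun n : ℕ => R / 2 / ((n : ℝ) + 1)) atTop (𝓝 0) :=
          tendsto_const_nhds.div_atTop (tendsto_atTop_add_const_right _ _ tendsto_natCast_atTop_atTop)
        have h2 := (Complex.continuous_ofReal.tendsto 0).comp this
        simpa using h2.const_add z₀
      · have : (R / 2 / (n + 1) : ℝ) ≠ 0 := by positivity
        rw [mem_compl_iff, mem_singleton_iff, add_eq_left]
        exact Complex.ofReal_ne_zero.2 this
    have hmem : ∀ n : ℕ, z₀ + ((R / 2 / (n + 1) : ℝ) : ℂ) ∈ Metric.ball z₀ R := by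
      intro n
      have h1 : (0 : ℝ) < n + 1 := by positivity
      have : R / 2 / (n + 1) ≤ R / 2 := div_le_self (by positivity) (by simp)
      have h3 : 0 < R / 2 / (n + 1) := by positivity
      rw [mem_ball_iff_norm, add_sub_cancel_left, Complex.norm_real, Real.norm_of_nonneg h3.le]
      linarith
    refine aestronglyMeasurable_of_tendsto_ae atTop
      (f := fun (n : ℕ) a => slope (fun z => F z a) z₀ (z₀ + ((R / 2 / (n + 1) : ℝ) : ℂ)))
      (fun n => ?_) ?_
    · simp only [slope, vsub_eq_sub]
      exact ((hmeas _ (hmem n)).sub (hmeas _ h0)).const_smul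
        ((z₀ + ((R / 2 / (n + 1) : ℝ) : ℂ) - z₀)⁻¹)
    · filter_upwards [hderiv] with a ha
      exact (hasDerivAt_iff_tendsto_slope.1 (ha z₀ (Metric.mem_ball_self (half_pos hR)))).comp hseq
  · filter_upwards [hdiff, hbound] with a ha hb z hz
    have hz' : Metric.closedBall z (R / 4) ⊆ Metric.ball z₀ R := by
      intro w hw
      rw [Metric.mem_closedBall] at hw
      rw [Metric.mem_ball] at hz ⊢
      linarith [dist_triangle w z z₀]
    refine Complex.norm_deriv_le_of_forall_mem_sphere_norm_le (by positivity) ?_ fun w hw =>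
      hb w (hz' (Metric.sphere_subset_closedBall hw))
    exact (ha.mono hz').diffContOnCl_ball subset_rfl

/-- A bounded function on the closed upper half-plane, holomorphic inside, is bounded by its
bound on the real axis. -/
theorem norm_le_of_norm_le_real {f : ℂ → ℂ} {C M : ℝ}
    (hd : DifferentiableOn ℂ f {z | 0 < z.im}) (hc : ContinuousOn f {z | 0 ≤ z.im})
    (hM : ∀ z : ℂ, 0 < z.im → ‖f z‖ ≤ M) (hC : ∀ x : ℝ, ‖f x‖ ≤ C) {z : ℂ} (hz : 0 ≤ z.im) :
    ‖f z‖ ≤ C := by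
  have him : ∀ w : ℂ, (Complex.I * w).im = w.re := fun w => by simp
  have key := PhragmenLindelof.right_half_plane_of_bounded_on_real
    (f := fun w => f (Complex.I * w)) (C := C) (z := -Complex.I * z) ?_ ?_ ?_ ?_ (by simpa using hz)
  · have : Complex.I * (-Complex.I * z) = z := by
      rw [← mul_assoc]; simp
    simpa only [this] using key
  · refine ⟨hd.comp (by fun_prop) fun w hw => ?_, ?_⟩
    · simpa [him] using hw
    · rw [Complex.closure_setOfPred_lt_re]
      exact hc.comp (by fun_prop) fun w hw => by simpa [him] using hw
  -- The growth hypothesis is met with order `1 < 2` and factor `0` in the exponent, since the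
  -- function is bounded.
  · refine ⟨1, by norm_num, 0, ?_⟩
    refine Asymptotics.IsBigO.of_bound M ?_
    refine eventually_inf_principal.2 (Eventually.of_forall fun w hw => ?_)
    simpa using hM (Complex.I * w) (by simpa [him] using hw)
  · refine ⟨M, ?_⟩
    simp only [eventually_map]
    filter_upwards [eventually_gt_atTop 0] with x hx
    exact hM _ (by simpa using hx)
  · intro x
    have : Complex.I * (x * Complex.I) = ((-x : ℝ) : ℂ) := by
      rw [mul_left_comm, Complex.I_mul_I]; simp
    simpa only [this] using hC (-x)

/-- Mean value property, with the angle moved by periodicity to `(-π, π)`, the range used by polar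
coordinates. -/
theorem enorm_le_lintegral_circle {f : ℂ → ℂ} {c : ℂ} {R ρ : ℝ} (hρ : 0 ≤ ρ) (hρR : ρ < R)
    (hf : DifferentiableOn ℂ f (Metric.ball c R)) :
    ENNReal.ofReal (2 * Real.pi) * ‖f c‖ₑ ≤
      ∫⁻ θ in Ioo (-Real.pi) Real.pi, ‖f (c + ρ * Complex.exp (θ * Complex.I))‖ₑ := by
  have hsub : Metric.closedBall c ρ ⊆ Metric.ball c R := Metric.closedBall_subset_ball hρR
  have hd : DiffContOnCl ℂ f (Metric.ball c |ρ|) := by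
    rw [abs_of_nonneg hρ]
    exact (hf.mono hsub).diffContOnCl_ball subset_rfl
  have h1 := hd.circleAverage
  have h2 : ∫ θ in (-Real.pi)..Real.pi, f (circleMap c ρ θ) = (2 * Real.pi : ℝ) • f c := by
    have h3 : ∫ θ in (-Real.pi)..Real.pi, f (circleMap c ρ θ) =
        ∫ θ in (0 : ℝ)..2 * Real.pi, f (circleMap c ρ θ) := by
      have hp : Function.Periodic (fun θ => f (circleMap c ρ θ)) (2 * Real.pi) := fun θ => by
        simp [periodic_circleMap c ρ θ]
      have := hp.intervalIntegral_add_eq (-Real.pi) 0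
      convert this using 2 <;> ring
    rw [h3, ← h1, Real.circleAverage_def, smul_smul, mul_inv_cancel₀ (by positivity), one_smul]
  have h4 : ‖(2 * Real.pi : ℝ) • f c‖ₑ = ENNReal.ofReal (2 * Real.pi) * ‖f c‖ₑ := by
    rw [enorm_smul, Real.enorm_of_nonneg (by positivity)]
  rw [← h4, ← h2, intervalIntegral.integral_of_le (by linarith [Real.pi_pos]),
    integral_Ioc_eq_integral_Ioo]
  exact (enorm_integral_le_lintegral_enorm _).trans (le_of_eq (by simp [circleMap]))

/-- The area sub-mean value property of `|f|`. -/
theorem enorm_le_lintegral_ball {f : ℂ → ℂ} {c : ℂ} {R : ℝ} (hR : 0 < R)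
    (hf : DifferentiableOn ℂ f (Metric.ball c R)) :
    ENNReal.ofReal (Real.pi * R ^ 2) * ‖f c‖ₑ ≤ ∫⁻ z in Metric.ball c R, ‖f z‖ₑ := by
  have hm : Measurable ((Metric.ball c R).indicator fun z => ‖f z‖ₑ) := by
    classical
    rw [← piecewise_eq_indicator]
    exact hf.continuousOn.enorm.measurable_piecewise continuousOn_const
      Metric.isOpen_ball.measurableSet
  rw [← lintegral_indicator Metric.isOpen_ball.measurableSet,
    ← lintegral_add_left_eq_self _ c,
    ← Complex.lintegral_comp_polarCoord_symm, polarCoord_target, Measure.volume_eq_prod,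
    ← Measure.prod_restrict, lintegral_prod _ ?_]
  · have hstep : ∀ ρ ∈ Ioo 0 R, ENNReal.ofReal (2 * Real.pi) * ‖f c‖ₑ * ENNReal.ofReal ρ ≤
        ∫⁻ θ in Ioo (-Real.pi) Real.pi, ENNReal.ofReal ρ •
          (Metric.ball c R).indicator (fun z => ‖f z‖ₑ) (c + Complex.polarCoord.symm (ρ, θ)) := by
      intro ρ hρ
      simp only [smul_eq_mul]
      rw [lintegral_const_mul' _ _ ENNReal.ofReal_ne_top, mul_comm]
      gcongr
      refine (enorm_le_lintegral_circle hρ.1.le hρ.2 hf).trans (le_of_eq ?_)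
      refine lintegral_congr fun θ => ?_
      have hE : Complex.polarCoord.symm (ρ, θ) = ρ * Complex.exp (θ * Complex.I) := by
        rw [Complex.polarCoord_symm_apply, Complex.exp_mul_I]
        simp
      rw [hE, indicator_of_mem]
      rw [mem_ball_iff_norm, add_sub_cancel_left, norm_mul, Complex.norm_exp_ofReal_mul_I, mul_one,
        Complex.norm_real, Real.norm_of_nonneg hρ.1.le]
      exact hρ.2
    calc ENNReal.ofReal (Real.pi * R ^ 2) * ‖f c‖ₑ
        = ∫⁻ ρ in Ioo 0 R, ENNReal.ofReal (2 * Real.pi) * ‖f c‖ₑ * ENNReal.ofReal ρ := by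
          rw [lintegral_const_mul _ ENNReal.measurable_ofReal]
          have : ∫⁻ ρ in Ioo 0 R, ENNReal.ofReal ρ = ENNReal.ofReal (R ^ 2 / 2) := by
            rw [← ofReal_integral_eq_lintegral_ofReal, ← integral_Ioc_eq_integral_Ioo,
              ← intervalIntegral.integral_of_le hR.le, integral_id]
            · simp
            · exact (continuous_id.integrableOn_Icc).mono_set Ioo_subset_Icc_self
            · exact (ae_restrict_mem measurableSet_Ioo).mono fun x hx => hx.1.le
          rw [this, mul_right_comm, ← ENNReal.ofReal_mul (by positivity)]
          congr 2
          ring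
      _ ≤ ∫⁻ ρ in Ioo 0 R, ∫⁻ θ in Ioo (-Real.pi) Real.pi, ENNReal.ofReal ρ •
          (Metric.ball c R).indicator (fun z => ‖f z‖ₑ) (c + Complex.polarCoord.symm (ρ, θ)) :=
          setLIntegral_mono' measurableSet_Ioo hstep
      _ ≤ _ := lintegral_mono_set Ioo_subset_Ioi_self
  · refine Measurable.aemeasurable ?_
    simp only [smul_eq_mul]
    refine (ENNReal.measurable_ofReal.comp measurable_fst).mul (hm.comp ?_)
    have : Measurable fun p : ℝ × ℝ => Complex.polarCoord.symm p := by
      simp_rw [Complex.polarCoord_symm_apply]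
      fun_prop
    exact this.const_add c

/-! ### Horizontal lines and the pointwise growth of Hardy functions. -/

theorem add_mul_I_mem_upperHalfPlaneSet (x : ℝ) {y : ℝ} (hy : 0 < y) :
    (x + y * Complex.I : ℂ) ∈ upperHalfPlaneSet := by
  simpa [upperHalfPlaneSet] using hy

theorem isOpen_upperHalfPlane_im : IsOpen {z : ℂ | 0 < z.im} :=
  isOpen_lt continuous_const Complex.continuous_im

theorem continuous_horizontal_line {f : ℂ → ℂ} (hf : ContinuousOn f {z : ℂ | 0 < z.im})
    {y : ℝ} (hy : 0 < y) : Continuous fun x : ℝ => f (x + y * Complex.I) :=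
  hf.comp_continuous (by fun_prop) fun x => by simpa using hy

theorem eLpNorm_line_le_hardyNorm {p : ℝ≥0∞} (hp : 1 ≤ p) (f : ℂ → ℂ) {y : ℝ} (hy : 0 < y) :
    eLpNorm (fun x : ℝ => f (x + y * Complex.I)) p volume ≤ hardyNorm p f := by
  by_cases h : p = ∞
  · rw [hardyNorm, if_pos h, h, eLpNorm_exponent_top]
    refine eLpNormEssSup_le_of_ae_enorm_bound (Eventually.of_forall fun x => ?_)
    exact le_iSup₂ (f := fun z (_ : z ∈ upperHalfPlaneSet) => ‖f z‖ₑ) _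
      (add_mul_I_mem_upperHalfPlaneSet x hy)
  · rw [hardyNorm, if_neg h, eLpNorm_eq_lintegral_rpow_enorm_toReal (by positivity) h]
    exact le_iSup₂ (f := fun (y : ℝ) (_ : y ∈ Ioi (0 : ℝ)) =>
      (∫⁻ x : ℝ, ‖f (x + y * Complex.I)‖ₑ ^ p.toReal) ^ (1 / p.toReal)) y hy

theorem toReal_inv_eq_one_div (p : ℝ≥0∞) : p⁻¹.toReal = 1 / p.toReal := by
  rw [ENNReal.toReal_inv, one_div]

theorem toReal_inv_le_one {p : ℝ≥0∞} (hp : 1 ≤ p) : p⁻¹.toReal ≤ 1 := by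
  have : p⁻¹ ≤ 1 := ENNReal.inv_le_one.2 hp
  simpa using ENNReal.toReal_mono ENNReal.one_ne_top this

/-- Hölder's inequality on an interval. -/
theorem lintegral_Ioo_enorm_le {p : ℝ≥0∞} (hp : 1 ≤ p) {g : ℝ → ℂ} (hg : AEStronglyMeasurable g)
    (a b : ℝ) : ∫⁻ x in Ioo a b, ‖g x‖ₑ ≤
      eLpNorm g p volume * ENNReal.ofReal (b - a) ^ (1 - p⁻¹.toReal) := by
  have h := eLpNorm_le_eLpNorm_mul_rpow_measure_univ hp (hg.restrict (s := Ioo a b))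
  rw [eLpNorm_one_eq_lintegral_enorm, Measure.restrict_apply_univ, Real.volume_Ioo,
    ENNReal.toReal_one, div_one, ← toReal_inv_eq_one_div] at h
  refine h.trans ?_
  gcongr
  exact Measure.restrict_le_self

theorem lintegral_ball_enorm_le {f : ℂ → ℂ} {c : ℂ} {r : ℝ} (hr : r < c.im)
    (hf : ContinuousOn f {z : ℂ | 0 < z.im}) :
    ∫⁻ z in Metric.ball c r, ‖f z‖ₑ ≤ ∫⁻ y in Ioo (c.im - r) (c.im + r),
      ∫⁻ x in Ioo (c.re - r) (c.re + r), ‖f (x + y * Complex.I)‖ₑ := by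
  have hsub : Metric.ball c r ⊆ Complex.measurableEquivRealProd ⁻¹'
      (Ioo (c.re - r) (c.re + r) ×ˢ Ioo (c.im - r) (c.im + r)) := by
    intro z hz
    rw [mem_ball_iff_norm] at hz
    have h1 := (Complex.abs_re_le_norm (z - c)).trans_lt hz
    have h2 := (Complex.abs_im_le_norm (z - c)).trans_lt hz
    rw [Complex.sub_re, abs_lt] at h1
    rw [Complex.sub_im, abs_lt] at h2
    simp only [mem_preimage, Complex.measurableEquivRealProd_apply, mem_prod, mem_Ioo]
    exact ⟨⟨by linarith, by linarith⟩, by linarith, by linarith⟩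
  refine (lintegral_mono_set hsub).trans (le_of_eq ?_)
  have h := Complex.volume_preserving_equiv_real_prod.setLIntegral_comp_preimage_emb
    Complex.measurableEquivRealProd.measurableEmbedding
    (fun q : ℝ × ℝ => ‖f (q.1 + q.2 * Complex.I)‖ₑ)
    (Ioo (c.re - r) (c.re + r) ×ˢ Ioo (c.im - r) (c.im + r))
  simp only [Complex.measurableEquivRealProd_apply, Complex.re_add_im] at h
  rw [h, Measure.volume_eq_prod, ← Measure.prod_restrict, lintegral_prod_symm]
  rw [Measure.prod_restrict]
  refine ContinuousOn.aemeasurable ?_ (measurableSet_Ioo.prod measurableSet_Ioo)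
  refine ContinuousOn.enorm (hf.comp (by fun_prop : Continuous fun q : ℝ × ℝ =>
    (q.1 + q.2 * Complex.I : ℂ)).continuousOn fun q hq => ?_)
  have := hq.2.1
  simp only [mem_ofPred_eq, Complex.add_im, Complex.ofReal_im, Complex.mul_im, Complex.ofReal_re,
    Complex.I_im, Complex.I_re]
  linarith

/-- The disc of radius `y / 2` about `z` lies in a square of side `y` above the axis. The area
sub-mean value property, with Hölder on each horizontal segment of the square, gives `(π / 4) y²
|f(z)| ≤ N y · y^(1 - 1/p)`, and `4 / π ≤ 2`. -/
theorem MemHardy.norm_le {p : ℝ≥0∞} (hp : 1 ≤ p) {f : ℂ → ℂ} (hf : MemHardy p f) {z : ℂ}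
    (hz : 0 < z.im) :
    ‖f z‖ ≤ 2 * (hardyNorm p f).toReal * z.im ^ (-p⁻¹.toReal) := by
  set q := p⁻¹.toReal
  set y := z.im
  set N := hardyNorm p f
  have hN : N ≠ ∞ := hf.2.ne
  have hball : Metric.ball z (y / 2) ⊆ {z : ℂ | 0 < z.im} := by
    intro w hw
    rw [mem_ball_iff_norm] at hw
    have h2 := (Complex.abs_im_le_norm (w - z)).trans_lt hw
    rw [Complex.sub_im, abs_lt] at h2
    simp only [mem_ofPred_eq]
    linarith
  have h1 := enorm_le_lintegral_ball (half_pos hz) (hf.1.mono hball)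
  have h2 := lintegral_ball_enorm_le (r := y / 2) (c := z) (half_lt_self hz) hf.1.continuousOn
  have h3 : ∫⁻ v in Ioo (y - y / 2) (y + y / 2),
      ∫⁻ x in Ioo (z.re - y / 2) (z.re + y / 2), ‖f (x + v * Complex.I)‖ₑ ≤
      ∫⁻ v in Ioo (y - y / 2) (y + y / 2), N * ENNReal.ofReal y ^ (1 - q) := by
    refine setLIntegral_mono' measurableSet_Ioo fun v hv => ?_
    have hv0 : 0 < v := by linarith [hv.1]
    refine (lintegral_Ioo_enorm_le hp
      (continuous_horizontal_line hf.1.continuousOn hv0).aestronglyMeasurable _ _).trans ?_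
    have : z.re + y / 2 - (z.re - y / 2) = y := by ring
    rw [this]
    gcongr
    exact eLpNorm_line_le_hardyNorm hp f hv0
  have h4 := h1.trans (h2.trans h3)
  rw [lintegral_const, Measure.restrict_apply_univ, Real.volume_Ioo] at h4
  have e1 : y + y / 2 - (y - y / 2) = y := by ring
  rw [e1, ENNReal.ofReal_rpow_of_pos hz] at h4
  have h5 := ENNReal.toReal_mono (by finiteness) h4
  rw [ENNReal.toReal_mul, ENNReal.toReal_mul, ENNReal.toReal_mul,
    ENNReal.toReal_ofReal (by positivity), ENNReal.toReal_ofReal (by positivity),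
    ENNReal.toReal_ofReal hz.le, toReal_enorm] at h5
  have e2 : y ^ (1 - q) = y * y ^ (-q) := by
    rw [sub_eq_add_neg, Real.rpow_add hz, Real.rpow_one]
  rw [e2] at h5
  have h6 : Real.pi / 4 * ‖f z‖ ≤ N.toReal * y ^ (-q) := by
    have hy2 : 0 < y ^ 2 := by positivity
    refine le_of_mul_le_mul_left ?_ hy2
    calc y ^ 2 * (Real.pi / 4 * ‖f z‖) = Real.pi * (y / 2) ^ 2 * ‖f z‖ := by ring
      _ ≤ _ := h5
      _ = _ := by ring
  nlinarith [Real.pi_gt_three, norm_nonneg (f z)]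

/-! ### Fatou's theorem by means of second primitives. -/

/-- If `D` has a vanishing second order Peano expansion at `0` along the real axis, then its second
derivative tends to `0` vertically. -/
theorem tendsto_deriv_deriv_of_peano {D : ℂ → ℂ} {M : ℝ}
    (hd : DifferentiableOn ℂ D {z | 0 < z.im}) (hc : ContinuousOn D {z | 0 ≤ z.im})
    (hM : ∀ z : ℂ, 0 ≤ z.im → ‖D z‖ ≤ M * (1 + ‖z‖ ^ 2))
    (hP : ∀ ε > 0, ∃ ρ > 0, ∀ t : ℝ, |t| < ρ → ‖D t‖ ≤ ε * t ^ 2) :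
    Tendsto (fun r : ℝ => deriv (deriv D) (r * Complex.I)) (𝓝[>] 0) (𝓝 0) := by
  have hM0 : 0 ≤ M := by simpa using (norm_nonneg _).trans (hM 0 le_rfl)
  have key : ∀ ε > 0, ∀ᶠ r : ℝ in 𝓝[>] 0, ‖deriv (deriv D) (r * Complex.I)‖ ≤ 256 * ε := by
    intro ε hε
    obtain ⟨ρ, hρ, hρD⟩ := hP ε hε
    -- For `|t| ≥ ρ` the global growth reads `‖D t‖ ≤ C t²`; the later smallness of `r` makes `C /
    -- ρ` negligible against `ε / r`.
    set C := M * (1 + 1 / ρ ^ 2)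
    have hC0 : 0 ≤ C := by positivity
    have hpos : 0 < ε * ρ / (C + 1) := by positivity
    filter_upwards [Ioo_mem_nhdsGT hpos] with r hr
    have hr0 : 0 < r := hr.1
    have hrC : C / ρ ≤ ε / r := by
      rw [div_le_div_iff₀ hρ hr0]
      have := hr.2
      rw [lt_div_iff₀ (by positivity)] at this
      nlinarith
    have hlow : ∀ z : ℂ, 0 ≤ z.im → r ≤ ‖z + r * Complex.I‖ ∧ ‖z‖ ≤ ‖z + r * Complex.I‖ := by
      intro z hz
      constructor
      · refine le_trans ?_ (Complex.abs_im_le_norm _)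
        rw [abs_of_nonneg] <;> simp <;> linarith
      · rw [← sq_le_sq₀ (norm_nonneg _) (norm_nonneg _), ← Complex.normSq_eq_norm_sq,
          ← Complex.normSq_eq_norm_sq, Complex.normSq_apply, Complex.normSq_apply]
        simp
        nlinarith
    have hne : ∀ z : ℂ, 0 ≤ z.im → (z + r * Complex.I) ^ 3 ≠ 0 := by
      intro z hz
      exact pow_ne_zero 3 (norm_pos_iff.1 (hr0.trans_le (hlow z hz).1))
    -- The denominator vanishes only at `-ri`. The cube makes the quotient bounded in the half-plane
    -- despite the quadratic growth of `D`, and on the axis the expansion bounds it by `ε / r`; the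
    -- maximum principle then applies.
    have hQ : ∀ z : ℂ, 0 ≤ z.im → ‖D z / (z + r * Complex.I) ^ 3‖ ≤ ε / r := by
      intro z hz
      refine norm_le_of_norm_le_real (f := fun z => D z / (z + r * Complex.I) ^ 3)
        (M := M * (1 / r ^ 3 + 1 / r))
        (hd.div (by fun_prop) fun z hz => hne z (le_of_lt hz))
        (hc.div (by fun_prop) fun z hz => hne z hz) (fun z hz => ?_) (fun t => ?_) hz
      · obtain ⟨h1, h2⟩ := hlow z hz.le
        rw [norm_div, norm_pow]
        set b := ‖z + r * Complex.I‖
        have hb : 0 < b := hr0.trans_le h1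
        calc ‖D z‖ / b ^ 3 ≤ M * (1 + b ^ 2) / b ^ 3 := by
              gcongr
              exact (hM z hz.le).trans (by gcongr)
          _ = M * (1 / b ^ 3 + 1 / b) := by field_simp
          _ ≤ _ := by gcongr
      · obtain ⟨h1, h2⟩ := hlow t (by simp)
        rw [Complex.norm_real, Real.norm_eq_abs] at h2
        rw [norm_div, norm_pow]
        set b := ‖(t : ℂ) + r * Complex.I‖
        have hb : 0 < b := hr0.trans_le h1
        have ht2 : t ^ 2 ≤ b ^ 2 := by
          rw [← sq_abs t]; gcongr
        rcases lt_or_ge |t| ρ with ht | ht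
        · calc ‖D t‖ / b ^ 3 ≤ ε * b ^ 2 / b ^ 3 := by
                gcongr
                exact (hρD t ht).trans (by gcongr)
            _ = ε / b := by field_simp
            _ ≤ ε / r := by gcongr
        · refine le_trans ?_ hrC
          have hDt : ‖D t‖ ≤ C * t ^ 2 := by
            refine (hM t (by simp)).trans ?_
            rw [Complex.norm_real, Real.norm_eq_abs, sq_abs, mul_assoc]
            gcongr
            have : 1 ≤ 1 / ρ ^ 2 * t ^ 2 := by
              rw [one_div, inv_mul_eq_div, one_le_div (by positivity), ← sq_abs t]
              gcongr
            linarith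
          calc ‖D t‖ / b ^ 3 ≤ C * b ^ 2 / b ^ 3 := by
                gcongr
                exact hDt.trans (by gcongr)
            _ = C / b := by field_simp
            _ ≤ C / ρ := by gcongr; exact ht.trans h2
    have him : ∀ z ∈ Metric.closedBall (r * Complex.I) (r / 2), 0 < z.im := by
      intro z hz
      rw [mem_closedBall_iff_norm] at hz
      have h2 := (Complex.abs_im_le_norm _).trans hz
      simp [abs_le] at h2
      linarith
    -- Near `ri` the denominator has size comparable to `r³`, so `D` is of order `ε r²`; two Cauchy
    -- estimates on discs of radius `r / 4` multiply this by `16 / r²`.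
    have hD : ∀ z ∈ Metric.closedBall (r * Complex.I) (r / 2), ‖D z‖ ≤ 16 * ε * r ^ 2 := by
      intro z hz
      have h1 := hQ z (him z hz).le
      have h3 := hne z (him z hz).le
      rw [norm_div, div_le_iff₀ (norm_pos_iff.2 h3), norm_pow] at h1
      have h4 : ‖z + r * Complex.I‖ ≤ 5 / 2 * r := by
        have : z + r * Complex.I = (z - r * Complex.I) + ((2 * r : ℝ) : ℂ) * Complex.I := by
          push_cast; ring
        rw [this]
        rw [mem_closedBall_iff_norm] at hz
        refine (norm_add_le _ _).trans ?_
        rw [norm_mul, Complex.norm_I, Complex.norm_real, Real.norm_of_nonneg (by positivity)]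
        linarith
      calc ‖D z‖ ≤ ε / r * ‖z + r * Complex.I‖ ^ 3 := h1
        _ ≤ ε / r * (5 / 2 * r) ^ 3 := by gcongr
        _ = 125 / 8 * ε * r ^ 2 := by field_simp; ring
        _ ≤ _ := by gcongr; norm_num
    have hsub : ∀ w ∈ Metric.closedBall (r * Complex.I) (r / 4),
        Metric.closedBall w (r / 4) ⊆ Metric.closedBall (r * Complex.I) (r / 2) := by
      intro w hw
      refine Metric.closedBall_subset_closedBall' ?_
      rw [Metric.mem_closedBall] at hw
      linarith
    have hD' : ∀ w ∈ Metric.closedBall (r * Complex.I) (r / 4), ‖deriv D w‖ ≤ 64 * ε * r := by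
      intro w hw
      have := Complex.norm_deriv_le_of_forall_mem_sphere_norm_le (f := D) (c := w) (R := r / 4)
        (C := 16 * ε * r ^ 2) (by positivity)
        ((hd.mono fun z hz => him z (hsub w hw hz)).diffContOnCl_ball subset_rfl)
        fun z hz => hD z (hsub w hw (Metric.sphere_subset_closedBall hz))
      refine this.trans (le_of_eq ?_)
      field_simp
      ring
    have hdd : DifferentiableOn ℂ (deriv D) {z | 0 < z.im} := hd.deriv isOpen_upperHalfPlane_im
    have := Complex.norm_deriv_le_of_forall_mem_sphere_norm_le (f := deriv D) (c := r * Complex.I)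
      (R := r / 4) (C := 64 * ε * r) (by positivity)
      ((hdd.mono fun z hz => him z (Metric.closedBall_subset_closedBall
        (by linarith) hz)).diffContOnCl_ball subset_rfl)
      fun z hz => hD' z (Metric.sphere_subset_closedBall hz)
    refine this.trans (le_of_eq ?_)
    field_simp
    ring
  rw [Metric.tendsto_nhds]
  intro ε hε
  filter_upwards [key (ε / 512) (by positivity)] with r hr
  rw [dist_zero_right]
  linarith

/-- Holomorphic functions with uniformly integrable horizontal traces that decay at infinity and
blow up at most like `1 / y` at the real axis. -/
structure DecayingHardyOne (A B : ℝ) (g : ℂ → ℂ) : Prop where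
  diff : DifferentiableOn ℂ g {z | 0 < z.im}
  decay : ∀ z : ℂ, 0 < z.im → ‖g z‖ ≤ A / (z.im * (1 + z.im) ^ 2)
  lintegral_le : ∀ y : ℝ, 0 < y → ∫⁻ x : ℝ, ‖g (x + y * Complex.I)‖ₑ ≤ ENNReal.ofReal B

/-- The primitive of `g` vanishing at `i∞`. -/
noncomputable def verticalPrimitive (g : ℂ → ℂ) (z : ℂ) : ℂ :=
  -Complex.I * ∫ s in Ioi (0 : ℝ), g (z + s * Complex.I)

/-- The second primitive of `g` vanishing at `i∞`. -/
noncomputable def verticalPrimitive₂ (g : ℂ → ℂ) (z : ℂ) : ℂ :=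
  -∫ s in Ioi (0 : ℝ), s * g (z + s * Complex.I)

namespace DecayingHardyOne

variable {A B : ℝ} {g : ℂ → ℂ}

theorem A_nonneg (hg : DecayingHardyOne A B g) : 0 ≤ A := by
  have := (norm_nonneg _).trans (hg.decay Complex.I (by simp))
  rw [Complex.I_im] at this
  by_contra! h
  exact absurd this (not_le.2 (div_neg_of_neg_of_pos h (by norm_num)))

theorem differentiableAt (hg : DecayingHardyOne A B g) {z : ℂ} (hz : 0 < z.im) :
    DifferentiableAt ℂ g z :=
  hg.diff.differentiableAt (isOpen_upperHalfPlane_im.mem_nhds hz)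

theorem continuousOn_vertical (hg : DecayingHardyOne A B g) {z : ℂ} (hz : 0 ≤ z.im) :
    ContinuousOn (fun s : ℝ => g (z + s * Complex.I)) (Ioi 0) := by
  refine hg.diff.continuousOn.comp (by fun_prop) fun s hs => ?_
  have : 0 < s := hs
  simp; linarith

theorem aestronglyMeasurable_vertical (hg : DecayingHardyOne A B g) {z : ℂ} (hz : 0 ≤ z.im) :
    AEStronglyMeasurable (fun s : ℝ => g (z + s * Complex.I)) (volume.restrict (Ioi 0)) :=
  (hg.continuousOn_vertical hz).aestronglyMeasurable measurableSet_Ioi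

theorem norm_vertical_le (hg : DecayingHardyOne A B g) {z : ℂ} {y : ℝ} (hy : 0 ≤ y)
    (hz : y ≤ z.im) {s : ℝ} (hs : 0 < s) :
    ‖g (z + s * Complex.I)‖ ≤ A / (y + s) * (1 + s ^ 2)⁻¹ := by
  have hA := hg.A_nonneg
  have him : (z + s * Complex.I).im = z.im + s := by simp
  refine (hg.decay _ (by rw [him]; linarith)).trans ?_
  rw [him, ← div_div, ← div_eq_mul_inv]
  gcongr
  nlinarith

theorem norm_mul_vertical_le (hg : DecayingHardyOne A B g) {z : ℂ} (hz : 0 ≤ z.im) {s : ℝ}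
    (hs : 0 < s) : ‖s * g (z + s * Complex.I)‖ ≤ A * (1 + s ^ 2)⁻¹ := by
  have := hg.norm_vertical_le le_rfl hz hs
  rw [norm_mul, Complex.norm_real, Real.norm_of_nonneg hs.le]
  calc s * ‖g (z + s * Complex.I)‖ ≤ s * (A / (0 + s) * (1 + s ^ 2)⁻¹) := by gcongr
    _ = _ := by rw [zero_add]; field_simp

/-- Serves both primitives, with `w = 1` and `w s = s`. The hypothesis `hwc` says that `w`
compensates the factor `1 / (y + s)` in the bound for `g`, leaving the integrable majorant `1 / (1 +
s²)`. -/
theorem hasDerivAt_integral_vertical (hg : DecayingHardyOne A B g) {z₀ : ℂ} (hz : 0 < z₀.im)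
    {w : ℝ → ℂ} (hw : Continuous w) {c : ℝ}
    (hwc : ∀ s > 0, ‖w s‖ / (z₀.im / 2 + s) ≤ c) :
    IntegrableOn (fun s : ℝ => w s * g (z₀ + s * Complex.I)) (Ioi 0) ∧
    IntegrableOn (fun s : ℝ => w s * deriv g (z₀ + s * Complex.I)) (Ioi 0) ∧
    HasDerivAt (fun z => ∫ s in Ioi (0 : ℝ), w s * g (z + s * Complex.I))
      (∫ s in Ioi (0 : ℝ), w s * deriv g (z₀ + s * Complex.I)) z₀ := by
  have him : ∀ z ∈ Metric.ball z₀ (z₀.im / 2), z₀.im / 2 ≤ z.im := by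
    intro z hz
    rw [mem_ball_iff_norm] at hz
    have h2 := (Complex.abs_im_le_norm _).trans_lt hz
    rw [Complex.sub_im, abs_lt] at h2
    linarith
  have hA := hg.A_nonneg
  have hsum : ∀ z : ℂ, 0 < z.im → ∀ s : ℝ, 0 < s → 0 < (z + s * Complex.I).im := by
    intro z hz s hs
    simp; linarith
  have hmeas : ∀ z : ℂ, 0 < z.im → AEStronglyMeasurable
      (fun s : ℝ => w s * g (z + s * Complex.I)) (volume.restrict (Ioi 0)) := fun z hz =>
    hw.aestronglyMeasurable.mul (hg.aestronglyMeasurable_vertical hz.le)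
  have hbd : ∀ z ∈ Metric.ball z₀ (z₀.im / 2), ∀ s : ℝ, 0 < s →
      ‖w s * g (z + s * Complex.I)‖ ≤ c * A * (1 + s ^ 2)⁻¹ := by
    intro z hz' s hs
    rw [norm_mul]
    calc ‖w s‖ * ‖g (z + s * Complex.I)‖
        ≤ ‖w s‖ * (A / (z₀.im / 2 + s) * (1 + s ^ 2)⁻¹) := by
          gcongr
          exact hg.norm_vertical_le (half_pos hz).le (him z hz') hs
      _ = ‖w s‖ / (z₀.im / 2 + s) * (A * (1 + s ^ 2)⁻¹) := by ring
      _ ≤ c * (A * (1 + s ^ 2)⁻¹) := by gcongr; exact hwc s hs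
      _ = _ := by ring
  have hint : IntegrableOn (fun s : ℝ => c * A * (1 + s ^ 2)⁻¹) (Ioi 0) :=
    (integrable_inv_one_add_sq.const_mul _).integrableOn
  have hderiv : ∀ s : ℝ, 0 < s → ∀ z : ℂ, 0 < z.im →
      HasDerivAt (fun z => w s * g (z + s * Complex.I)) (w s * deriv g (z + s * Complex.I)) z := by
    intro s hs z hz
    have h1 := (hg.differentiableAt (hsum z hz s hs)).hasDerivAt
    exact (h1.comp_add_const z (s * Complex.I)).const_mul (w s)
  have key := hasDerivAt_integral_of_holomorphic (μ := volume.restrict (Ioi (0 : ℝ)))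
    (F := fun z s => w s * g (z + s * Complex.I)) (z₀ := z₀) (half_pos hz)
    (bound := fun s => c * A * (1 + s ^ 2)⁻¹)
    (fun z hz' => hmeas z ((half_pos hz).trans_le (him z hz')))
    ((ae_restrict_mem measurableSet_Ioi).mono fun s hs z hz' =>
      (hderiv s hs z ((half_pos hz).trans_le (him z hz'))).differentiableAt.differentiableWithinAt)
    ((ae_restrict_mem measurableSet_Ioi).mono fun s hs z hz' => hbd z hz' s hs) hint
  have hcongr : (fun s : ℝ => deriv (fun z => w s * g (z + s * Complex.I)) z₀)
      =ᵐ[volume.restrict (Ioi 0)] fun s => w s * deriv g (z₀ + s * Complex.I) :=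
    (ae_restrict_mem measurableSet_Ioi).mono fun s hs => (hderiv s hs z₀ hz).deriv
  refine ⟨?_, key.1.congr hcongr, ?_⟩
  · exact hint.mono' (hmeas z₀ hz) ((ae_restrict_mem measurableSet_Ioi).mono fun s hs =>
      hbd z₀ (Metric.mem_ball_self (half_pos hz)) s hs)
  · rw [← integral_congr_ae hcongr]
    exact key.2

theorem hasDerivAt_comp_vertical (hg : DecayingHardyOne A B g) {z : ℂ} (hz : 0 < z.im) {s : ℝ}
    (hs : 0 ≤ s) : HasDerivAt (fun s : ℝ => g (z + s * Complex.I))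
      (Complex.I * deriv g (z + s * Complex.I)) s := by
  have h1 : HasDerivAt g (deriv g (z + s * Complex.I)) (z + s * Complex.I) :=
    (hg.differentiableAt (by simp; linarith)).hasDerivAt
  have h2 : HasDerivAt (fun s : ℝ => z + s * Complex.I) Complex.I s := by
    simpa using ((Complex.ofRealCLM.hasDerivAt (x := s)).mul_const Complex.I).const_add z
  rw [mul_comm]
  exact h1.comp s h2

theorem tendsto_vertical (hg : DecayingHardyOne A B g) {z : ℂ} (hz : 0 ≤ z.im) :
    Tendsto (fun s : ℝ => s * g (z + s * Complex.I)) atTop (𝓝 0) := by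
  refine squeeze_zero_norm' ((eventually_gt_atTop 0).mono fun s hs =>
    hg.norm_mul_vertical_le hz hs) ?_
  have h : Tendsto (fun s : ℝ => 1 + s ^ 2) atTop atTop :=
    tendsto_atTop_add_const_left _ _ (tendsto_pow_atTop two_ne_zero)
  simpa using h.inv_tendsto_atTop.const_mul A

theorem hasDerivAt_verticalPrimitive (hg : DecayingHardyOne A B g) {z : ℂ} (hz : 0 < z.im) :
    HasDerivAt (verticalPrimitive g) (g z) z := by
  obtain ⟨h1, h2, h3⟩ := hg.hasDerivAt_integral_vertical hz (w := fun _ => 1) continuous_const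
    (c := 2 / z.im) (fun s hs => by
      rw [norm_one, show 2 / z.im = 1 / (z.im / 2) by field_simp]
      gcongr
      linarith)
  simp only [one_mul] at h1 h2 h3
  have hlim : Tendsto (fun s : ℝ => g (z + s * Complex.I)) atTop (𝓝 0) := by
    refine squeeze_zero_norm' (a := fun s : ℝ => ‖s * g (z + s * Complex.I)‖)
      ((eventually_ge_atTop 1).mono fun s hs => ?_) (by simpa using (hg.tendsto_vertical hz.le).norm)
    rw [norm_mul, Complex.norm_real, Real.norm_of_nonneg (by linarith)]
    exact le_mul_of_one_le_left (norm_nonneg _) hs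
  have h4 := integral_Ioi_of_hasDerivAt_of_tendsto' (a := 0)
    (fun s hs => hg.hasDerivAt_comp_vertical hz hs) (h2.const_mul Complex.I) hlim
  rw [integral_const_mul] at h4
  have h5 : HasDerivAt (verticalPrimitive g) _ z := h3.const_mul (-Complex.I)
  rw [neg_mul, h4] at h5
  simpa using h5

/-- Integration by parts along the vertical ray, from `d/ds (s g) = g + i s g'`: the boundary term
vanishes at `0` because of the factor `s` and at infinity by decay. -/
theorem hasDerivAt_verticalPrimitive₂ (hg : DecayingHardyOne A B g) {z : ℂ} (hz : 0 < z.im) :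
    HasDerivAt (verticalPrimitive₂ g) (verticalPrimitive g z) z := by
  obtain ⟨h1, h2, h3⟩ := hg.hasDerivAt_integral_vertical hz (w := fun s => (s : ℂ))
    Complex.continuous_ofReal
    (c := 1) (fun s hs => by
      rw [Complex.norm_real, Real.norm_of_nonneg hs.le, div_le_one (by linarith)]
      linarith)
  obtain ⟨h1', -, -⟩ := hg.hasDerivAt_integral_vertical hz (w := fun _ => 1) continuous_const
    (c := 2 / z.im) (fun s hs => by
      rw [norm_one, show 2 / z.im = 1 / (z.im / 2) by field_simp]
      gcongr
      linarith)
  simp only [one_mul] at h1'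
  have h4 := integral_Ioi_of_hasDerivAt_of_tendsto' (a := 0)
    (fun s hs => (Complex.ofRealCLM.hasDerivAt (x := s)).mul (hg.hasDerivAt_comp_vertical hz hs))
    ?_ (hg.tendsto_vertical hz.le)
  · simp only [Complex.ofRealCLM_apply, Complex.ofReal_one, one_mul, Pi.mul_apply,
      Complex.ofReal_zero, zero_mul, sub_zero] at h4
    have e : ∀ s : ℝ, (s : ℂ) * (Complex.I * deriv g (z + s * Complex.I)) =
        Complex.I * (s * deriv g (z + s * Complex.I)) := fun s => by ring
    simp only [e] at h4
    rw [integral_add h1' (h2.const_mul Complex.I), integral_const_mul] at h4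
    have h5 : HasDerivAt (verticalPrimitive₂ g) _ z := h3.neg
    convert h5 using 1
    rw [verticalPrimitive]
    set p := ∫ s in Ioi (0 : ℝ), g (z + s * Complex.I)
    set q := ∫ s in Ioi (0 : ℝ), (s : ℂ) * deriv g (z + s * Complex.I)
    linear_combination (-Complex.I) * h4 + q * Complex.I_mul_I
  · simp only [Complex.ofRealCLM_apply, Complex.ofReal_one, one_mul]
    refine h1'.add ?_
    have e : ∀ s : ℝ, (s : ℂ) * (Complex.I * deriv g (z + s * Complex.I)) =
        Complex.I * (s * deriv g (z + s * Complex.I)) := fun s => by ring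
    simp only [e]
    exact h2.const_mul Complex.I

/-- The factor `s` cancels the singularity of `g` at the axis, so one majorant works up to and
including the axis. The first primitive has no such majorant, which is the reason for integrating
twice. -/
theorem continuousOn_verticalPrimitive₂ (hg : DecayingHardyOne A B g) :
    ContinuousOn (verticalPrimitive₂ g) {z | 0 ≤ z.im} := by
  intro z hz
  refine ContinuousWithinAt.neg ?_
  refine continuousWithinAt_of_dominated (bound := fun s => A * (1 + s ^ 2)⁻¹) ?_ ?_
    (integrable_inv_one_add_sq.const_mul _).integrableOn ?_
  · filter_upwards [self_mem_nhdsWithin] with w hw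
    exact Complex.continuous_ofReal.aestronglyMeasurable.mul (hg.aestronglyMeasurable_vertical hw)
  · filter_upwards [self_mem_nhdsWithin] with w hw
    exact (ae_restrict_mem measurableSet_Ioi).mono fun s hs => hg.norm_mul_vertical_le hw hs
  · refine (ae_restrict_mem measurableSet_Ioi).mono fun s hs => ?_
    refine ContinuousAt.continuousWithinAt (continuousAt_const.mul ?_)
    have h1 : 0 < (z + s * Complex.I).im := by
      have h2 : 0 < s := hs
      have h3 : 0 ≤ z.im := hz
      simp; linarith
    exact (hg.differentiableAt h1).continuousAt.comp (f := fun z => z + s * Complex.I) (by fun_prop)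

theorem norm_verticalPrimitive₂_le (hg : DecayingHardyOne A B g) {z : ℂ} (hz : 0 ≤ z.im) :
    ‖verticalPrimitive₂ g z‖ ≤ ∫ s in Ioi (0 : ℝ), A * (1 + s ^ 2)⁻¹ := by
  rw [verticalPrimitive₂, norm_neg]
  exact norm_integral_le_of_norm_le (integrable_inv_one_add_sq.const_mul _).integrableOn
    ((ae_restrict_mem measurableSet_Ioi).mono fun s hs => hg.norm_mul_vertical_le hz hs)

end DecayingHardyOne

theorem aestronglyMeasurable_of_tendsto_vertical {f : ℂ → ℂ}
    (hf : ContinuousOn f {z : ℂ | 0 < z.im}) {b : ℝ → ℂ}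
    (h : ∀ᵐ x : ℝ, Tendsto (fun y : ℝ => f (x + y * Complex.I)) (𝓝[>] 0) (𝓝 (b x))) :
    AEStronglyMeasurable b := by
  have hseq : Tendsto (fun n : ℕ => 1 / ((n : ℝ) + 1)) atTop (𝓝[>] 0) :=
    tendsto_nhdsWithin_iff.2 ⟨tendsto_one_div_add_atTop_nhds_zero_nat,
      Eventually.of_forall fun n => show (0 : ℝ) < 1 / ((n : ℝ) + 1) by positivity⟩
  refine aestronglyMeasurable_of_tendsto_ae atTop
    (f := fun (n : ℕ) (x : ℝ) => f (x + ((1 / ((n : ℝ) + 1) : ℝ) : ℂ) * Complex.I))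
    (fun n => (continuous_horizontal_line hf (by positivity)).aestronglyMeasurable) ?_
  exact h.mono fun x hx => hx.comp hseq

namespace DecayingHardyOne

variable {A B : ℝ} {g : ℂ → ℂ}

/-- The real points at which `g` is integrable along the vertical half-line. -/
def goodPoints (g : ℂ → ℂ) : Set ℝ :=
  {x : ℝ | ∫⁻ s in Ioc (0 : ℝ) 1, ‖g (x + s * Complex.I)‖ₑ < ∞}

theorem aemeasurable_enorm_plane (hg : DecayingHardyOne A B g) :
    AEMeasurable (fun q : ℝ × ℝ => ‖g (q.1 + q.2 * Complex.I)‖ₑ)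
      ((volume : Measure ℝ).prod (volume.restrict (Ioc 0 1))) := by
  rw [← Measure.restrict_univ (μ := (volume : Measure ℝ)), Measure.restrict_restrict_of_subset
    (subset_univ _), Measure.prod_restrict]
  refine ContinuousOn.aemeasurable ?_ (MeasurableSet.univ.prod measurableSet_Ioc)
  refine ContinuousOn.enorm (hg.diff.continuousOn.comp (by fun_prop : Continuous fun q : ℝ × ℝ =>
    (q.1 + q.2 * Complex.I : ℂ)).continuousOn fun q hq => ?_)
  simpa using hq.2.1

/-- By Tonelli the uniform `L¹` bound on horizontal lines makes `g` integrable on the strip of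
height one, hence on almost every vertical segment. -/
theorem lintegral_lintegral_vertical_le (hg : DecayingHardyOne A B g) :
    ∫⁻ x : ℝ, ∫⁻ s in Ioc (0 : ℝ) 1, ‖g (x + s * Complex.I)‖ₑ ≤ ENNReal.ofReal B := by
  rw [lintegral_lintegral_swap hg.aemeasurable_enorm_plane]
  refine (setLIntegral_mono' (g := fun _ => ENNReal.ofReal B) measurableSet_Ioc
    fun s hs => hg.lintegral_le s hs.1).trans ?_
  simp

theorem aemeasurable_lintegral_vertical (hg : DecayingHardyOne A B g) :
    AEMeasurable fun x : ℝ => ∫⁻ s in Ioc (0 : ℝ) 1, ‖g (x + s * Complex.I)‖ₑ :=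
  hg.aemeasurable_enorm_plane.lintegral_prod_right'

theorem ae_mem_goodPoints (hg : DecayingHardyOne A B g) : ∀ᵐ x : ℝ, x ∈ goodPoints g :=
  ae_lt_top' hg.aemeasurable_lintegral_vertical
    (hg.lintegral_lintegral_vertical_le.trans_lt ENNReal.ofReal_lt_top).ne

theorem norm_vertical_le_of_one_le (hg : DecayingHardyOne A B g) (x : ℝ) {s : ℝ} (hs : 1 < s) :
    ‖g (x + s * Complex.I)‖ ≤ A * (1 + s ^ 2)⁻¹ := by
  have h0 : 0 < s := by linarith
  have h := hg.norm_mul_vertical_le (z := x) (by simp) h0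
  rw [norm_mul, Complex.norm_real, Real.norm_of_nonneg h0.le] at h
  exact (le_mul_of_one_le_left (norm_nonneg _) hs.le).trans h

theorem aestronglyMeasurable_vertical_real (hg : DecayingHardyOne A B g) (x : ℝ) :
    AEStronglyMeasurable (fun s : ℝ => g (x + s * Complex.I)) (volume.restrict (Ioi 0)) :=
  hg.aestronglyMeasurable_vertical (z := x) (by simp)

theorem integrableOn_Ioi_one (hg : DecayingHardyOne A B g) (x : ℝ) :
    IntegrableOn (fun s : ℝ => g (x + s * Complex.I)) (Ioi 1) :=
  (integrable_inv_one_add_sq.const_mul A).integrableOn.mono'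
    ((hg.aestronglyMeasurable_vertical_real x).mono_set (Ioi_subset_Ioi zero_le_one))
    ((ae_restrict_mem measurableSet_Ioi).mono fun _ hs => hg.norm_vertical_le_of_one_le x hs)

theorem integrableOn_Ioc (hg : DecayingHardyOne A B g) {x : ℝ} (hx : x ∈ goodPoints g) :
    IntegrableOn (fun s : ℝ => g (x + s * Complex.I)) (Ioc 0 1) :=
  ⟨(hg.aestronglyMeasurable_vertical_real x).mono_set Ioc_subset_Ioi_self, hx⟩

theorem integrableOn_vertical (hg : DecayingHardyOne A B g) {x : ℝ} (hx : x ∈ goodPoints g) :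
    IntegrableOn (fun s : ℝ => g (x + s * Complex.I)) (Ioi 0) := by
  rw [← Ioc_union_Ioi_eq_Ioi zero_le_one]
  exact (hg.integrableOn_Ioc hx).union (hg.integrableOn_Ioi_one x)

theorem verticalPrimitive_add_mul_I (x : ℝ) (y : ℝ) :
    verticalPrimitive g (x + y * Complex.I) =
      -Complex.I * ∫ s in Ioi y, g (x + s * Complex.I) := by
  have h := (measurePreserving_add_right (volume : Measure ℝ) y).setIntegral_preimage_emb
    (measurableEmbedding_addRight y) (fun s : ℝ => g (x + s * Complex.I)) (Ioi y)
  have hpre : (fun s : ℝ => s + y) ⁻¹' Ioi y = Ioi 0 := by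
    ext s; simp
  rw [hpre] at h
  rw [verticalPrimitive, ← h]
  congr 2
  ext s
  push_cast
  ring_nf

/-- An integrable majorant, on bounded intervals, of the first primitive. -/
noncomputable def verticalMajorant (A : ℝ) (g : ℂ → ℂ) (x : ℝ) : ℝ :=
  (∫⁻ s in Ioc (0 : ℝ) 1, ‖g (x + s * Complex.I)‖ₑ).toReal + ∫ s in Ioi (1 : ℝ), A * (1 + s ^ 2)⁻¹

theorem norm_verticalPrimitive_le (hg : DecayingHardyOne A B g) {x : ℝ} (hx : x ∈ goodPoints g)
    {y : ℝ} (hy : 0 ≤ y) :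
    ‖verticalPrimitive g (x + y * Complex.I)‖ ≤ verticalMajorant A g x := by
  have hi := hg.integrableOn_vertical hx
  rw [verticalPrimitive_add_mul_I, norm_mul, norm_neg, Complex.norm_I, one_mul]
  calc ‖∫ s in Ioi y, g (x + s * Complex.I)‖ ≤ ∫ s in Ioi y, ‖g (x + s * Complex.I)‖ :=
        norm_integral_le_integral_norm _
    _ ≤ ∫ s in Ioi (0 : ℝ), ‖g (x + s * Complex.I)‖ :=
        setIntegral_mono_set hi.norm (Eventually.of_forall fun _ => norm_nonneg _)
          (Ioi_subset_Ioi hy).eventuallyLE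
    _ = (∫ s in Ioc (0 : ℝ) 1, ‖g (x + s * Complex.I)‖) + ∫ s in Ioi (1 : ℝ), ‖g (x + s * Complex.I)‖ := by
        rw [← setIntegral_union Ioc_disjoint_Ioi_same measurableSet_Ioi
          (hg.integrableOn_Ioc hx).norm (hg.integrableOn_Ioi_one x).norm,
          Ioc_union_Ioi_eq_Ioi zero_le_one]
    _ ≤ _ := by
        rw [verticalMajorant]
        refine add_le_add (le_of_eq ?_) ?_
        · exact integral_norm_eq_lintegral_enorm (hg.integrableOn_Ioc hx).1
        · exact setIntegral_mono_on (hg.integrableOn_Ioi_one x).norm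
            (integrable_inv_one_add_sq.const_mul A).integrableOn measurableSet_Ioi
            fun s hs => hg.norm_vertical_le_of_one_le x hs

theorem intervalIntegrable_verticalMajorant (hg : DecayingHardyOne A B g) (a b : ℝ) :
    IntervalIntegrable (verticalMajorant A g) volume a b := by
  refine IntervalIntegrable.add ?_ intervalIntegrable_const
  exact (integrable_toReal_of_lintegral_ne_top hg.aemeasurable_lintegral_vertical
    (hg.lintegral_lintegral_vertical_le.trans_lt ENNReal.ofReal_lt_top).ne).intervalIntegrable

theorem tendsto_verticalPrimitive (hg : DecayingHardyOne A B g) {x : ℝ} (hx : x ∈ goodPoints g) :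
    Tendsto (fun y : ℝ => verticalPrimitive g (x + y * Complex.I)) (𝓝[>] 0)
      (𝓝 (verticalPrimitive g x)) := by
  have hi := hg.integrableOn_vertical hx
  rw [verticalPrimitive]
  simp_rw [verticalPrimitive_add_mul_I]
  refine Tendsto.const_mul _ ?_
  have h : ∀ᶠ y : ℝ in 𝓝[>] 0, ∫ s in Ioi 0, (Ioi y).indicator (fun s : ℝ => g (x + s * Complex.I)) s
      = ∫ s in Ioi y, g (x + s * Complex.I) := by
    filter_upwards [self_mem_nhdsWithin] with y hy
    rw [integral_indicator measurableSet_Ioi, Measure.restrict_restrict measurableSet_Ioi,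
      inter_eq_left.2 (Ioi_subset_Ioi (le_of_lt hy))]
  refine Tendsto.congr' h ?_
  refine tendsto_integral_filter_of_dominated_convergence (fun s => ‖g (x + s * Complex.I)‖)
    (Eventually.of_forall fun y => hi.1.indicator measurableSet_Ioi)
    (Eventually.of_forall fun y => Eventually.of_forall fun s => norm_indicator_le_norm_self _ _)
    hi.norm ?_
  refine (ae_restrict_mem measurableSet_Ioi).mono fun s hs => ?_
  refine tendsto_const_nhds.congr' ?_
  filter_upwards [Ioo_mem_nhdsGT (show (0 : ℝ) < s from hs)] with y hy
  rw [indicator_of_mem (show s ∈ Ioi y from hy.2)]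

theorem hasDerivAt_horizontal {f f' : ℂ → ℂ} (h : ∀ z : ℂ, 0 < z.im → HasDerivAt f (f' z) z)
    {y : ℝ} (hy : 0 < y) (x : ℝ) :
    HasDerivAt (fun x : ℝ => f (x + y * Complex.I)) (f' (x + y * Complex.I)) x := by
  have h1 := h (x + y * Complex.I) (by simpa using hy)
  have h2 : HasDerivAt (fun x : ℝ => (x + y * Complex.I : ℂ)) 1 x := by
    simpa using (Complex.ofRealCLM.hasDerivAt (x := x)).add_const (y * Complex.I : ℂ)
  have h3 := h1.comp x h2
  rwa [mul_one] at h3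

theorem integral_horizontal (hg : DecayingHardyOne A B g) {y : ℝ} (hy : 0 < y) (a b : ℝ) :
    ∫ x in a..b, g (x + y * Complex.I) =
      verticalPrimitive g (b + y * Complex.I) - verticalPrimitive g (a + y * Complex.I) :=
  intervalIntegral.integral_eq_sub_of_hasDerivAt
    (fun x _ => hasDerivAt_horizontal (fun _ hz => hg.hasDerivAt_verticalPrimitive hz) hy x)
    ((continuous_horizontal_line hg.diff.continuousOn hy).intervalIntegrable _ _)

theorem continuousOn_verticalPrimitive (hg : DecayingHardyOne A B g) :
    ContinuousOn (verticalPrimitive g) {z | 0 < z.im} := fun _ hz =>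
  (hg.hasDerivAt_verticalPrimitive hz).continuousAt.continuousWithinAt

/-- Increments of the primitive are integrals of `g`, so its variation on a line is at most the `L¹`
norm of `g` there, uniformly in the height. -/
theorem boundedVariationOn_horizontal (hg : DecayingHardyOne A B g) {y : ℝ} (hy : 0 < y) (s : Set ℝ) :
    eVariationOn (fun x : ℝ => verticalPrimitive g (x + y * Complex.I)) s ≤ ENNReal.ofReal B := by
  refine iSup_le fun ⟨n, u, hu, _⟩ => ?_
  have hcont := continuous_horizontal_line hg.diff.continuousOn hy
  have hstep : ∀ i, edist (verticalPrimitive g (u (i + 1) + y * Complex.I))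
      (verticalPrimitive g (u i + y * Complex.I)) ≤
      ∫⁻ x in Ioc (u i) (u (i + 1)), ‖g (x + y * Complex.I)‖ₑ := by
    intro i
    rw [edist_eq_enorm_sub, ← hg.integral_horizontal hy,
      intervalIntegral.integral_of_le (hu (Nat.le_succ i))]
    exact enorm_integral_le_lintegral_enorm _
  have hsum : ∑ i ∈ Finset.range n, ∫⁻ x in Ioc (u i) (u (i + 1)), ‖g (x + y * Complex.I)‖ₑ =
      ∫⁻ x in Ioc (u 0) (u n), ‖g (x + y * Complex.I)‖ₑ := by
    induction n with
    | zero => simp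
    | succ k ih =>
      rw [Finset.sum_range_succ, ih, ← lintegral_union measurableSet_Ioc
        (Ioc_disjoint_Ioc_of_le le_rfl), Ioc_union_Ioc_eq_Ioc (hu (Nat.zero_le k)) (hu (Nat.le_succ k))]
  calc _ ≤ ∑ i ∈ Finset.range n, ∫⁻ x in Ioc (u i) (u (i + 1)), ‖g (x + y * Complex.I)‖ₑ :=
        Finset.sum_le_sum fun i _ => hstep i
    _ = _ := hsum
    _ ≤ ∫⁻ x : ℝ, ‖g (x + y * Complex.I)‖ₑ := setLIntegral_le_lintegral _ _
    _ ≤ _ := hg.lintegral_le y hy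

/-- Variation is lower semicontinuous under pointwise convergence, which holds on the good points as
the height tends to `0`. -/
theorem boundedVariationOn_boundary (hg : DecayingHardyOne A B g) :
    BoundedVariationOn (fun x : ℝ => verticalPrimitive g x) (goodPoints g) := by
  have h : eVariationOn (fun x : ℝ => verticalPrimitive g x) (goodPoints g) ≤ ENNReal.ofReal B := by
    by_contra! hlt
    have h1 := eVariationOn.lowerSemicontinuous_aux (p := 𝓝[>] (0 : ℝ))
      (F := fun (y : ℝ) (x : ℝ) => verticalPrimitive g (x + y * Complex.I))
      (fun x hx => hg.tendsto_verticalPrimitive hx) hlt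
    obtain ⟨y, hy1, hy2⟩ := (h1.and self_mem_nhdsWithin).exists
    exact absurd (hg.boundedVariationOn_horizontal hy2 (goodPoints g)) (not_le.2 hy1)
  exact (h.trans_lt ENNReal.ofReal_lt_top).ne

theorem aestronglyMeasurable_boundary (hg : DecayingHardyOne A B g) :
    AEStronglyMeasurable fun x : ℝ => verticalPrimitive g x :=
  aestronglyMeasurable_of_tendsto_vertical hg.continuousOn_verticalPrimitive
    (hg.ae_mem_goodPoints.mono fun _ hx => hg.tendsto_verticalPrimitive hx)

theorem intervalIntegrable_boundary (hg : DecayingHardyOne A B g) (a b : ℝ) :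
    IntervalIntegrable (fun x : ℝ => verticalPrimitive g x) volume a b := by
  refine (hg.intervalIntegrable_verticalMajorant a b).mono_fun'
    hg.aestronglyMeasurable_boundary.restrict (ae_restrict_of_ae ?_)
  filter_upwards [hg.ae_mem_goodPoints] with x hx
  simpa using hg.norm_verticalPrimitive_le hx le_rfl

/-- The fundamental theorem at height `y` passes to the limit: the second primitive is continuous up
to the axis, and the first is dominated by `verticalMajorant`. -/
theorem integral_boundary (hg : DecayingHardyOne A B g) (a b : ℝ) :
    ∫ x : ℝ in a..b, verticalPrimitive g x = verticalPrimitive₂ g b - verticalPrimitive₂ g a := by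
  have hK : ∀ x : ℝ, Tendsto (fun y : ℝ => verticalPrimitive₂ g (x + y * Complex.I)) (𝓝[>] 0)
      (𝓝 (verticalPrimitive₂ g x)) := by
    intro x
    have h1 := hg.continuousOn_verticalPrimitive₂ x (by simp)
    refine h1.tendsto.comp (tendsto_nhdsWithin_iff.2 ⟨?_, ?_⟩)
    · refine Tendsto.mono_left ?_ nhdsWithin_le_nhds
      exact Continuous.tendsto' (by fun_prop) _ _ (by simp)
    · filter_upwards [self_mem_nhdsWithin] with y hy
      simpa using le_of_lt hy
  refine tendsto_nhds_unique ?_ ((hK b).sub (hK a))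
  have h : ∀ᶠ y : ℝ in 𝓝[>] 0, ∫ x : ℝ in a..b, verticalPrimitive g (x + y * Complex.I) =
      verticalPrimitive₂ g (b + y * Complex.I) - verticalPrimitive₂ g (a + y * Complex.I) := by
    filter_upwards [self_mem_nhdsWithin] with y hy
    exact intervalIntegral.integral_eq_sub_of_hasDerivAt
      (fun x _ => hasDerivAt_horizontal (fun _ hz => hg.hasDerivAt_verticalPrimitive₂ hz) hy x)
      ((continuous_horizontal_line hg.continuousOn_verticalPrimitive hy).intervalIntegrable _ _)
  refine Tendsto.congr' h ?_
  refine intervalIntegral.tendsto_integral_filter_of_dominated_convergence (verticalMajorant A g)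
    ?_ ?_ (hg.intervalIntegrable_verticalMajorant a b) ?_
  · filter_upwards [self_mem_nhdsWithin] with y hy
    exact (continuous_horizontal_line hg.continuousOn_verticalPrimitive hy).aestronglyMeasurable
  · filter_upwards [self_mem_nhdsWithin] with y hy
    filter_upwards [hg.ae_mem_goodPoints] with x hx _
    exact hg.norm_verticalPrimitive_le hx (le_of_lt hy)
  · filter_upwards [hg.ae_mem_goodPoints] with x hx _
    exact hg.tendsto_verticalPrimitive hx

/-- The remainder is the integral of the first order remainder of the first primitive. That
integrand is at most `ε |u - x|` at good points only, but these have full measure, so the estimate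
holds for every small `t`. -/
theorem norm_peano_remainder_le (hg : DecayingHardyOne A B g) {x : ℝ} {a : ℂ}
    (ha : HasDerivWithinAt (fun x : ℝ => verticalPrimitive g x) a (goodPoints g) x)
    {ε : ℝ} (hε : 0 < ε) : ∃ ρ > 0, ∀ t : ℝ, |t| < ρ →
      ‖verticalPrimitive₂ g (x + t) - verticalPrimitive₂ g x - t * verticalPrimitive g x
        - a * t ^ 2 / 2‖ ≤ ε * t ^ 2 := by
  have h1 := (hasDerivWithinAt_iff_isLittleO.1 ha).def hε
  obtain ⟨ρ, hρ, hball⟩ := Metric.mem_nhdsWithin_iff.1 h1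
  refine ⟨ρ, hρ, fun t ht => ?_⟩
  have hint := hg.intervalIntegrable_boundary x (x + t)
  have heq : verticalPrimitive₂ g (x + t) - verticalPrimitive₂ g x - t * verticalPrimitive g x
        - a * t ^ 2 / 2 = ∫ u : ℝ in x..(x + t), (verticalPrimitive g u - verticalPrimitive g x
          - (u - x : ℝ) • a) := by
    rw [intervalIntegral.integral_sub (hint.sub intervalIntegrable_const)
      (Continuous.intervalIntegrable (by fun_prop) _ _),
      intervalIntegral.integral_sub hint intervalIntegrable_const, hg.integral_boundary,
      intervalIntegral.integral_const, intervalIntegral.integral_smul_const,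
      intervalIntegral.integral_comp_sub_right (fun u => u), integral_id]
    simp only [add_sub_cancel_left, sub_self, Complex.real_smul]
    push_cast
    ring
  rw [heq]
  have hsq : ε * t ^ 2 = ε * |t| * |x + t - x| := by
    rw [add_sub_cancel_left, mul_assoc, abs_mul_abs_self, sq]
  rw [hsq]
  refine intervalIntegral.norm_integral_le_of_norm_le_const_ae ?_
  filter_upwards [hg.ae_mem_goodPoints] with u hu hut
  have hux : |u - x| ≤ |t| := by
    have := abs_sub_left_of_mem_uIcc (uIoc_subset_uIcc hut)
    simpa using this
  have h2 := hball ⟨by rw [Metric.mem_ball, Real.dist_eq]; linarith, hu⟩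
  refine le_trans h2 ?_
  rw [Real.norm_eq_abs]
  gcongr

/-- **Fatou's theorem** for decaying Hardy functions. -/
theorem exists_tendsto (hg : DecayingHardyOne A B g) :
    ∀ᵐ x : ℝ, ∃ a : ℂ, Tendsto (fun y : ℝ => g (x + y * Complex.I)) (𝓝[>] 0) (𝓝 a) := by
  filter_upwards [hg.ae_mem_goodPoints,
    hg.boundedVariationOn_boundary.locallyBoundedVariationOn.ae_differentiableWithinAt_of_mem]
    with x hx hdx
  set a := derivWithin (fun x : ℝ => verticalPrimitive g x) (goodPoints g) x
  have ha : HasDerivWithinAt (fun x : ℝ => verticalPrimitive g x) a (goodPoints g) x :=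
    (hdx hx).hasDerivWithinAt
  refine ⟨a, ?_⟩
  set F := verticalPrimitive g
  set K := verticalPrimitive₂ g
  -- The second primitive minus its second order Taylor polynomial at `x`. Its second derivative is
  -- `g (x + z) - a`, so the decay of `D''` along the vertical ray is the claim.
  set D : ℂ → ℂ := fun z => K (x + z) - K x - z * F x - a * z ^ 2 / 2
  set M := ∫ s in Ioi (0 : ℝ), A * (1 + s ^ 2)⁻¹
  have him : ∀ z : ℂ, (x + z).im = z.im := fun z => by simp
  have hD1 : ∀ z : ℂ, 0 < z.im → HasDerivAt D (F (x + z) - F x - a * z) z := by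
    intro z hz
    have h1 := (hg.hasDerivAt_verticalPrimitive₂ (z := x + z) (by rwa [him])).comp_const_add (x : ℂ) z
    have h2 : HasDerivAt D _ z := ((h1.sub_const (K x)).sub ((hasDerivAt_id z).mul_const (F x))).sub
      (((hasDerivAt_pow 2 z).const_mul a).div_const 2)
    convert h2 using 1
    simp
    ring
  have hD2 : ∀ z : ℂ, 0 < z.im → deriv (deriv D) z = g (x + z) - a := by
    intro z hz
    have h1 : deriv D =ᶠ[𝓝 z] fun z => F (x + z) - F x - a * z := by
      filter_upwards [isOpen_upperHalfPlane_im.mem_nhds hz] with w hw using (hD1 w hw).deriv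
    rw [h1.deriv_eq]
    have h2 := (hg.hasDerivAt_verticalPrimitive (z := x + z) (by rwa [him])).comp_const_add (x : ℂ) z
    have h3 : HasDerivAt (fun z => F (x + z) - F x - a * z) (g (x + z) - a * 1) z :=
      (h2.sub_const (F x)).sub ((hasDerivAt_id z).const_mul a)
    rw [h3.deriv, mul_one]
  have key := tendsto_deriv_deriv_of_peano (D := D) (M := 2 * M + ‖F x‖ + ‖a‖)
    (fun z hz => (hD1 z hz).differentiableAt.differentiableWithinAt) ?_ ?_ ?_
  · have h1 : ∀ᶠ r : ℝ in 𝓝[>] 0, deriv (deriv D) (r * Complex.I) + a = g (x + r * Complex.I) := by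
      filter_upwards [self_mem_nhdsWithin] with r hr
      rw [hD2 _ (by simpa using hr)]
      ring
    simpa using Tendsto.congr' h1 (key.add_const a)
  · have h1 : ContinuousOn (fun z : ℂ => K (x + z)) {z | 0 ≤ z.im} :=
      hg.continuousOn_verticalPrimitive₂.comp (by fun_prop) fun z hz => by simpa using hz
    exact ((h1.sub continuousOn_const).sub (by fun_prop)).sub (by fun_prop)
  · intro z hz
    have hK1 := hg.norm_verticalPrimitive₂_le (z := x + z) (by rwa [him])
    have hK2 := hg.norm_verticalPrimitive₂_le (z := x) (by simp)
    have hM0 : 0 ≤ M := (norm_nonneg _).trans hK2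
    calc ‖D z‖ ≤ ‖K (x + z)‖ + ‖K x‖ + ‖z * F x‖ + ‖a * z ^ 2 / 2‖ := by
          refine (norm_sub_le _ _).trans ?_
          gcongr
          refine (norm_sub_le _ _).trans ?_
          gcongr
          exact norm_sub_le _ _
      _ ≤ M + M + ‖z‖ * ‖F x‖ + ‖a‖ * ‖z‖ ^ 2 / 2 := by
          rw [norm_mul, norm_div, norm_mul, norm_pow, Complex.norm_ofNat]
          gcongr
      _ ≤ _ := by
          have h1 : ‖z‖ ≤ 1 + ‖z‖ ^ 2 := by nlinarith [sq_nonneg (‖z‖ - 1)]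
          have h2 : ‖z‖ * ‖F x‖ ≤ (1 + ‖z‖ ^ 2) * ‖F x‖ := by gcongr
          nlinarith [norm_nonneg a, mul_nonneg hM0 (sq_nonneg ‖z‖),
            mul_nonneg (norm_nonneg a) (sq_nonneg ‖z‖)]
  · intro ε hε
    exact hg.norm_peano_remainder_le ha hε

end DecayingHardyOne

/-! ### The Poisson kernel and the Herglotz integral. -/

open ProbabilityTheory in
/-- The standard Cauchy distribution, i.e. the Poisson kernel of the upper half-plane at `i`. -/
noncomputable abbrev poissonMeasure : Measure ℝ := cauchyMeasure 0 1

theorem poissonMeasure_eq_withDensity : poissonMeasure =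
    volume.withDensity fun u : ℝ => ENNReal.ofReal (Real.pi⁻¹ * (1 + u ^ 2)⁻¹) := by
  rw [poissonMeasure, ProbabilityTheory.cauchyMeasure_of_scale_ne_zero _ one_ne_zero]
  congr 1
  ext u
  simp [ProbabilityTheory.cauchyPDF, ProbabilityTheory.cauchyPDFReal_def']

theorem integral_poissonMeasure (f : ℝ → ℝ) :
    ∫ u, f u ∂poissonMeasure = ∫ u, Real.pi⁻¹ * (1 + u ^ 2)⁻¹ * f u := by
  rw [poissonMeasure_eq_withDensity, integral_withDensity_eq_integral_toReal_smul (by fun_prop)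
    (Eventually.of_forall fun _ => ENNReal.ofReal_lt_top)]
  refine integral_congr_ae (Eventually.of_forall fun u => ?_)
  simp only [smul_eq_mul]
  rw [ENNReal.toReal_ofReal (by positivity)]

theorem poissonMeasure_absolutelyContinuous : poissonMeasure ≪ volume := by
  rw [poissonMeasure_eq_withDensity]
  exact withDensity_absolutelyContinuous _ _

theorem integral_poissonMeasure_comp_affine (k : ℝ → ℝ) (x : ℝ) {y : ℝ} (hy : 0 < y) :
    ∫ u, k (x + y * u) ∂poissonMeasure = ∫ t, Real.pi⁻¹ * (y / ((t - x) ^ 2 + y ^ 2)) * k t := by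
  rw [integral_poissonMeasure]
  set h : ℝ → ℝ := fun t => Real.pi⁻¹ * (y / ((t - x) ^ 2 + y ^ 2)) * k t
  have h1 : ∀ u, Real.pi⁻¹ * (1 + u ^ 2)⁻¹ * k (x + y * u) = y * h (x + y * u) := by
    intro u
    simp only [h, add_sub_cancel_left]
    field_simp
    ring
  simp_rw [h1]
  rw [integral_const_mul, Measure.integral_comp_mul_left (fun u => h (x + u)) y,
    integral_add_left_eq_self h x, abs_of_pos (inv_pos.2 hy), smul_eq_mul, ← mul_assoc,
    mul_inv_cancel₀ hy.ne', one_mul]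

/-- The Herglotz type integral whose real part is the Poisson integral of `k`. -/
noncomputable def poissonCauchyIntegral (k : ℝ → ℝ) (z : ℂ) : ℂ :=
  ∫ t : ℝ, (k t : ℂ) / (Real.pi * Complex.I * (t - z))

section PoissonCauchy

variable {k : ℝ → ℝ}

theorem im_le_norm_real_sub (t : ℝ) (z : ℂ) : z.im ≤ ‖(t : ℂ) - z‖ := by
  refine le_trans ?_ (Complex.abs_im_le_norm _)
  simp [le_abs_self]

theorem norm_poissonCauchy_integrand_le (t : ℝ) {z : ℂ} {y : ℝ} (hy : 0 < y) (hz : y ≤ z.im) :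
    ‖(k t : ℂ) / (Real.pi * Complex.I * (t - z))‖ ≤ |k t| * y⁻¹ := by
  have h := hz.trans (im_le_norm_real_sub t z)
  rw [norm_div, Complex.norm_real, Real.norm_eq_abs, div_eq_mul_inv]
  gcongr
  rw [norm_mul, norm_mul, Complex.norm_I, mul_one, Complex.norm_real,
    Real.norm_of_nonneg Real.pi_pos.le]
  nlinarith [Real.pi_gt_three]

theorem integrable_poissonCauchy_integrand (hk : Integrable k) {z : ℂ} (hz : 0 < z.im) :
    Integrable fun t : ℝ => (k t : ℂ) / (Real.pi * Complex.I * (t - z)) := by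
  refine (hk.abs.mul_const z.im⁻¹).mono' ?_
    (Eventually.of_forall fun t => norm_poissonCauchy_integrand_le t hz le_rfl)
  exact (Complex.continuous_ofReal.comp_aestronglyMeasurable hk.1).div₀
    (by fun_prop : Continuous fun t : ℝ => (Real.pi * Complex.I * (t - z) : ℂ)).aestronglyMeasurable

theorem differentiableOn_poissonCauchyIntegral (hk : Integrable k) :
    DifferentiableOn ℂ (poissonCauchyIntegral k) {z | 0 < z.im} := by
  intro z₀ hz
  have hz0 : 0 < z₀.im := hz
  have him : ∀ z ∈ Metric.ball z₀ (z₀.im / 2), z₀.im / 2 ≤ z.im := by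
    intro z hz
    rw [mem_ball_iff_norm] at hz
    have h2 := (Complex.abs_im_le_norm _).trans_lt hz
    rw [Complex.sub_im, abs_lt] at h2
    linarith
  refine ((hasDerivAt_integral_of_holomorphic (half_pos hz0)
    (F := fun z (t : ℝ) => (k t : ℂ) / (Real.pi * Complex.I * (t - z)))
    (bound := fun t => |k t| * (z₀.im / 2)⁻¹) (fun z hz => ?_) ?_ ?_
    (hk.abs.mul_const _)).2).differentiableAt.differentiableWithinAt
  · exact (integrable_poissonCauchy_integrand hk ((half_pos hz0).trans_le (him z hz))).1
  · refine Eventually.of_forall fun t z hz => DifferentiableAt.differentiableWithinAt ?_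
    have : (t : ℂ) - z ≠ 0 := norm_pos_iff.1
      (((half_pos hz0).trans_le (him z hz)).trans_le (im_le_norm_real_sub t z))
    refine DifferentiableAt.div (by fun_prop) (by fun_prop) ?_
    simp [this, Real.pi_ne_zero]
  · exact Eventually.of_forall fun t z hz => norm_poissonCauchy_integrand_le t (half_pos hz0) (him z hz)

/-- The real part of `1 / (π i (t - z))` is the Poisson kernel `π⁻¹ y / ((t - x)² + y²)`. -/
theorem re_poissonCauchyIntegral (hk : Integrable k) (x : ℝ) {y : ℝ} (hy : 0 < y) :
    (poissonCauchyIntegral k (x + y * Complex.I)).re = ∫ u, k (x + y * u) ∂poissonMeasure := by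
  have h := integral_re (integrable_poissonCauchy_integrand hk
    (z := x + y * Complex.I) (by simpa using hy))
  rw [integral_poissonMeasure_comp_affine k x hy, poissonCauchyIntegral]
  refine Eq.trans h.symm (integral_congr_ae (Eventually.of_forall fun t => ?_))
  have hpos : 0 < (t - x) ^ 2 + y ^ 2 := by positivity
  have h1 : (k t : ℂ) / (Real.pi * Complex.I * (t - (x + y * Complex.I))) =
      ((Real.pi⁻¹ * k t / ((t - x) ^ 2 + y ^ 2) : ℝ) : ℂ) * (y - (t - x) * Complex.I) := by
    have h2 : (t : ℂ) - (x + y * Complex.I) ≠ 0 := by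
      refine norm_pos_iff.1 (lt_of_lt_of_le hy ?_)
      simpa using im_le_norm_real_sub t (x + y * Complex.I)
    have h3 : (((t - x) ^ 2 + y ^ 2 : ℝ) : ℂ) ≠ 0 := Complex.ofReal_ne_zero.2 hpos.ne'
    have h4 : (Real.pi : ℂ) ≠ 0 := Complex.ofReal_ne_zero.2 Real.pi_ne_zero
    rw [div_eq_iff (by simp [h2, h4])]
    rw [Complex.ofReal_div, div_mul_eq_mul_div, div_mul_eq_mul_div, eq_div_iff h3]
    push_cast
    field_simp
    linear_combination (k t : ℂ) * ((t - x) ^ 2 + y ^ 2 - (t - x) * y * Complex.I) * Complex.I_sq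
  simp only [h1, RCLike.re_to_complex, Complex.re_ofReal_mul]
  simp
  ring

end PoissonCauchy

/-! ### Outer functions and the Poisson majorant of the square root of the modulus. -/

section Subharmonic

variable {G : ℂ → ℂ} {L M : ℝ}

/-- The Lipschitz bound controls `k x - k (x + η u)` by `L η |u|`. The cut at `M` is essential
because `|u|` is not integrable against the Cauchy distribution. -/
theorem integral_poissonMeasure_affine_ge {k : ℝ → ℝ} {L M : ℝ} (hkc : Continuous k)
    (hk0 : ∀ t, 0 ≤ k t) (hkM : ∀ t, k t ≤ M) (hkL : ∀ s t, |k s - k t| ≤ L * |s - t|) (x : ℝ)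
    {η : ℝ} (hη : 0 < η) :
    k x - ∫ u, min (L * η * |u|) M ∂poissonMeasure ≤ ∫ u, k (x + η * u) ∂poissonMeasure := by
  have hL : 0 ≤ L := by simpa using (abs_nonneg _).trans (hkL 1 0)
  have hM : 0 ≤ M := (hk0 0).trans (hkM 0)
  have hi1 : Integrable (fun u : ℝ => min (L * η * |u|) M) poissonMeasure := by
    refine Integrable.of_bound (by fun_prop : Continuous _).aestronglyMeasurable M
      (Eventually.of_forall fun u => ?_)
    rw [Real.norm_of_nonneg (le_min (by positivity) hM)]
    exact min_le_right _ _
  have hi2 : Integrable (fun u : ℝ => k (x + η * u)) poissonMeasure := by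
    refine Integrable.of_bound (by fun_prop : Continuous _).aestronglyMeasurable M
      (Eventually.of_forall fun u => ?_)
    rw [Real.norm_of_nonneg (hk0 _)]
    exact hkM _
  have h1 : ∫ _, k x ∂poissonMeasure = k x := by simp
  rw [sub_le_iff_le_add, ← integral_add hi2 hi1]
  conv_lhs => rw [← h1]
  refine integral_mono (integrable_const _) (hi2.add hi1) fun u => ?_
  have h2 := hkL x (x + η * u)
  rw [sub_add_cancel_left, abs_neg, abs_mul, abs_of_pos hη, abs_le] at h2
  have h3 : k x - k (x + η * u) ≤ min (L * η * |u|) M :=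
    le_min (by nlinarith [h2.2]) (by linarith [hkM x, hk0 (x + η * u)])
  simp only
  linarith

theorem tendsto_integral_min (L : ℝ) {M : ℝ} (hL : 0 ≤ L) (hM : 0 ≤ M) :
    Tendsto (fun η : ℝ => ∫ u, min (L * η * |u|) M ∂poissonMeasure) (𝓝[>] 0) (𝓝 0) := by
  have h : Tendsto (fun η : ℝ => ∫ u, min (L * η * |u|) M ∂poissonMeasure) (𝓝[>] 0)
      (𝓝 (∫ _, 0 ∂poissonMeasure)) := by
    refine tendsto_integral_filter_of_dominated_convergence (fun _ => M) ?_ ?_ (integrable_const _) ?_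
    · exact Eventually.of_forall fun η => (by fun_prop : Continuous _).aestronglyMeasurable
    · filter_upwards [self_mem_nhdsWithin] with η hη
      have : 0 < η := hη
      refine Eventually.of_forall fun u => ?_
      rw [Real.norm_of_nonneg (le_min (by positivity) hM)]
      exact min_le_right _ _
    · refine Eventually.of_forall fun u => Tendsto.mono_left ?_ nhdsWithin_le_nhds
      exact Continuous.tendsto' (by fun_prop) _ _ (by simp [hM])
  simpa using h

theorem abs_log_one_add_sub_le {a b ε : ℝ} (hε : 0 < ε) (ha : 0 ≤ a) (hb : 0 ≤ b) :
    |Real.log (1 + a / ε) - Real.log (1 + b / ε)| ≤ |a - b| / ε := by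
  have key : ∀ a b : ℝ, 0 ≤ a → 0 ≤ b →
      Real.log (1 + a / ε) - Real.log (1 + b / ε) ≤ |a - b| / ε := by
    intro a b ha hb
    rw [← Real.log_div (by positivity) (by positivity)]
    refine (Real.log_le_sub_one_of_pos (by positivity)).trans ?_
    rw [div_sub_one (by positivity), add_sub_add_left_eq_sub, ← sub_div]
    calc (a - b) / ε / (1 + b / ε) ≤ |a - b| / ε / (1 + b / ε) := by
          gcongr; exact le_abs_self _
      _ ≤ |a - b| / ε := div_le_self (by positivity) (by simp; positivity)
  rw [abs_le]
  refine ⟨?_, key a b ha hb⟩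
  have := key b a hb ha
  rw [abs_sub_comm] at this
  linarith

/-- The outer function with boundary modulus `ε + |G|` dominates `G`. -/
theorem norm_le_exp_poisson (hd : DifferentiableOn ℂ G {z | 0 < z.im})
    (hL : ∀ z w : ℂ, 0 ≤ z.im → 0 ≤ w.im → ‖G z - G w‖ ≤ L * ‖z - w‖)
    (hM : ∀ z : ℂ, 0 ≤ z.im → ‖G z‖ ≤ M) (hi : Integrable fun x : ℝ => G x) {ε : ℝ} (hε : 0 < ε)
    (x : ℝ) {y : ℝ} (hy : 0 < y) : ‖G (x + y * Complex.I)‖ ≤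
      ε * Real.exp (∫ u : ℝ, Real.log (1 + ‖G (x + y * u : ℝ)‖ / ε) ∂poissonMeasure) := by
  -- Here `ε exp (k t) = ε + |G t|`. Adding `ε` avoids the zeros of `G`, and `k ≤ |G| / ε` makes `k`
  -- integrable.
  set k : ℝ → ℝ := fun t => Real.log (1 + ‖G t‖ / ε) with hkdef
  have hL0 : 0 ≤ L := by
    have := (norm_nonneg _).trans (hL 1 0 (by simp) (by simp))
    simpa using this
  have hM0 : 0 ≤ M := (norm_nonneg _).trans (hM 0 (by simp))
  have hk0 : ∀ t, 0 ≤ k t := fun t => Real.log_nonneg (by simp; positivity)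
  have hkG : ∀ t, k t ≤ ‖G t‖ / ε := fun t => by
    have := Real.log_le_sub_one_of_pos (x := 1 + ‖G t‖ / ε) (by positivity)
    simp only [hkdef]
    linarith
  have hkM : ∀ t, k t ≤ M / ε := fun t => (hkG t).trans (by gcongr; exact hM t (by simp))
  have hkL : ∀ s t, |k s - k t| ≤ L / ε * |s - t| := by
    intro s t
    refine (abs_log_one_add_sub_le hε (norm_nonneg _) (norm_nonneg _)).trans ?_
    rw [div_mul_eq_mul_div]
    gcongr
    refine (abs_norm_sub_norm_le _ _).trans ((hL s t (by simp) (by simp)).trans (le_of_eq ?_))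
    rw [← Complex.ofReal_sub, Complex.norm_real, Real.norm_eq_abs]
  have hkc : Continuous k := by
    refine (LipschitzWith.of_dist_le_mul (K := (L / ε).toNNReal) fun s t => ?_).continuous
    rw [Real.dist_eq, Real.dist_eq, Real.coe_toNNReal _ (by positivity)]
    exact hkL s t
  have hki : Integrable k := (hi.norm.div_const ε).mono' hkc.aestronglyMeasurable
    (Eventually.of_forall fun t => by rw [Real.norm_of_nonneg (hk0 t)]; exact hkG t)
  -- The quotient of `G` by the outer function without its factor `ε`; the claim is `|ψ| ≤ ε`.
  set ψ : ℂ → ℂ := fun z => G z * Complex.exp (-poissonCauchyIntegral k z) with hψ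
  have hψd : DifferentiableOn ℂ ψ {z | 0 < z.im} :=
    hd.mul (differentiableOn_poissonCauchyIntegral hki).neg.cexp
  have hnorm : ∀ (x : ℝ) {y : ℝ}, 0 < y → ‖ψ (x + y * Complex.I)‖ =
      ‖G (x + y * Complex.I)‖ * Real.exp (-∫ u, k (x + y * u) ∂poissonMeasure) := by
    intro x y hy
    rw [hψ, norm_mul, Complex.norm_exp, Complex.neg_re, re_poissonCauchyIntegral hki x hy]
  have hψM : ∀ z : ℂ, 0 < z.im → ‖ψ z‖ ≤ M := by
    intro z hz
    have h := hnorm z.re hz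
    rw [Complex.re_add_im] at h
    rw [h]
    refine (mul_le_of_le_one_right (norm_nonneg _) ?_).trans (hM z hz.le)
    rw [Real.exp_le_one_iff, neg_nonpos]
    exact integral_nonneg fun u => hk0 _
  set ω : ℝ → ℝ := fun η => ∫ u, min (L / ε * η * |u|) (M / ε) ∂poissonMeasure
  -- The outer function is not known to extend continuously to the axis, so the maximum principle is
  -- applied above the line at height `η`, with an error that vanishes as `η → 0`.
  have hline : ∀ η : ℝ, 0 < η → ∀ x : ℝ, ‖ψ (x + η * Complex.I)‖ ≤ Real.exp (ω η) * (ε + L * η) := by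
    intro η hη x
    rw [hnorm x hη]
    have h1 := integral_poissonMeasure_affine_ge hkc hk0 hkM hkL x hη
    have h2 : ‖G (x + η * Complex.I)‖ ≤ ‖G x‖ + L * η := by
      have h3 := hL (x + η * Complex.I) x (by simpa using hη.le) (by simp)
      rw [add_sub_cancel_left, norm_mul, Complex.norm_I, mul_one, Complex.norm_real,
        Real.norm_of_nonneg hη.le] at h3
      linarith [norm_le_norm_add_norm_sub' (G (x + η * Complex.I)) (G x)]
    have h4 : Real.exp (-k x) = ε / (ε + ‖G x‖) := by
      rw [Real.exp_neg, Real.exp_log (by positivity)]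
      field_simp
    calc ‖G (x + η * Complex.I)‖ * Real.exp (-∫ u, k (x + η * u) ∂poissonMeasure)
        ≤ (‖G x‖ + L * η) * Real.exp (ω η + -k x) := by
          gcongr
          linarith
      _ = Real.exp (ω η) * ((‖G x‖ + L * η) * ε / (ε + ‖G x‖)) := by
          rw [Real.exp_add, h4]; ring
      _ ≤ Real.exp (ω η) * (ε + L * η) := by
          gcongr
          rw [div_le_iff₀ (by positivity)]
          nlinarith [mul_nonneg (mul_nonneg hL0 hη.le) (norm_nonneg (G x)), norm_nonneg (G x),
            mul_nonneg (norm_nonneg (G x)) (norm_nonneg (G x))]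
  have hmax : ∀ η ∈ Ioo 0 y, ‖ψ (x + y * Complex.I)‖ ≤ Real.exp (ω η) * (ε + L * η) := by
    intro η hη
    have him : ∀ z : ℂ, (z + η * Complex.I).im = z.im + η := fun z => by simp
    have hd1 : DifferentiableOn ℂ (fun z => ψ (z + η * Complex.I)) {z | 0 ≤ z.im} :=
      hψd.comp (by fun_prop) fun z hz => by
        have : 0 ≤ z.im := hz
        have h0 := hη.1
        simp only [mem_ofPred_eq, him]; linarith
    have h := norm_le_of_norm_le_real (f := fun z => ψ (z + η * Complex.I)) (M := M)
      (hd1.mono fun z (hz : 0 < z.im) => (hz.le : 0 ≤ z.im)) hd1.continuousOn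
      (fun z hz => hψM _ (by rw [him]; linarith [hη.1])) (hline η hη.1)
      (z := x + (y - η : ℝ) * Complex.I) (by simpa using hη.2.le)
    convert h using 3
    push_cast
    ring
  have hlim : Tendsto (fun η => Real.exp (ω η) * (ε + L * η)) (𝓝[>] 0)
      (𝓝 (Real.exp 0 * (ε + L * 0))) := by
    refine ((Real.continuous_exp.tendsto 0).comp
      (tendsto_integral_min (L / ε) (by positivity) (by positivity))).mul ?_
    exact Tendsto.mono_left (Continuous.tendsto (by fun_prop) 0) nhdsWithin_le_nhds
  have hfin : ‖ψ (x + y * Complex.I)‖ ≤ ε := by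
    have := ge_of_tendsto hlim (by filter_upwards [Ioo_mem_nhdsGT hy] with η hη using hmax η hη)
    simpa using this
  rw [hnorm x hy, Real.exp_neg, ← div_eq_mul_inv, div_le_iff₀ (Real.exp_pos _)] at hfin
  exact hfin

/-- The square root of the modulus of a holomorphic function is dominated by the Poisson integral
of its boundary values. -/
theorem sqrt_norm_le_poisson (hd : DifferentiableOn ℂ G {z | 0 < z.im})
    (hL : ∀ z w : ℂ, 0 ≤ z.im → 0 ≤ w.im → ‖G z - G w‖ ≤ L * ‖z - w‖)
    (hM : ∀ z : ℂ, 0 ≤ z.im → ‖G z‖ ≤ M) (hi : Integrable fun x : ℝ => G x)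
    (x : ℝ) {y : ℝ} (hy : 0 < y) : √‖G (x + y * Complex.I)‖ ≤
      ∫ u : ℝ, √‖G (x + y * u : ℝ)‖ ∂poissonMeasure := by
  have hGc : Continuous fun t : ℝ => G t := by
    refine (LipschitzWith.of_dist_le_mul (K := L.toNNReal) fun s t => ?_).continuous
    rw [dist_eq_norm, dist_eq_norm]
    refine (hL s t (by simp) (by simp)).trans ?_
    rw [← Complex.ofReal_sub, Complex.norm_real]
    gcongr
    exact Real.le_coe_toNNReal L
  have hGu : Continuous fun u : ℝ => G (x + y * u : ℝ) :=
    hGc.comp (by fun_prop : Continuous fun u : ℝ => x + y * u)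
  have hM0 : 0 ≤ M := (norm_nonneg _).trans (hM 0 (by simp))
  have hbd : ∀ u : ℝ, ‖G (x + y * u : ℝ)‖ ≤ M := fun u => hM _ (by simp)
  have hint : Integrable (fun u : ℝ => √‖G (x + y * u : ℝ)‖) poissonMeasure := by
    refine Integrable.of_bound hGu.norm.sqrt.aestronglyMeasurable (√M)
      (Eventually.of_forall fun u => ?_)
    rw [Real.norm_of_nonneg (Real.sqrt_nonneg _)]
    exact Real.sqrt_le_sqrt (hbd u)
  refine le_of_forall_pos_le_add fun δ hδ => ?_
  -- This choice makes `√(ε + |G|) ≤ √|G| + δ`.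
  set ε := δ ^ 2
  have hε : 0 < ε := by positivity
  have hδε : √ε = δ := Real.sqrt_sq hδ.le
  set k : ℝ → ℝ := fun u => Real.log (1 + ‖G (x + y * u : ℝ)‖ / ε)
  have hpos : ∀ u : ℝ, 0 < 1 + ‖G (x + y * u : ℝ)‖ / ε := fun u => by positivity
  have hkc : Continuous k :=
    Continuous.log (continuous_const.add (hGu.norm.div_const ε)) fun u => (hpos u).ne'
  have hexp : ∀ u, √ε * Real.exp (k u / 2) = √(ε + ‖G (x + y * u : ℝ)‖) := by
    intro u
    rw [Real.exp_half, Real.exp_log (hpos u), ← Real.sqrt_mul hε.le]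
    congr 1
    field_simp
  have hik : Integrable (fun u => k u / 2) poissonMeasure := by
    refine Integrable.of_bound (hkc.div_const 2).aestronglyMeasurable (M / ε / 2)
      (Eventually.of_forall fun u => ?_)
    have h0 : 0 ≤ k u := Real.log_nonneg (by simp; positivity)
    rw [Real.norm_of_nonneg (by positivity)]
    have h1 := Real.log_le_sub_one_of_pos (hpos u)
    have h2 : ‖G (x + y * u : ℝ)‖ / ε ≤ M / ε := by gcongr; exact hbd u
    simp only [k]
    linarith
  have hie : Integrable (Real.exp ∘ fun u => k u / 2) poissonMeasure := by
    have h1 : Integrable (fun u => (√ε)⁻¹ * √(ε + ‖G (x + y * u : ℝ)‖)) poissonMeasure := by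
      refine Integrable.of_bound (continuous_const.mul
        (continuous_const.add hGu.norm).sqrt).aestronglyMeasurable ((√ε)⁻¹ * √(ε + M))
        (Eventually.of_forall fun u => ?_)
      rw [Real.norm_of_nonneg (by positivity)]
      gcongr
      exact hbd u
    refine h1.congr (Eventually.of_forall fun u => ?_)
    simp only [Function.comp]
    rw [← hexp, ← mul_assoc, inv_mul_cancel₀ (Real.sqrt_pos.2 hε).ne', one_mul]
  -- Jensen's inequality for the exponential turns the logarithmic majorant into a Poisson integral
  -- of `√(ε + |G|)`.
  have hJ : Real.exp (∫ u, k u / 2 ∂poissonMeasure) ≤ ∫ u, Real.exp (k u / 2) ∂poissonMeasure :=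
    convexOn_exp.map_integral_le Real.continuous_exp.continuousOn isClosed_univ
      (Eventually.of_forall fun _ => mem_univ _) hik hie
  calc √‖G (x + y * Complex.I)‖ ≤ √(ε * Real.exp (∫ u, k u ∂poissonMeasure)) :=
        Real.sqrt_le_sqrt (norm_le_exp_poisson hd hL hM hi hε x hy)
    _ = √ε * Real.exp (∫ u, k u / 2 ∂poissonMeasure) := by
        rw [Real.sqrt_mul hε.le, ← Real.exp_half, integral_div]
    _ ≤ √ε * ∫ u, Real.exp (k u / 2) ∂poissonMeasure := by gcongr
    _ = ∫ u, √(ε + ‖G (x + y * u : ℝ)‖) ∂poissonMeasure := by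
        rw [← integral_const_mul]
        simp_rw [hexp]
    _ ≤ ∫ u, (√‖G (x + y * u : ℝ)‖ + δ) ∂poissonMeasure := by
        refine integral_mono_of_nonneg (Eventually.of_forall fun u => Real.sqrt_nonneg _)
          (hint.add (integrable_const _)) (Eventually.of_forall fun u => ?_)
        simp only
        rw [add_comm, ← hδε]
        rw [Real.sqrt_le_left (by positivity), add_sq, Real.sq_sqrt (norm_nonneg _),
          Real.sq_sqrt hε.le]
        have : 0 ≤ 2 * √‖G (x + y * u : ℝ)‖ * √ε := by positivity
        linarith
    _ = _ := by
        rw [integral_add hint (integrable_const _)]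
        simp

end Subharmonic

/-! ### Convergence to the boundary values in `L¹`. -/

theorem lintegral_comp_mul_left (h : ℝ → ℝ≥0∞) {y : ℝ} (hy : y ≠ 0) :
    ∫⁻ u, h (y * u) = ENNReal.ofReal |y⁻¹| * ∫⁻ t, h t := by
  have h1 := (measurableEmbedding_mulLeft₀ hy).lintegral_map (μ := volume) h
  rw [Real.map_volume_mul_left hy, lintegral_smul_measure, smul_eq_mul] at h1
  exact h1.symm

theorem lintegral_comp_affine (h : ℝ → ℝ≥0∞) (x : ℝ) {y : ℝ} (hy : y ≠ 0) :
    ∫⁻ u, h (x + y * u) = ENNReal.ofReal |y⁻¹| * ∫⁻ t, h t := by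
  rw [lintegral_comp_mul_left (fun t => h (x + t)) hy, lintegral_add_left_eq_self]

theorem quasiMeasurePreserving_affine (x : ℝ) {y : ℝ} (hy : y ≠ 0) :
    Measure.QuasiMeasurePreserving (fun u : ℝ => x + y * u) := by
  refine ⟨by fun_prop, ?_⟩
  refine Measure.AbsolutelyContinuous.mk fun s hs h0 => ?_
  rw [Measure.map_apply (by fun_prop) hs, ← lintegral_indicator_one (hs.preimage (by fun_prop))]
  have h1 := lintegral_comp_affine (s.indicator 1) x hy
  rw [lintegral_indicator_one hs, h0, mul_zero] at h1
  exact h1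

theorem lintegral_poissonMeasure_affine_le (h : ℝ → ℝ≥0∞) (x : ℝ) {y : ℝ} (hy : 0 < y) :
    ∫⁻ u, h (x + y * u) ∂poissonMeasure ≤ ENNReal.ofReal y⁻¹ * ∫⁻ t, h t := by
  have h1 : poissonMeasure ≤ volume := by
    rw [poissonMeasure_eq_withDensity]
    conv_rhs => rw [← withDensity_one (μ := (volume : Measure ℝ))]
    refine withDensity_mono (Eventually.of_forall fun u => ?_)
    rw [Pi.one_apply, ← ENNReal.ofReal_one]
    refine ENNReal.ofReal_le_ofReal ?_
    exact mul_le_one₀ (inv_le_one_of_one_le₀ (by linarith [Real.pi_gt_three])) (by positivity)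
      (inv_le_one_of_one_le₀ (by nlinarith))
  refine (lintegral_mono' h1 le_rfl).trans (le_of_eq ?_)
  rw [lintegral_comp_affine h x hy.ne', abs_of_pos (inv_pos.2 hy)]

/-- A limit of nonnegative functions, bounded in `L²`, passes to the limit in an upper estimate by
integrals. -/
theorem le_integral_of_tendsto {α : Type*} [MeasurableSpace α] {μ : Measure α} [IsFiniteMeasure μ]
    {v : ℝ → α → ℝ} {w : α → ℝ} {c : ℝ → ℝ} {c₀ S : ℝ} {l : Filter ℝ} [l.NeBot]
    [l.IsCountablyGenerated] (hc : Tendsto c l (𝓝 c₀))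
    (hvi : ∀ᶠ δ in l, Integrable (v δ) μ) (hv2 : ∀ᶠ δ in l, Integrable (fun a => v δ a ^ 2) μ)
    (hv0 : ∀ δ a, 0 ≤ v δ a) (hw : Integrable w μ)
    (hS : ∀ᶠ δ in l, ∫ a, v δ a ^ 2 ∂μ ≤ S)
    (hle : ∀ᶠ δ in l, c δ ≤ ∫ a, v δ a ∂μ)
    (hlim : ∀ᵐ a ∂μ, Tendsto (fun δ => v δ a) l (𝓝 (w a))) : c₀ ≤ ∫ a, w a ∂μ := by
  -- From `v ≤ min v M + v² / M`, the `L²` bound leaves a tail of order `1 / M`, uniformly in the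
  -- parameter, while the truncated part converges by domination.
  have key : ∀ M > 0, c₀ ≤ ∫ a, w a ∂μ + S / M := by
    intro M hM
    have h1 : Tendsto (fun δ => ∫ a, min (v δ a) M ∂μ) l (𝓝 (∫ a, min (w a) M ∂μ)) := by
      refine tendsto_integral_filter_of_dominated_convergence (fun _ => M) ?_ ?_
        (integrable_const _) ?_
      · filter_upwards [hvi] with δ hδ using (hδ.1.inf aestronglyMeasurable_const)
      · refine Eventually.of_forall fun δ => Eventually.of_forall fun a => ?_
        rw [Real.norm_of_nonneg (le_min (hv0 δ a) hM.le)]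
        exact min_le_right _ _
      · filter_upwards [hlim] with a ha using ha.min tendsto_const_nhds
    have h2 : c₀ ≤ ∫ a, min (w a) M ∂μ + S / M := by
      refine le_of_tendsto_of_tendsto hc (h1.add_const _) ?_
      filter_upwards [hvi, hv2, hS, hle] with δ hi hi2 hSδ hδ
      have hmin : Integrable (fun a => min (v δ a) M) μ := hi.inf (integrable_const M)
      calc c δ ≤ ∫ a, v δ a ∂μ := hδ
        _ ≤ ∫ a, (min (v δ a) M + v δ a ^ 2 / M) ∂μ := by
            refine integral_mono hi (hmin.add (hi2.div_const M)) fun a => ?_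
            simp only
            rcases le_total (v δ a) M with h | h
            · rw [min_eq_left h]
              have : 0 ≤ v δ a ^ 2 / M := by positivity
              linarith
            · rw [min_eq_right h]
              have : v δ a ≤ v δ a ^ 2 / M := by
                rw [le_div_iff₀ hM]
                nlinarith [hv0 δ a]
              linarith
        _ = ∫ a, min (v δ a) M ∂μ + (∫ a, v δ a ^ 2 ∂μ) / M := by
            rw [integral_add hmin (hi2.div_const M), integral_div]
        _ ≤ _ := by gcongr
    refine h2.trans ?_
    gcongr
    · exact hw.inf (integrable_const M)
    · intro a
      exact min_le_left _ _
  have hlim2 : Tendsto (fun M : ℝ => ∫ a, w a ∂μ + S / M) atTop (𝓝 (∫ a, w a ∂μ + 0)) :=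
    (tendsto_const_nhds.div_atTop tendsto_id).const_add _
  rw [add_zero] at hlim2
  exact ge_of_tendsto hlim2 ((eventually_gt_atTop 0).mono key)

/-- A.e. convergence together with an upper bound for the norms implies convergence in `L¹`. -/
theorem tendsto_integral_norm_sub {α : Type*} [MeasurableSpace α] {μ : Measure α}
    {l : Filter ℝ} [l.IsCountablyGenerated] {f : ℝ → α → ℂ} {b : α → ℂ}
    (hf : ∀ᶠ y in l, Integrable (f y) μ) (hb : Integrable b μ)
    (hlim : ∀ᵐ a ∂μ, Tendsto (fun y => f y a) l (𝓝 (b a)))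
    (hle : ∀ᶠ y in l, ∫ a, ‖f y a‖ ∂μ ≤ ∫ a, ‖b a‖ ∂μ) :
    Tendsto (fun y => ∫ a, ‖f y a - b a‖ ∂μ) l (𝓝 0) := by
  -- The difference `‖f - b‖ - ‖f‖` is dominated by `‖b‖`, so no majorant for the family `f y` is
  -- required.
  have h1 : Tendsto (fun y => ∫ a, (‖f y a - b a‖ - ‖f y a‖) ∂μ) l (𝓝 (∫ a, -‖b a‖ ∂μ)) := by
    refine tendsto_integral_filter_of_dominated_convergence (fun a => ‖b a‖) ?_ ?_ hb.norm ?_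
    · filter_upwards [hf] with y hy using ((hy.sub hb).norm.sub hy.norm).1
    · refine Eventually.of_forall fun y => Eventually.of_forall fun a => ?_
      rw [Real.norm_eq_abs]
      refine (abs_norm_sub_norm_le _ _).trans (le_of_eq ?_)
      rw [sub_sub_cancel_left, norm_neg]
    · filter_upwards [hlim] with a ha
      have h2 := (ha.sub_const (b a)).norm.sub ha.norm
      simpa using h2
  rw [integral_neg] at h1
  have h2 := h1.add_const (∫ a, ‖b a‖ ∂μ)
  rw [neg_add_cancel] at h2
  refine squeeze_zero' (Eventually.of_forall fun y => integral_nonneg fun a => norm_nonneg _) ?_ h2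
  filter_upwards [hf, hle] with y hy hley
  have h3 := integral_sub (hy.sub hb).norm hy.norm
  simp only [Pi.sub_apply] at h3
  rw [h3]
  linarith

namespace DecayingHardyOne

variable {A B : ℝ} {g : ℂ → ℂ}

theorem norm_le_div (hg : DecayingHardyOne A B g) {c : ℝ} (hc : 0 < c) {z : ℂ} (hz : c ≤ z.im) :
    ‖g z‖ ≤ A / c := by
  have hA := hg.A_nonneg
  have hz0 : 0 < z.im := hc.trans_le hz
  refine (hg.decay z hz0).trans ?_
  gcongr
  exact hz.trans (le_mul_of_one_le_right hz0.le (one_le_pow₀ (by linarith)))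

/-- Above height `δ / 2` the function is bounded by `A / (δ / 2)`; Cauchy's estimate on discs of
radius `δ / 2` then bounds the derivative of the shifted function on the closed half-plane. -/
theorem norm_sub_le_shift (hg : DecayingHardyOne A B g) {δ : ℝ} (hδ : 0 < δ) {z w : ℂ}
    (hz : 0 ≤ z.im) (hw : 0 ≤ w.im) : ‖g (z + δ * Complex.I) - g (w + δ * Complex.I)‖ ≤
      A / (δ / 2) / (δ / 2) * ‖z - w‖ := by
  have him : ∀ z : ℂ, (z + δ * Complex.I).im = z.im + δ := fun z => by simp
  have hd : ∀ z ∈ {z : ℂ | 0 ≤ z.im}, HasDerivAt (fun z => g (z + δ * Complex.I))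
      (deriv g (z + δ * Complex.I)) z := by
    intro z hz
    have hz' : 0 ≤ z.im := hz
    exact (hg.differentiableAt (by rw [him]; linarith)).hasDerivAt.comp_add_const z _
  refine Convex.norm_image_sub_le_of_norm_deriv_le (s := {z : ℂ | 0 ≤ z.im})
    (f := fun z => g (z + δ * Complex.I)) (fun z hz => (hd z hz).differentiableAt)
    (fun z hz => ?_) (convex_halfSpace_im_ge 0) hw hz
  rw [(hd z hz).deriv]
  have hz' : 0 ≤ z.im := hz
  have hball : ∀ w ∈ Metric.closedBall (z + δ * Complex.I) (δ / 2), δ / 2 ≤ w.im := by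
    intro w hw
    rw [mem_closedBall_iff_norm] at hw
    have h2 := (Complex.abs_im_le_norm _).trans hw
    rw [Complex.sub_im, him, abs_le] at h2
    linarith
  refine Complex.norm_deriv_le_of_forall_mem_sphere_norm_le (half_pos hδ) ?_ fun w hw =>
    hg.norm_le_div (half_pos hδ) (hball w (Metric.sphere_subset_closedBall hw))
  exact (hg.diff.mono fun w hw => (half_pos hδ).trans_le (hball w hw)).diffContOnCl_ball subset_rfl

theorem integrable_line (hg : DecayingHardyOne A B g) {y : ℝ} (hy : 0 < y) :
    Integrable fun x : ℝ => g (x + y * Complex.I) :=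
  ⟨(continuous_horizontal_line hg.diff.continuousOn hy).aestronglyMeasurable,
    (hg.lintegral_le y hy).trans_lt ENNReal.ofReal_lt_top⟩

theorem sqrt_norm_le_poisson_shift (hg : DecayingHardyOne A B g) (x : ℝ) {y δ : ℝ} (hy : 0 < y)
    (hδ : 0 < δ) : √‖g (x + y * Complex.I + δ * Complex.I)‖ ≤
      ∫ u : ℝ, √‖g ((x + y * u : ℝ) + δ * Complex.I)‖ ∂poissonMeasure := by
  refine sqrt_norm_le_poisson (G := fun z => g (z + δ * Complex.I)) (M := A / δ) ?_
    (fun z w hz hw => hg.norm_sub_le_shift hδ hz hw) (fun z hz => hg.norm_le_div hδ (by simpa using hz))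
    (hg.integrable_line hδ) x hy
  refine hg.diff.comp (by fun_prop) fun z hz => ?_
  have : 0 < z.im := hz
  simp; linarith

variable {b : ℝ → ℂ}

theorem integrable_limit (hg : DecayingHardyOne A B g)
    (hb : ∀ᵐ x : ℝ, Tendsto (fun y : ℝ => g (x + y * Complex.I)) (𝓝[>] 0) (𝓝 (b x))) :
    Integrable b := by
  refine ⟨aestronglyMeasurable_of_tendsto_vertical hg.diff.continuousOn hb, ?_⟩
  have hseq : Tendsto (fun n : ℕ => 1 / ((n : ℝ) + 1)) atTop (𝓝[>] 0) :=
    tendsto_nhdsWithin_iff.2 ⟨tendsto_one_div_add_atTop_nhds_zero_nat,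
      Eventually.of_forall fun n => show (0 : ℝ) < 1 / ((n : ℝ) + 1) by positivity⟩
  refine lt_of_le_of_lt ?_ (ENNReal.ofReal_lt_top (r := B))
  calc ∫⁻ x, ‖b x‖ₑ = ∫⁻ x : ℝ, liminf (fun n : ℕ =>
        ‖g (x + (1 / ((n : ℝ) + 1) : ℝ) * Complex.I)‖ₑ) atTop := by
        refine lintegral_congr_ae ?_
        filter_upwards [hb] with x hx
        exact (((continuous_enorm.tendsto _).comp hx).comp hseq).liminf_eq.symm
    _ ≤ liminf (fun n : ℕ => ∫⁻ x : ℝ, ‖g (x + (1 / ((n : ℝ) + 1) : ℝ) * Complex.I)‖ₑ) atTop := by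
        refine lintegral_liminf_le' fun n => ?_
        exact (continuous_horizontal_line hg.diff.continuousOn (by positivity)).enorm.aemeasurable
    _ ≤ ENNReal.ofReal B := by
        refine liminf_le_of_le (by isBoundedDefault) fun c hc => ?_
        obtain ⟨n, hn⟩ := hc.exists
        exact hn.trans (hg.lintegral_le _ (by positivity))

theorem integrable_poisson_limit (hbi : Integrable b) (x : ℝ) {y : ℝ} (hy : 0 < y) :
    Integrable (fun u : ℝ => b (x + y * u)) poissonMeasure := by
  refine ⟨(hbi.1.comp_quasiMeasurePreserving (quasiMeasurePreserving_affine x hy.ne')).mono_ac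
    poissonMeasure_absolutelyContinuous, ?_⟩
  refine (lintegral_poissonMeasure_affine_le (fun t => ‖b t‖ₑ) x hy).trans_lt ?_
  exact ENNReal.mul_lt_top ENNReal.ofReal_lt_top hbi.2

theorem integrable_sqrt_norm {α : Type*} [MeasurableSpace α] {μ : Measure α} [IsFiniteMeasure μ]
    {b : α → ℂ} (hb : Integrable b μ) : Integrable (fun a => √‖b a‖) μ := by
  refine ((integrable_const 1).add hb.norm).mono'
    (Real.continuous_sqrt.comp_aestronglyMeasurable hb.norm.1) (Eventually.of_forall fun a => ?_)
  rw [Real.norm_of_nonneg (Real.sqrt_nonneg _), Pi.add_apply, Real.sqrt_le_left (by positivity)]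
  nlinarith [norm_nonneg (b a)]

/-- An `L¹` bound alone would not allow the limit `δ → 0` under the Poisson integral. For square
roots the same bound is an `L²` bound, which gives uniform integrability; this is why the majorant
is first proved for `√|g|`. -/
theorem sqrt_norm_le_poisson_limit (hg : DecayingHardyOne A B g)
    (hb : ∀ᵐ x : ℝ, Tendsto (fun y : ℝ => g (x + y * Complex.I)) (𝓝[>] 0) (𝓝 (b x)))
    (x : ℝ) {y : ℝ} (hy : 0 < y) : √‖g (x + y * Complex.I)‖ ≤
      ∫ u : ℝ, √‖b (x + y * u)‖ ∂poissonMeasure := by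
  have hbi := hg.integrable_limit hb
  have hli : ∀ δ : ℝ, 0 < δ → Integrable (fun u : ℝ => g ((x + y * u : ℝ) + δ * Complex.I))
      poissonMeasure := fun δ hδ => integrable_poisson_limit (hg.integrable_line hδ) x hy
  refine le_integral_of_tendsto (l := 𝓝[>] (0 : ℝ)) (S := y⁻¹ * B ⊔ 0)
    (v := fun δ u => √‖g ((x + y * u : ℝ) + δ * Complex.I)‖)
    (c := fun δ => √‖g (x + y * Complex.I + δ * Complex.I)‖) ?_ ?_ ?_
    (fun δ u => Real.sqrt_nonneg _) (integrable_sqrt_norm (integrable_poisson_limit hbi x hy)) ?_ ?_ ?_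
  · refine Tendsto.mono_left ?_ nhdsWithin_le_nhds
    have h1 : Tendsto (fun δ : ℝ => (x + y * Complex.I + δ * Complex.I : ℂ)) (𝓝 0)
        (𝓝 (x + y * Complex.I)) := Continuous.tendsto' (by fun_prop) _ _ (by simp)
    exact ((hg.differentiableAt (by simpa using hy)).continuousAt.tendsto.comp h1).norm.sqrt
  · filter_upwards [self_mem_nhdsWithin] with δ hδ using integrable_sqrt_norm (hli δ hδ)
  · filter_upwards [self_mem_nhdsWithin] with δ hδ
    simp_rw [Real.sq_sqrt (norm_nonneg _)]
    exact (hli δ hδ).norm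
  · filter_upwards [self_mem_nhdsWithin] with δ hδ
    simp_rw [Real.sq_sqrt (norm_nonneg _)]
    rw [integral_norm_eq_lintegral_enorm (hli δ hδ).1]
    have h1 := lintegral_poissonMeasure_affine_le (fun t : ℝ => ‖g (t + δ * Complex.I)‖ₑ) x hy
    have h2 : ∫⁻ u : ℝ, ‖g ((x + y * u : ℝ) + δ * Complex.I)‖ₑ ∂poissonMeasure ≤
        ENNReal.ofReal (y⁻¹ * B) := by
      rw [ENNReal.ofReal_mul (inv_nonneg.2 hy.le)]
      refine h1.trans ?_
      gcongr
      exact hg.lintegral_le δ hδ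
    have h3 := ENNReal.toReal_mono ENNReal.ofReal_ne_top h2
    rwa [ENNReal.toReal_ofReal'] at h3
  · filter_upwards [self_mem_nhdsWithin] with δ hδ using hg.sqrt_norm_le_poisson_shift x hy hδ
  · have h1 := poissonMeasure_absolutelyContinuous.ae_le
      ((quasiMeasurePreserving_affine x hy.ne').ae hb)
    filter_upwards [h1] with u hu
    exact hu.norm.sqrt

/-- Squaring the estimate for `√|g|` and applying Jensen to the square. -/
theorem enorm_le_poisson_limit (hg : DecayingHardyOne A B g)
    (hb : ∀ᵐ x : ℝ, Tendsto (fun y : ℝ => g (x + y * Complex.I)) (𝓝[>] 0) (𝓝 (b x)))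
    (x : ℝ) {y : ℝ} (hy : 0 < y) : ‖g (x + y * Complex.I)‖ₑ ≤
      ∫⁻ u : ℝ, ‖b (x + y * u)‖ₑ ∂poissonMeasure := by
  have hbi := integrable_poisson_limit (hg.integrable_limit hb) x hy
  have h1 := hg.sqrt_norm_le_poisson_limit hb x hy
  have h2 : (∫ u : ℝ, √‖b (x + y * u)‖ ∂poissonMeasure) ^ 2 ≤
      ∫ u : ℝ, √‖b (x + y * u)‖ ^ 2 ∂poissonMeasure := by
    refine (even_two.convexOn_pow (𝕜 := ℝ)).map_integral_le (continuous_pow 2).continuousOn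
      isClosed_univ (Eventually.of_forall fun _ => mem_univ _) (integrable_sqrt_norm hbi) ?_
    refine hbi.norm.congr (Eventually.of_forall fun u => ?_)
    simp only [Function.comp, Real.sq_sqrt (norm_nonneg _)]
  simp_rw [Real.sq_sqrt (norm_nonneg _)] at h2
  have h3 : ‖g (x + y * Complex.I)‖ ≤ ∫ u : ℝ, ‖b (x + y * u)‖ ∂poissonMeasure := by
    refine le_trans ?_ h2
    rw [← Real.sq_sqrt (norm_nonneg (g (x + y * Complex.I)))]
    gcongr
  rw [← ofReal_norm]
  refine (ENNReal.ofReal_le_ofReal h3).trans (le_of_eq ?_)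
  rw [integral_norm_eq_lintegral_enorm hbi.1, ENNReal.ofReal_toReal hbi.2.ne]

/-- The Poisson measure has mass one and Lebesgue measure is translation invariant, so integrating
the Poisson majorant over `x` returns the norm of `b`. A measurable representative of `b` is chosen
for Tonelli. -/
theorem lintegral_line_le_limit (hg : DecayingHardyOne A B g)
    (hb : ∀ᵐ x : ℝ, Tendsto (fun y : ℝ => g (x + y * Complex.I)) (𝓝[>] 0) (𝓝 (b x)))
    {y : ℝ} (hy : 0 < y) : ∫⁻ x : ℝ, ‖g (x + y * Complex.I)‖ₑ ≤ ∫⁻ x : ℝ, ‖b x‖ₑ := by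
  have hbm := (hg.integrable_limit hb).1
  obtain ⟨b', hb'm, hbb'⟩ := hbm
  have hb' : ∀ᵐ x : ℝ, Tendsto (fun y : ℝ => g (x + y * Complex.I)) (𝓝[>] 0) (𝓝 (b' x)) := by
    filter_upwards [hb, hbb'] with x h1 h2
    rwa [← h2]
  calc ∫⁻ x : ℝ, ‖g (x + y * Complex.I)‖ₑ
      ≤ ∫⁻ x : ℝ, ∫⁻ u : ℝ, ‖b' (x + y * u)‖ₑ ∂poissonMeasure :=
        lintegral_mono fun x => hg.enorm_le_poisson_limit hb' x hy
    _ = ∫⁻ u : ℝ, (∫⁻ x : ℝ, ‖b' (x + y * u)‖ₑ) ∂poissonMeasure := by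
        have hm : Measurable (Function.uncurry fun x u : ℝ => ‖b' (x + y * u)‖ₑ) :=
          (hb'm.measurable.comp (by fun_prop : Measurable fun q : ℝ × ℝ => q.1 + y * q.2)).enorm
        exact lintegral_lintegral_swap hm.aemeasurable
    _ = ∫⁻ x : ℝ, ‖b' x‖ₑ := by
        have h1 : ∀ u : ℝ, ∫⁻ x : ℝ, ‖b' (x + y * u)‖ₑ = ∫⁻ x : ℝ, ‖b' x‖ₑ := fun u =>
          lintegral_add_right_eq_self (fun x => ‖b' x‖ₑ) (y * u)
        rw [lintegral_congr h1]
        simp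
    _ = _ := lintegral_congr_ae (hbb'.mono fun x hx => by simp only [hx])

/-- Horizontal traces converge to the boundary values in `L¹`. -/
theorem tendsto_integral_norm_sub_limit (hg : DecayingHardyOne A B g)
    (hb : ∀ᵐ x : ℝ, Tendsto (fun y : ℝ => g (x + y * Complex.I)) (𝓝[>] 0) (𝓝 (b x))) :
    Tendsto (fun y : ℝ => ∫ x : ℝ, ‖g (x + y * Complex.I) - b x‖) (𝓝[>] 0) (𝓝 0) := by
  have hbi := hg.integrable_limit hb
  refine tendsto_integral_norm_sub (f := fun (y : ℝ) (x : ℝ) => g (x + y * Complex.I)) ?_ hbi hb ?_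
  · filter_upwards [self_mem_nhdsWithin] with y hy using hg.integrable_line hy
  · filter_upwards [self_mem_nhdsWithin] with y hy
    rw [integral_norm_eq_lintegral_enorm (hg.integrable_line hy).1,
      integral_norm_eq_lintegral_enorm hbi.1]
    exact ENNReal.toReal_mono hbi.2.ne (hg.lintegral_line_le_limit hb hy)

end DecayingHardyOne

/-! ### From Hardy functions to the decaying class. -/

theorem one_add_sq_le_norm_pow (x : ℝ) {y : ℝ} (hy : 0 ≤ y) :
    1 + x ^ 2 ≤ ‖(x + y * Complex.I + Complex.I : ℂ)‖ ^ 3 := by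
  have h1 : ‖(x + y * Complex.I + Complex.I : ℂ)‖ ^ 2 = x ^ 2 + (y + 1) ^ 2 := by
    rw [← Complex.normSq_eq_norm_sq, Complex.normSq_apply]
    simp
    ring
  have h2 : 1 ≤ ‖(x + y * Complex.I + Complex.I : ℂ)‖ := by
    rw [← one_le_sq_iff₀ (norm_nonneg _), h1]
    nlinarith [sq_nonneg x]
  calc 1 + x ^ 2 ≤ ‖(x + y * Complex.I + Complex.I : ℂ)‖ ^ 2 := by rw [h1]; nlinarith
    _ ≤ _ := pow_le_pow_right₀ h2 (by norm_num)

theorem one_add_im_le_norm_add_I {z : ℂ} : 1 + z.im ≤ ‖z + Complex.I‖ := by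
  refine le_trans ?_ (Complex.abs_im_le_norm _)
  rw [Complex.add_im, Complex.I_im, add_comm]
  exact le_abs_self _

theorem add_I_ne_zero {z : ℂ} (hz : 0 ≤ z.im) : z + Complex.I ≠ 0 :=
  norm_pos_iff.1 (lt_of_lt_of_le (by linarith) one_add_im_le_norm_add_I)

theorem MemHardy.lintegral_line_rpow_le {p : ℝ≥0∞} (hp : 1 ≤ p) (hp' : p ≠ ∞) (f : ℂ → ℂ) {y : ℝ}
    (hy : 0 < y) : ∫⁻ x : ℝ, ‖f (x + y * Complex.I)‖ₑ ^ p.toReal ≤ hardyNorm p f ^ p.toReal := by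
  have h := eLpNorm_line_le_hardyNorm hp f hy
  have hpos : 0 < p.toReal := ENNReal.toReal_pos (by positivity) hp'
  rw [eLpNorm_eq_lintegral_rpow_enorm_toReal (by positivity) hp', one_div] at h
  rwa [← ENNReal.rpow_inv_le_iff hpos]

/-- The cube serves two purposes. Since `y^(-1/p) ≤ (1 + y) / y`, one power absorbs the numerator
and two give the decay `(1 + y)^(-2)`. On lines `|z + i|³ ≥ 1 + x²` supplies an integrable weight `w
≤ 1`, and `|f| w ≤ w + |f|^p` for finite `p`, so a single `L¹` class covers every exponent. -/
theorem MemHardy.decayingHardyOne {p : ℝ≥0∞} (hp : 1 ≤ p) {f : ℂ → ℂ} (hf : MemHardy p f) :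
    ∃ A B, DecayingHardyOne A B fun z => f z / (z + Complex.I) ^ 3 := by
  set N := hardyNorm p f
  have hN : N ≠ ∞ := hf.2.ne
  have hw : ∫⁻ x : ℝ, ENNReal.ofReal (1 + x ^ 2)⁻¹ < ∞ := by
    have := integrable_inv_one_add_sq.hasFiniteIntegral
    rw [hasFiniteIntegral_iff_ofReal (Eventually.of_forall fun x => by positivity)] at this
    exact this
  have hle : ∃ B : ℝ, ∀ y : ℝ, 0 < y → ∫⁻ x : ℝ, ‖f (x + y * Complex.I)‖ₑ *
      ENNReal.ofReal (1 + x ^ 2)⁻¹ ≤ ENNReal.ofReal B := by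
    have hmeasw : Measurable fun x : ℝ => ENNReal.ofReal (1 + x ^ 2)⁻¹ := by fun_prop
    by_cases hp' : p = ∞
    · refine ⟨(N * ∫⁻ x : ℝ, ENNReal.ofReal (1 + x ^ 2)⁻¹).toReal, fun y hy => ?_⟩
      rw [ENNReal.ofReal_toReal (by finiteness), ← lintegral_const_mul _ hmeasw]
      refine lintegral_mono fun x => ?_
      gcongr
      simp only [N, hardyNorm, if_pos hp']
      exact le_iSup₂ (f := fun z (_ : z ∈ upperHalfPlaneSet) => ‖f z‖ₑ) _
        (add_mul_I_mem_upperHalfPlaneSet x hy)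
    · refine ⟨((∫⁻ x : ℝ, ENNReal.ofReal (1 + x ^ 2)⁻¹) + N ^ p.toReal).toReal, fun y hy => ?_⟩
      rw [ENNReal.ofReal_toReal (by finiteness)]
      refine le_trans ?_ (add_le_add le_rfl (MemHardy.lintegral_line_rpow_le hp hp' f hy))
      rw [← lintegral_add_left hmeasw]
      refine lintegral_mono fun x => ?_
      have hp1 : 1 ≤ p.toReal := by
        simpa using ENNReal.toReal_mono hp' hp
      have hw1 : ENNReal.ofReal (1 + x ^ 2)⁻¹ ≤ 1 := by
        rw [← ENNReal.ofReal_one]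
        exact ENNReal.ofReal_le_ofReal (inv_le_one_of_one_le₀ (by nlinarith))
      rcases le_total ‖f (x + y * Complex.I)‖ₑ 1 with h | h
      · exact (mul_le_of_le_one_left zero_le h).trans le_self_add
      · refine (mul_le_of_le_one_right zero_le hw1).trans (le_trans ?_ le_add_self)
        simpa using ENNReal.rpow_le_rpow_of_exponent_le h hp1
  obtain ⟨B, hB⟩ := hle
  refine ⟨2 * N.toReal, B, ?_, fun z hz => ?_, fun y hy => ?_⟩
  · exact hf.1.div (by fun_prop) fun z hz => pow_ne_zero 3 (add_I_ne_zero (le_of_lt hz))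
  · have h1 := hf.norm_le hp hz
    have h2 : z.im ^ (-p⁻¹.toReal) ≤ (1 + z.im) / z.im := by
      have h3 : z.im ^ (-p⁻¹.toReal) = (z.im⁻¹) ^ p⁻¹.toReal := by
        rw [Real.rpow_neg hz.le, Real.inv_rpow hz.le]
      have h4 : (1 + z.im) / z.im = 1 + z.im⁻¹ := by field_simp; ring
      have h5 : 0 < z.im⁻¹ := inv_pos.2 hz
      rw [h3, h4]
      calc (z.im⁻¹) ^ p⁻¹.toReal ≤ (1 + z.im⁻¹) ^ p⁻¹.toReal :=
            Real.rpow_le_rpow h5.le (by linarith) ENNReal.toReal_nonneg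
        _ ≤ (1 + z.im⁻¹) ^ (1 : ℝ) :=
            Real.rpow_le_rpow_of_exponent_le (by linarith) (toReal_inv_le_one hp)
        _ = _ := Real.rpow_one _
    rw [norm_div, norm_pow]
    calc ‖f z‖ / ‖z + Complex.I‖ ^ 3
        ≤ (2 * N.toReal * ((1 + z.im) / z.im)) / (1 + z.im) ^ 3 := by
          gcongr
          · exact h1.trans (by gcongr)
          · exact one_add_im_le_norm_add_I
      _ = _ := by field_simp
  · refine le_trans (lintegral_mono fun x => ?_) (hB y hy)
    rw [← ofReal_norm, ← ofReal_norm, ← ENNReal.ofReal_mul (norm_nonneg _), norm_div, norm_pow,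
      div_eq_mul_inv]
    gcongr
    exact one_add_sq_le_norm_pow x hy.le

theorem tendsto_add_I_pow (x : ℝ) : Tendsto (fun y : ℝ => (x + y * Complex.I + Complex.I) ^ 3)
    (𝓝[>] 0) (𝓝 ((x + Complex.I) ^ 3)) :=
  Tendsto.mono_left (Continuous.tendsto' (by fun_prop) _ _ (by simp)) nhdsWithin_le_nhds

theorem MemHardy.hasBoundaryValue {p : ℝ≥0∞} (hp : 1 ≤ p) {f : ℂ → ℂ} (hf : MemHardy p f) :
    HasBoundaryValue f := by
  obtain ⟨A, B, hg⟩ := hf.decayingHardyOne hp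
  filter_upwards [hg.exists_tendsto] with x hx
  obtain ⟨a, ha⟩ := hx
  refine tendsto_nhds_limUnder ⟨a * (x + Complex.I) ^ 3, ?_⟩
  refine Tendsto.congr' ?_ (ha.mul (tendsto_add_I_pow x))
  filter_upwards [self_mem_nhdsWithin] with y hy
  have hy' : 0 < y := hy
  exact div_mul_cancel₀ _ (pow_ne_zero 3 (add_I_ne_zero (by simpa using hy'.le)))

theorem MemHardy.aestronglyMeasurable_boundaryValue {p : ℝ≥0∞} (hp : 1 ≤ p) {f : ℂ → ℂ}
    (hf : MemHardy p f) : AEStronglyMeasurable (boundaryValue f) :=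
  aestronglyMeasurable_of_tendsto_vertical hf.1.continuousOn (hf.hasBoundaryValue hp)

theorem MemHardy.eLpNorm_boundaryValue_le {p : ℝ≥0∞} (hp : 1 ≤ p) {f : ℂ → ℂ}
    (hf : MemHardy p f) : eLpNorm (boundaryValue f) p volume ≤ hardyNorm p f := by
  have hseq : Tendsto (fun n : ℕ => 1 / ((n : ℝ) + 1)) atTop (𝓝[>] 0) :=
    tendsto_nhdsWithin_iff.2 ⟨tendsto_one_div_add_atTop_nhds_zero_nat,
      Eventually.of_forall fun n => show (0 : ℝ) < 1 / ((n : ℝ) + 1) by positivity⟩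
  refine (Lp.eLpNorm_lim_le_liminf_eLpNorm
    (f := fun (n : ℕ) (x : ℝ) => f (x + (1 / ((n : ℝ) + 1) : ℝ) * Complex.I))
    (fun n => (continuous_horizontal_line hf.1.continuousOn (by positivity)).aestronglyMeasurable)
    _ ((hf.hasBoundaryValue hp).mono fun x hx => hx.comp hseq)).trans ?_
  refine liminf_le_of_le (by isBoundedDefault) fun c hc => ?_
  obtain ⟨n, hn⟩ := hc.exists
  exact hn.trans (eLpNorm_line_le_hardyNorm hp f (by positivity))

theorem MemHardy.memLp_boundaryValue {p : ℝ≥0∞} (hp : 1 ≤ p) {f : ℂ → ℂ}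
    (hf : MemHardy p f) : MemLp (boundaryValue f) p :=
  ⟨hf.aestronglyMeasurable_boundaryValue hp, (hf.eLpNorm_boundaryValue_le hp).trans_lt hf.2⟩

/-- Horizontal traces of Hardy functions converge to the boundary values in `L¹_loc`. -/
theorem MemHardy.tendsto_lintegral_boundaryValue {p : ℝ≥0∞} (hp : 1 ≤ p) {f : ℂ → ℂ}
    (hf : MemHardy p f) (R : ℝ) :
    Tendsto (fun y : ℝ => ∫⁻ x in Ioo (-R) R, ‖f (x + y * Complex.I) - boundaryValue f x‖ₑ)
      (𝓝[>] 0) (𝓝 0) := by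
  obtain ⟨A, B, hg⟩ := hf.decayingHardyOne hp
  set g : ℂ → ℂ := fun z => f z / (z + Complex.I) ^ 3
  set b : ℝ → ℂ := fun x => boundaryValue f x / (x + Complex.I) ^ 3
  have hx0 : ∀ x : ℝ, ((x : ℂ) + Complex.I) ^ 3 ≠ 0 := fun x =>
    pow_ne_zero 3 (add_I_ne_zero (by simp))
  have hb : ∀ᵐ x : ℝ, Tendsto (fun y : ℝ => g (x + y * Complex.I)) (𝓝[>] 0) (𝓝 (b x)) := by
    filter_upwards [hf.hasBoundaryValue hp] with x hx
    exact hx.div (tendsto_add_I_pow x) (hx0 x)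
  have hbi := hg.integrable_limit hb
  set C := (|R| + 2) ^ 3
  have hC : ∀ y ∈ Ioo (0 : ℝ) 1, ∀ x ∈ Ioo (-R) R, ‖(x + y * Complex.I + Complex.I) ^ 3‖ ≤ C := by
    intro y hy x hx
    rw [norm_pow]
    simp only [C]
    gcongr
    refine (norm_add₃_le).trans ?_
    rw [norm_mul, Complex.norm_I, Complex.norm_real, Complex.norm_real, mul_one,
      Real.norm_of_nonneg hy.1.le, Real.norm_eq_abs]
    have h1 : |x| ≤ |R| := (abs_le.2 ⟨hx.1.le, hx.2.le⟩).trans (le_abs_self R)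
    linarith [hy.2]
  have hC0 : ∀ x ∈ Ioo (-R) R, ‖((x : ℂ) + Complex.I) ^ 3‖ ≤ C := by
    intro x hx
    refine le_of_tendsto (tendsto_add_I_pow x).norm ?_
    filter_upwards [Ioo_mem_nhdsGT one_pos] with y hy using hC y hy x hx
  have h1 : Tendsto (fun y : ℝ => ENNReal.ofReal C * ∫⁻ x : ℝ, ‖g (x + y * Complex.I) - b x‖ₑ)
      (𝓝[>] 0) (𝓝 0) := by
    have h2 := (ENNReal.continuous_ofReal.tendsto 0).comp (hg.tendsto_integral_norm_sub_limit hb)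
    rw [ENNReal.ofReal_zero] at h2
    have h3 := ENNReal.Tendsto.const_mul (a := ENNReal.ofReal C) h2 (Or.inr ENNReal.ofReal_ne_top)
    rw [mul_zero] at h3
    refine h3.congr' ?_
    filter_upwards [self_mem_nhdsWithin] with y hy
    have hi := (hg.integrable_line hy).sub hbi
    simp only [Function.comp]
    congr 1
    have := integral_norm_eq_lintegral_enorm hi.1
    simp only [Pi.sub_apply] at this
    rw [this, ENNReal.ofReal_toReal]
    exact hi.2.ne
  have h2 : Tendsto (fun y : ℝ => ∫⁻ x in Ioo (-R) R,
      ‖((x + y * Complex.I + Complex.I) ^ 3 - (x + Complex.I) ^ 3) * b x‖ₑ) (𝓝[>] 0) (𝓝 0) := by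
    have h3 : Tendsto (fun y : ℝ => ∫⁻ x in Ioo (-R) R,
      ‖((x + y * Complex.I + Complex.I) ^ 3 - (x + Complex.I) ^ 3) * b x‖ₑ) (𝓝[>] 0)
      (𝓝 (∫⁻ x in Ioo (-R) R, 0)) := by
      refine tendsto_lintegral_filter_of_dominated_convergence'
        (fun x => ENNReal.ofReal (C + C) * ‖b x‖ₑ) ?_ ?_ ?_ ?_
      · refine Eventually.of_forall fun y => ?_
        refine (AEStronglyMeasurable.mul (Continuous.aestronglyMeasurable ?_) hbi.1.restrict).enorm
        fun_prop
      · filter_upwards [Ioo_mem_nhdsGT one_pos] with y hy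
        refine (ae_restrict_mem measurableSet_Ioo).mono fun x hx => ?_
        rw [enorm_mul]
        gcongr
        rw [← ofReal_norm]
        refine ENNReal.ofReal_le_ofReal ((norm_sub_le _ _).trans ?_)
        gcongr
        · exact hC y hy x hx
        · exact hC0 x hx
      · rw [lintegral_const_mul' _ _ ENNReal.ofReal_ne_top]
        exact (ENNReal.mul_lt_top ENNReal.ofReal_lt_top
          ((setLIntegral_le_lintegral _ _).trans_lt hbi.2)).ne
      · refine Eventually.of_forall fun x => ?_
        have h4 := ((tendsto_add_I_pow x).sub_const (((x : ℂ) + Complex.I) ^ 3)).mul_const (b x)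
        rw [sub_self, zero_mul] at h4
        have h5 := (continuous_enorm.tendsto _).comp h4
        rw [enorm_zero] at h5
        exact h5
    simpa using h3
  have h3 := h1.add h2
  rw [add_zero] at h3
  refine tendsto_of_tendsto_of_tendsto_of_le_of_le' tendsto_const_nhds h3
    (Eventually.of_forall fun _ => zero_le) ?_
  filter_upwards [Ioo_mem_nhdsGT one_pos] with y hy
  have hgm : AEMeasurable fun x : ℝ => ‖g (x + y * Complex.I) - b x‖ₑ :=
    ((hg.integrable_line hy.1).sub hbi).1.enorm
  refine le_trans ?_ (add_le_add (mul_le_mul_right (setLIntegral_le_lintegral (Ioo (-R) R) _) _)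
    le_rfl)
  rw [← lintegral_const_mul'' _ hgm.restrict, ← lintegral_add_left' (hgm.restrict.const_mul _)]
  refine setLIntegral_mono' measurableSet_Ioo fun x hx => ?_
  have hne : ((x : ℂ) + y * Complex.I + Complex.I) ^ 3 ≠ 0 :=
    pow_ne_zero 3 (add_I_ne_zero (by simpa using hy.1.le))
  -- In the first term the cube is bounded on `(-R, R)` and `g - b` tends to `0` in `L¹`; the second
  -- term tends to `0` by dominated convergence.
  have e : f (x + y * Complex.I) - boundaryValue f x =
      (x + y * Complex.I + Complex.I) ^ 3 * (g (x + y * Complex.I) - b x) +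
      ((x + y * Complex.I + Complex.I) ^ 3 - (x + Complex.I) ^ 3) * b x := by
    have e1 : (x + y * Complex.I + Complex.I) ^ 3 * g (x + y * Complex.I) = f (x + y * Complex.I) :=
      mul_div_cancel₀ _ hne
    have e2 : ((x : ℂ) + Complex.I) ^ 3 * b x = boundaryValue f x := mul_div_cancel₀ _ (hx0 x)
    rw [mul_sub, sub_mul, e1, e2]
    ring
  rw [e]
  refine (enorm_add_le _ _).trans ?_
  gcongr
  rw [enorm_mul]
  gcongr
  rw [← ofReal_norm]
  exact ENNReal.ofReal_le_ofReal (hC y hy x hx)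

/-! ### The upper bound for the Hausdorff operator. -/

/-- Hölder's inequality relative to the measure with density `w`, after the splitting `w = w^(1/r)
w^(1 - 1/r)`. -/
theorem lintegral_mul_le_rpow {α : Type*} [MeasurableSpace α] {μ : Measure α} {F w : α → ℝ≥0∞}
    (hF : AEMeasurable F μ) (hw : AEMeasurable w μ) {r : ℝ} (hr : 1 ≤ r) :
    ∫⁻ a, F a * w a ∂μ ≤
      (∫⁻ a, F a ^ r * w a ∂μ) ^ (1 / r) * (∫⁻ a, w a ∂μ) ^ (1 - 1 / r) := by
  have hr0 : 0 < r := by linarith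
  have h1 : 1 / r ≤ 1 := by rw [div_le_one hr0]; exact hr
  refine le_trans (le_of_eq ?_) (ENNReal.lintegral_mul_norm_pow_le (f := fun a => F a ^ r * w a)
    ((hF.pow_const r).mul hw) hw (by positivity) (by linarith) (add_sub_cancel _ _))
  refine lintegral_congr fun a => ?_
  rw [ENNReal.mul_rpow_of_nonneg _ _ (by positivity), ← ENNReal.rpow_mul, mul_one_div_cancel hr0.ne',
    ENNReal.rpow_one, mul_assoc, ← ENNReal.rpow_add_of_nonneg _ _ (by positivity) (by linarith),
    add_sub_cancel, ENNReal.rpow_one]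

/-- The density of the weight of a Hausdorff operator on `L^p`. -/
noncomputable def hausdorffDensity (p : ℝ≥0∞) (φ : ℝ → ℝ) (t : ℝ) : ℝ≥0∞ :=
  ENNReal.ofReal (t ^ (p⁻¹.toReal - 1) * φ t)

theorem hausdorffWeight_eq_lintegral (p : ℝ≥0∞) (φ : ℝ → ℝ) :
    hausdorffWeight p φ = ∫⁻ t in Ioi (0 : ℝ), hausdorffDensity p φ t := rfl

section Sufficiency

variable {p : ℝ≥0∞} {φ : ℝ → ℝ} {f : ℂ → ℂ}

theorem continuousOn_rpow_Ioi (s : ℝ) : ContinuousOn (fun t : ℝ => t ^ s) (Ioi 0) :=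
  fun t ht => (Real.continuousAt_rpow_const t s (Or.inl (ne_of_gt ht))).continuousWithinAt

theorem aestronglyMeasurable_rpow_mul (hφm : AEStronglyMeasurable φ (volume.restrict (Ioi 0)))
    (s : ℝ) : AEStronglyMeasurable (fun t : ℝ => t ^ s * φ t) (volume.restrict (Ioi 0)) :=
  ((continuousOn_rpow_Ioi s).aestronglyMeasurable measurableSet_Ioi).mul hφm

theorem aemeasurable_hausdorffDensity (hφm : AEStronglyMeasurable φ (volume.restrict (Ioi 0))) :
    AEMeasurable (hausdorffDensity p φ) (volume.restrict (Ioi 0)) :=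
  (aestronglyMeasurable_rpow_mul hφm _).aemeasurable.ennreal_ofReal

theorem aestronglyMeasurable_div (hφm : AEStronglyMeasurable φ (volume.restrict (Ioi 0))) :
    AEStronglyMeasurable (fun t : ℝ => ((φ t / t : ℝ) : ℂ)) (volume.restrict (Ioi 0)) := by
  refine Complex.continuous_ofReal.comp_aestronglyMeasurable ?_
  refine (aestronglyMeasurable_rpow_mul hφm (-1)).congr ?_
  refine (ae_restrict_mem measurableSet_Ioi).mono fun t ht => ?_
  simp only
  rw [Real.rpow_neg_one, inv_mul_eq_div]

theorem integrable_weight (hφm : AEStronglyMeasurable φ (volume.restrict (Ioi 0)))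
    (hφ0 : ∀ᵐ t ∂(volume.restrict (Ioi (0 : ℝ))), 0 ≤ φ t) (hW : hausdorffWeight p φ < ∞) :
    Integrable (fun t : ℝ => t ^ (p⁻¹.toReal - 1) * φ t) (volume.restrict (Ioi 0)) := by
  refine ⟨aestronglyMeasurable_rpow_mul hφm _, ?_⟩
  rw [hasFiniteIntegral_iff_ofReal]
  · exact hW
  · filter_upwards [hφ0, ae_restrict_mem measurableSet_Ioi] with t ht h0
    exact mul_nonneg (Real.rpow_nonneg (le_of_lt h0) _) ht

theorem im_div_ofReal (z : ℂ) (t : ℝ) : (z / t).im = z.im / t := by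
  simp

theorem line_div (x y t : ℝ) : ((x + y * Complex.I) / t : ℂ) =
    ((t⁻¹ * x : ℝ) : ℂ) + (y / t : ℝ) * Complex.I := by
  push_cast
  ring

theorem aestronglyMeasurable_hausdorffIntegrand
    (hφm : AEStronglyMeasurable φ (volume.restrict (Ioi 0)))
    (hf : ContinuousOn f {z : ℂ | 0 < z.im}) {z : ℂ} (hz : 0 < z.im) :
    AEStronglyMeasurable (hausdorffIntegrand φ f z) (volume.restrict (Ioi 0)) := by
  refine AEStronglyMeasurable.mul ?_ (aestronglyMeasurable_div hφm)
  refine ContinuousOn.aestronglyMeasurable ?_ measurableSet_Ioi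
  refine hf.comp ?_ fun t ht => ?_
  · refine continuousOn_const.div (by fun_prop) fun t ht => ?_
    exact Complex.ofReal_ne_zero.2 (ne_of_gt ht)
  · rw [mem_ofPred_eq, im_div_ofReal]
    exact div_pos hz ht

/-- The growth bound at `z / t` contributes `(y / t)^(-1/p)`, which together with `1 / t` produces
exactly the weight. Uniformity in `Im z ≥ y` makes this the local majorant for holomorphy. -/
theorem norm_hausdorffIntegrand_le (hp : 1 ≤ p) (hf : MemHardy p f) {z : ℂ} {y : ℝ} (hy : 0 < y)
    (hz : y ≤ z.im) {t : ℝ} (ht : 0 < t) (hφt : 0 ≤ φ t) :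
    ‖hausdorffIntegrand φ f z t‖ ≤
      2 * (hardyNorm p f).toReal * y ^ (-p⁻¹.toReal) * (t ^ (p⁻¹.toReal - 1) * φ t) := by
  have h1 := hf.norm_le hp (z := z / t) (by rw [im_div_ofReal]; exact div_pos (hy.trans_le hz) ht)
  rw [im_div_ofReal] at h1
  have h2 : (z.im / t) ^ (-p⁻¹.toReal) ≤ (y / t) ^ (-p⁻¹.toReal) := by
    refine Real.rpow_le_rpow_of_nonpos (by positivity) (by gcongr) ?_
    simp
  have h3 : (y / t) ^ (-p⁻¹.toReal) * t⁻¹ = y ^ (-p⁻¹.toReal) * t ^ (p⁻¹.toReal - 1) := by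
    rw [Real.div_rpow hy.le ht.le, Real.rpow_neg ht.le, div_inv_eq_mul, mul_assoc,
      Real.rpow_sub_one ht.ne', div_eq_mul_inv]
  rw [hausdorffIntegrand, norm_mul, Complex.norm_real, Real.norm_of_nonneg (by positivity)]
  calc ‖f (z / t)‖ * (φ t / t)
      ≤ 2 * (hardyNorm p f).toReal * (y / t) ^ (-p⁻¹.toReal) * (φ t / t) := by
        gcongr
        exact h1.trans (by gcongr)
    _ = 2 * (hardyNorm p f).toReal * ((y / t) ^ (-p⁻¹.toReal) * t⁻¹) * φ t := by ring
    _ = _ := by rw [h3]; ring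

theorem integrableOn_hausdorffIntegrand (hp : 1 ≤ p)
    (hφm : AEStronglyMeasurable φ (volume.restrict (Ioi 0)))
    (hφ0 : ∀ᵐ t ∂(volume.restrict (Ioi (0 : ℝ))), 0 ≤ φ t) (hW : hausdorffWeight p φ < ∞)
    (hf : MemHardy p f) {z : ℂ} (hz : 0 < z.im) :
    IntegrableOn (hausdorffIntegrand φ f z) (Ioi 0) := by
  refine ((integrable_weight hφm hφ0 hW).const_mul
    (2 * (hardyNorm p f).toReal * z.im ^ (-p⁻¹.toReal))).mono'
    (aestronglyMeasurable_hausdorffIntegrand hφm hf.1.continuousOn hz) ?_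
  filter_upwards [hφ0, ae_restrict_mem measurableSet_Ioi] with t ht h0
  exact norm_hausdorffIntegrand_le hp hf hz le_rfl h0 ht

theorem differentiableOn_complexHausdorff (hp : 1 ≤ p)
    (hφm : AEStronglyMeasurable φ (volume.restrict (Ioi 0)))
    (hφ0 : ∀ᵐ t ∂(volume.restrict (Ioi (0 : ℝ))), 0 ≤ φ t) (hW : hausdorffWeight p φ < ∞)
    (hf : MemHardy p f) : DifferentiableOn ℂ (complexHausdorff φ f) {z | 0 < z.im} := by
  intro z₀ hz
  have hz0 : 0 < z₀.im := hz
  have him : ∀ z ∈ Metric.ball z₀ (z₀.im / 2), z₀.im / 2 ≤ z.im := by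
    intro z hz
    rw [mem_ball_iff_norm] at hz
    have h2 := (Complex.abs_im_le_norm _).trans_lt hz
    rw [Complex.sub_im, abs_lt] at h2
    linarith
  refine ((hasDerivAt_integral_of_holomorphic (half_pos hz0) (F := hausdorffIntegrand φ f)
    (μ := volume.restrict (Ioi 0)) (fun z hz => ?_) ?_ ?_
    ((integrable_weight hφm hφ0 hW).const_mul (2 * (hardyNorm p f).toReal *
      (z₀.im / 2) ^ (-p⁻¹.toReal)))).2).differentiableAt.differentiableWithinAt
  · exact aestronglyMeasurable_hausdorffIntegrand hφm hf.1.continuousOn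
      ((half_pos hz0).trans_le (him z hz))
  · refine (ae_restrict_mem measurableSet_Ioi).mono fun t ht => ?_
    have ht0 : (0 : ℝ) < t := ht
    refine DifferentiableOn.mul_const ?_ _
    refine hf.1.comp (by fun_prop) fun z hz => ?_
    show 0 < (z / t).im
    rw [im_div_ofReal]
    exact div_pos ((half_pos hz0).trans_le (him z hz)) ht0
  · filter_upwards [hφ0, ae_restrict_mem measurableSet_Ioi] with t ht h0 z hz
    exact norm_hausdorffIntegrand_le hp hf (half_pos hz0) (him z hz) h0 ht

/-- Separates the norm-preserving dilation `t^(-1/p) f(z/t)` from the density against which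
dilations are averaged. -/
theorem enorm_hausdorffIntegrand (z : ℂ) {t : ℝ} (ht : 0 < t) (hφt : 0 ≤ φ t) :
    ‖hausdorffIntegrand φ f z t‖ₑ =
      ‖f (z / t)‖ₑ * ENNReal.ofReal (t ^ (-p⁻¹.toReal)) * hausdorffDensity p φ t := by
  rw [hausdorffIntegrand, enorm_mul, hausdorffDensity, mul_assoc,
    ← ENNReal.ofReal_mul (by positivity), ← mul_assoc, ← Real.rpow_add ht, ← ofReal_norm,
    ← ofReal_norm, Complex.norm_real, Real.norm_of_nonneg (by positivity)]
  congr 2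
  have : -p⁻¹.toReal + (p⁻¹.toReal - 1) = -1 := by ring
  rw [this, Real.rpow_neg_one]
  ring

theorem enorm_complexHausdorff_le (hφ0 : ∀ᵐ t ∂(volume.restrict (Ioi (0 : ℝ))), 0 ≤ φ t) (z : ℂ) :
    ‖complexHausdorff φ f z‖ₑ ≤ ∫⁻ t in Ioi (0 : ℝ),
      ‖f (z / t)‖ₑ * ENNReal.ofReal (t ^ (-p⁻¹.toReal)) * hausdorffDensity p φ t := by
  refine (enorm_integral_le_lintegral_enorm _).trans (le_of_eq (lintegral_congr_ae ?_))
  filter_upwards [hφ0, ae_restrict_mem measurableSet_Ioi] with t ht h0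
  exact enorm_hausdorffIntegrand z h0 ht

theorem continuousOn_plane_div (hf : ContinuousOn f {z : ℂ | 0 < z.im}) {y : ℝ} (hy : 0 < y) :
    ContinuousOn (fun q : ℝ × ℝ => f ((q.1 + y * Complex.I) / q.2)) (univ ×ˢ Ioi 0) := by
  refine hf.comp ?_ fun q hq => ?_
  · refine ContinuousOn.div (by fun_prop) (by fun_prop) fun q hq => ?_
    exact Complex.ofReal_ne_zero.2 (ne_of_gt hq.2)
  · rw [mem_ofPred_eq, im_div_ofReal]
    exact div_pos (by simpa using hy) hq.2

theorem prod_restrict_Ioi : (volume : Measure ℝ).prod (volume.restrict (Ioi (0 : ℝ))) =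
    (volume : Measure (ℝ × ℝ)).restrict (univ ×ˢ Ioi 0) := by
  rw [Measure.volume_eq_prod, ← Measure.prod_restrict, Measure.restrict_univ]

theorem aestronglyMeasurable_plane_div (hf : ContinuousOn f {z : ℂ | 0 < z.im}) {y : ℝ}
    (hy : 0 < y) : AEStronglyMeasurable (fun q : ℝ × ℝ => f ((q.1 + y * Complex.I) / q.2))
      ((volume : Measure ℝ).prod (volume.restrict (Ioi (0 : ℝ)))) := by
  rw [prod_restrict_Ioi]
  exact (continuousOn_plane_div hf hy).aestronglyMeasurable (MeasurableSet.univ.prod measurableSet_Ioi)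

/-- Minkowski's integral inequality: Hölder against the density, Tonelli, then the substitution `x ↦
x / t`, whose Jacobian `t` cancels `(t^(-1/p))^p`. -/
theorem lintegral_line_complexHausdorff_le (hp : 1 ≤ p) (hp' : p ≠ ∞)
    (hφm : AEStronglyMeasurable φ (volume.restrict (Ioi 0)))
    (hφ0 : ∀ᵐ t ∂(volume.restrict (Ioi (0 : ℝ))), 0 ≤ φ t)
    (hf : MemHardy p f) {y : ℝ} (hy : 0 < y) :
    ∫⁻ x : ℝ, ‖complexHausdorff φ f (x + y * Complex.I)‖ₑ ^ p.toReal ≤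
      (hausdorffWeight p φ * hardyNorm p f) ^ p.toReal := by
  set r := p.toReal with hr
  set W := hausdorffWeight p φ
  set N := hardyNorm p f
  set w := hausdorffDensity p φ
  have hr1 : 1 ≤ r := by simpa using ENNReal.toReal_mono hp' hp
  have hr0 : 0 < r := by linarith
  have hq : p⁻¹.toReal = 1 / r := toReal_inv_eq_one_div p
  have hwm : AEMeasurable w (volume.restrict (Ioi 0)) := aemeasurable_hausdorffDensity hφm
  have hpt : ∀ x : ℝ, ‖complexHausdorff φ f (x + y * Complex.I)‖ₑ ^ r ≤
      (∫⁻ t in Ioi (0 : ℝ), (‖f ((x + y * Complex.I) / t)‖ₑ * ENNReal.ofReal (t ^ (-p⁻¹.toReal))) ^ r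
        * w t) * W ^ (r - 1) := by
    intro x
    have hFm : AEMeasurable (fun t : ℝ => ‖f ((x + y * Complex.I) / t)‖ₑ *
        ENNReal.ofReal (t ^ (-p⁻¹.toReal))) (volume.restrict (Ioi 0)) := by
      refine AEMeasurable.mul (AEStronglyMeasurable.enorm ?_) ?_
      · refine ContinuousOn.aestronglyMeasurable ?_ measurableSet_Ioi
        exact (continuousOn_plane_div hf.1.continuousOn hy).comp
          (by fun_prop : Continuous fun t : ℝ => (x, t)).continuousOn fun t ht => ⟨mem_univ _, ht⟩
      · exact ((continuousOn_rpow_Ioi _).aemeasurable measurableSet_Ioi).ennreal_ofReal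
    have h1 := (enorm_complexHausdorff_le (p := p) (f := f) hφ0 (x + y * Complex.I)).trans
      (lintegral_mul_le_rpow hFm hwm hr1)
    refine (ENNReal.rpow_le_rpow h1 hr0.le).trans (le_of_eq ?_)
    rw [ENNReal.mul_rpow_of_nonneg _ _ hr0.le, ← ENNReal.rpow_mul, ← ENNReal.rpow_mul,
      one_div_mul_cancel hr0.ne', ENNReal.rpow_one, sub_mul, one_div_mul_cancel hr0.ne', one_mul]
    rfl
  have hjoint : AEMeasurable (Function.uncurry fun (x t : ℝ) => (‖f ((x + y * Complex.I) / t)‖ₑ *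
      ENNReal.ofReal (t ^ (-p⁻¹.toReal))) ^ r * w t)
      ((volume : Measure ℝ).prod (volume.restrict (Ioi (0 : ℝ)))) := by
    have h1 := (aestronglyMeasurable_plane_div hf.1.continuousOn hy).enorm.mul
      (((continuousOn_rpow_Ioi (-p⁻¹.toReal)).aemeasurable
        measurableSet_Ioi).ennreal_ofReal.comp_snd (μ := (volume : Measure ℝ)))
    exact (h1.pow_const r).mul hwm.comp_snd
  have hinner : ∀ t ∈ Ioi (0 : ℝ), ∫⁻ x : ℝ, (‖f ((x + y * Complex.I) / t)‖ₑ *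
      ENNReal.ofReal (t ^ (-p⁻¹.toReal))) ^ r * w t ≤ N ^ r * w t := by
    intro t ht
    have ht0 : (0 : ℝ) < t := ht
    have h1 : ∀ x : ℝ, (‖f ((x + y * Complex.I) / t)‖ₑ *
        ENNReal.ofReal (t ^ (-p⁻¹.toReal))) ^ r * w t =
        ‖f (((t⁻¹ * x : ℝ) : ℂ) + (y / t : ℝ) * Complex.I)‖ₑ ^ r * (ENNReal.ofReal t⁻¹ * w t) := by
      intro x
      rw [line_div, ENNReal.mul_rpow_of_nonneg _ _ hr0.le, mul_assoc,
        ENNReal.ofReal_rpow_of_nonneg (by positivity) hr0.le, ← Real.rpow_mul ht0.le, hq,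
        neg_mul, one_div_mul_cancel hr0.ne', Real.rpow_neg_one]
    simp_rw [h1]
    have hyt : 0 < y / t := div_pos hy ht0
    have hmeas : Measurable fun x : ℝ => ‖f (x + (y / t : ℝ) * Complex.I)‖ₑ ^ r :=
      ((continuous_horizontal_line hf.1.continuousOn hyt).enorm.measurable).pow_const r
    have hmeas' : Measurable fun x : ℝ =>
        ‖f (((t⁻¹ * x : ℝ) : ℂ) + (y / t : ℝ) * Complex.I)‖ₑ ^ r :=
      hmeas.comp (by fun_prop : Measurable fun x : ℝ => t⁻¹ * x)
    rw [lintegral_mul_const _ hmeas',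
      lintegral_comp_mul_left (fun x : ℝ => ‖f (x + (y / t : ℝ) * Complex.I)‖ₑ ^ r)
      (inv_ne_zero ht0.ne'), inv_inv, abs_of_pos ht0, mul_comm (ENNReal.ofReal t), mul_assoc,
      ← mul_assoc (ENNReal.ofReal t), ← ENNReal.ofReal_mul ht0.le, mul_inv_cancel₀ ht0.ne',
      ENNReal.ofReal_one, one_mul]
    gcongr
    exact MemHardy.lintegral_line_rpow_le hp hp' f hyt
  -- The identity `W · W^(r-1) = W^r` used below requires `W` to be neither `0` nor `∞`. For `W = ∞`
  -- and `N = 0` the right side is `0`, and `f` vanishes by the growth bound.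
  by_cases hW0 : W = 0
  · have : ∀ x : ℝ, ‖complexHausdorff φ f (x + y * Complex.I)‖ₑ ^ r ≤ 0 := by
      intro x
      have h0 : w =ᵐ[volume.restrict (Ioi 0)] 0 := (lintegral_eq_zero_iff' hwm).1 hW0
      have h1 := enorm_complexHausdorff_le (p := p) (f := f) hφ0 (x + y * Complex.I)
      rw [lintegral_congr_ae (g := 0) (h0.mono fun t ht => by
        change _ * w t = 0
        rw [ht]; simp)] at h1
      simp only [Pi.zero_apply, lintegral_zero, nonpos_iff_eq_zero] at h1
      rw [h1, ENNReal.zero_rpow_of_pos hr0]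
    exact (lintegral_mono this).trans (by simp)
  by_cases hWt : W = ∞
  · by_cases hN0 : N = 0
    · have hN : ∀ z : ℂ, 0 < z.im → f z = 0 := by
        intro z hz
        have := hf.norm_le hp hz
        rw [show hardyNorm p f = 0 from hN0] at this
        simpa using this
      have : ∀ x : ℝ, complexHausdorff φ f (x + y * Complex.I) = 0 := by
        intro x
        refine setIntegral_eq_zero_of_forall_eq_zero fun t ht => ?_
        rw [hausdorffIntegrand, hN, zero_mul]
        rw [im_div_ofReal]
        exact div_pos (by simpa using hy) ht
      simp [this, hr0]
    · rw [hWt, ENNReal.top_mul hN0, ENNReal.top_rpow_of_pos hr0]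
      exact le_top
  calc ∫⁻ x : ℝ, ‖complexHausdorff φ f (x + y * Complex.I)‖ₑ ^ r
      ≤ ∫⁻ x : ℝ, (∫⁻ t in Ioi (0 : ℝ), (‖f ((x + y * Complex.I) / t)‖ₑ *
          ENNReal.ofReal (t ^ (-p⁻¹.toReal))) ^ r * w t) * W ^ (r - 1) := lintegral_mono hpt
    _ = (∫⁻ t in Ioi (0 : ℝ), ∫⁻ x : ℝ, (‖f ((x + y * Complex.I) / t)‖ₑ *
          ENNReal.ofReal (t ^ (-p⁻¹.toReal))) ^ r * w t) * W ^ (r - 1) := by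
        rw [lintegral_mul_const' _ _ (by finiteness), lintegral_lintegral_swap hjoint]
    _ ≤ (∫⁻ t in Ioi (0 : ℝ), N ^ r * w t) * W ^ (r - 1) := by
        gcongr ?_ * _
        exact setLIntegral_mono' measurableSet_Ioi hinner
    _ = N ^ r * W ^ r := by
        have h1 : ∫⁻ t in Ioi (0 : ℝ), w t = W := rfl
        rw [lintegral_const_mul'' _ hwm, h1, mul_assoc]
        congr 1
        conv_lhs => enter [1]; rw [← ENNReal.rpow_one W]
        rw [← ENNReal.rpow_add _ _ hW0 hWt]
        congr 1
        ring
    _ = _ := by rw [ENNReal.mul_rpow_of_nonneg _ _ hr0.le, mul_comm]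

theorem hardyNorm_complexHausdorff_le (hp : 1 ≤ p)
    (hφm : AEStronglyMeasurable φ (volume.restrict (Ioi 0)))
    (hφ0 : ∀ᵐ t ∂(volume.restrict (Ioi (0 : ℝ))), 0 ≤ φ t)
    (hf : MemHardy p f) :
    hardyNorm p (complexHausdorff φ f) ≤ hausdorffWeight p φ * hardyNorm p f := by
  by_cases hp' : p = ∞
  · conv_lhs => rw [hardyNorm, if_pos hp']
    refine iSup₂_le fun z hz => ?_
    refine (enorm_complexHausdorff_le (p := p) hφ0 z).trans ?_
    rw [mul_comm, hausdorffWeight_eq_lintegral, ← lintegral_const_mul'' _ (aemeasurable_hausdorffDensity hφm)]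
    refine setLIntegral_mono' measurableSet_Ioi fun t ht => ?_
    have h1 : ENNReal.ofReal (t ^ (-p⁻¹.toReal)) = 1 := by simp [hp']
    rw [h1, mul_one]
    refine mul_le_mul' ?_ le_rfl
    rw [hardyNorm, if_pos hp']
    refine le_iSup₂ (f := fun z (_ : z ∈ upperHalfPlaneSet) => ‖f z‖ₑ) (z / t) ?_
    show 0 < (z / t).im
    rw [im_div_ofReal]
    exact div_pos hz ht
  · conv_lhs => rw [hardyNorm, if_neg hp']
    refine iSup₂_le fun y hy => ?_
    have hpos : 0 < p.toReal := ENNReal.toReal_pos (by positivity) hp'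
    rw [one_div, ENNReal.rpow_inv_le_iff hpos]
    exact lintegral_line_complexHausdorff_le hp hp' hφm hφ0 hf hy

theorem memHardy_complexHausdorff (hp : 1 ≤ p)
    (hφm : AEStronglyMeasurable φ (volume.restrict (Ioi 0)))
    (hφ0 : ∀ᵐ t ∂(volume.restrict (Ioi (0 : ℝ))), 0 ≤ φ t) (hW : hausdorffWeight p φ < ∞)
    (hf : MemHardy p f) : MemHardy p (complexHausdorff φ f) :=
  ⟨differentiableOn_complexHausdorff hp hφm hφ0 hW hf,
    (hardyNorm_complexHausdorff_le hp hφm hφ0 hf).trans_lt (ENNReal.mul_lt_top hW hf.2)⟩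

theorem isHardyBound_hausdorffWeight (hp : 1 ≤ p)
    (hφm : AEStronglyMeasurable φ (volume.restrict (Ioi 0)))
    (hφ0 : ∀ᵐ t ∂(volume.restrict (Ioi (0 : ℝ))), 0 ≤ φ t) (hW : hausdorffWeight p φ < ∞) :
    IsHardyBound p (complexHausdorff φ) (hausdorffWeight p φ).toNNReal := by
  intro f hf
  rw [ENNReal.coe_toNNReal hW.ne]
  exact hardyNorm_complexHausdorff_le hp hφm hφ0 hf

end Sufficiency

/-! ### Boundary values of the Hausdorff operator. -/

/-- A property valid almost everywhere holds at `x / t` for almost all `x` and `t`. -/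
theorem ae_ae_div {P : ℝ → Prop} (h : ∀ᵐ x, P x) :
    ∀ᵐ x : ℝ, ∀ᵐ t ∂(volume.restrict (Ioi (0 : ℝ))), P (x / t) := by
  set N := toMeasurable volume {x | ¬ P x}
  have hN : volume N = 0 := by rw [measure_toMeasurable]; exact h
  have hNm : MeasurableSet N := measurableSet_toMeasurable _ _
  have h1 : ∀ᵐ t ∂(volume.restrict (Ioi (0 : ℝ))), ∀ᵐ x : ℝ, x / t ∉ N := by
    refine (ae_restrict_mem measurableSet_Ioi).mono fun t ht => ?_
    have ht0 : (0 : ℝ) < t := ht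
    have h2 : ∀ᵐ x : ℝ, x ∉ N := measure_eq_zero_iff_ae_notMem.1 hN
    filter_upwards [(quasiMeasurePreserving_affine 0 (inv_ne_zero ht0.ne')).ae h2] with x hx
    rwa [zero_add, inv_mul_eq_div] at hx
  have hm : MeasurableSet {q : ℝ × ℝ | q.2 / q.1 ∉ N} :=
    (hNm.preimage (by fun_prop : Measurable fun q : ℝ × ℝ => q.2 / q.1)).compl
  rw [Measure.ae_ae_comm hm] at h1
  filter_upwards [h1] with x hx
  filter_upwards [hx] with t ht
  by_contra hP
  exact ht (subset_toMeasurable _ _ hP)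

theorem lintegral_Ioo_comp_div (h : ℝ → ℝ≥0∞) (R : ℝ) {t : ℝ} (ht : 0 < t) :
    ∫⁻ x in Ioo (-R) R, h (x / t) = ENNReal.ofReal t * ∫⁻ x in Ioo (-(R / t)) (R / t), h x := by
  rw [← lintegral_indicator measurableSet_Ioo, ← lintegral_indicator measurableSet_Ioo]
  have h1 := lintegral_comp_mul_left ((Ioo (-(R / t)) (R / t)).indicator h) (inv_ne_zero ht.ne')
  rw [inv_inv, abs_of_pos ht] at h1
  rw [← h1]
  refine lintegral_congr fun x => ?_
  have hiff : x ∈ Ioo (-R) R ↔ t⁻¹ * x ∈ Ioo (-(R / t)) (R / t) := by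
    rw [inv_mul_eq_div, ← neg_div, mem_Ioo, mem_Ioo, div_lt_div_iff_of_pos_right ht,
      div_lt_div_iff_of_pos_right ht]
  by_cases hx : x ∈ Ioo (-R) R
  · rw [indicator_of_mem hx, indicator_of_mem (hiff.1 hx), inv_mul_eq_div]
  · rw [indicator_of_notMem hx, indicator_of_notMem (mt hiff.2 hx)]

/-- Rescaling and Hölder on an interval of length `2R / t` give `t (2R / t)^(1 - 1/p) = (2R)^(1 -
1/p) t^(1/p)`; against `φ(t) / t` the power of `t` becomes the density. -/
theorem lintegral_Ioo_enorm_comp_div_le {p : ℝ≥0∞} (hp : 1 ≤ p) {h : ℝ → ℂ}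
    (hh : AEStronglyMeasurable h) {R : ℝ} (hR : 0 ≤ R) {t : ℝ} (ht : 0 < t) :
    ∫⁻ x in Ioo (-R) R, ‖h (x / t)‖ₑ ≤ eLpNorm h p volume *
      ENNReal.ofReal ((2 * R) ^ (1 - p⁻¹.toReal)) * ENNReal.ofReal (t ^ p⁻¹.toReal) := by
  have hq := toReal_inv_le_one hp
  rw [lintegral_Ioo_comp_div (fun x => ‖h x‖ₑ) R ht]
  refine (mul_le_mul_right (lintegral_Ioo_enorm_le hp hh _ _) _).trans (le_of_eq ?_)
  have e : R / t - -(R / t) = 2 * R / t := by ring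
  rw [e, ENNReal.ofReal_rpow_of_nonneg (by positivity) (by linarith), mul_left_comm, mul_assoc,
    ← ENNReal.ofReal_mul ht.le, ← ENNReal.ofReal_mul (by positivity)]
  congr 2
  rw [Real.div_rpow (by positivity) ht.le, Real.rpow_sub ht, Real.rpow_one]
  field_simp

section Boundary

variable {p : ℝ≥0∞} {φ : ℝ → ℝ} {f : ℂ → ℂ}

theorem enorm_div_eq {t : ℝ} (ht : 0 < t) (hφt : 0 ≤ φ t) :
    ENNReal.ofReal (t ^ p⁻¹.toReal) * ‖((φ t / t : ℝ) : ℂ)‖ₑ = hausdorffDensity p φ t := by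
  rw [← ofReal_norm, Complex.norm_real, Real.norm_of_nonneg (by positivity),
    ← ENNReal.ofReal_mul (by positivity), hausdorffDensity, Real.rpow_sub_one ht.ne']
  congr 1
  ring

theorem measurable_comp_div {b : ℝ → ℂ} (hb : Measurable b) :
    Measurable fun q : ℝ × ℝ => b (q.1 / q.2) :=
  hb.comp (by fun_prop)

theorem aestronglyMeasurable_realHausdorff_joint
    (hφm : AEStronglyMeasurable φ (volume.restrict (Ioi 0))) {b : ℝ → ℂ} (hb : Measurable b) :
    AEStronglyMeasurable (fun q : ℝ × ℝ => realHausdorffIntegrand φ b q.1 q.2)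
      ((volume : Measure ℝ).prod (volume.restrict (Ioi (0 : ℝ)))) :=
  (measurable_comp_div hb).aestronglyMeasurable.mul (aestronglyMeasurable_div hφm).comp_snd

theorem ae_restrict_of_forall_Ioo {P : ℝ → Prop}
    (h : ∀ R : ℝ, 0 ≤ R → ∀ᵐ x ∂(volume.restrict (Ioo (-R) R)), P x) : ∀ᵐ x : ℝ, P x := by
  have h1 : ∀ n : ℕ, ∀ᵐ x : ℝ, x ∈ Ioo (-(n : ℝ)) n → P x := fun n =>
    (ae_restrict_iff' measurableSet_Ioo).1 (h n n.cast_nonneg)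
  filter_upwards [ae_all_iff.2 h1] with x hx
  obtain ⟨n, hn⟩ := exists_nat_gt |x|
  exact hx n (abs_lt.1 hn)

/-- Tonelli on `(-R, R) × (0, ∞)`: the double integral is at most a constant depending on `R` times
the weight. Measurability of `b` is what makes `b (x / t)` jointly measurable. -/
theorem ae_integrableOn_realHausdorffIntegrand_of_measurable (hp : 1 ≤ p)
    (hφm : AEStronglyMeasurable φ (volume.restrict (Ioi 0)))
    (hφ0 : ∀ᵐ t ∂(volume.restrict (Ioi (0 : ℝ))), 0 ≤ φ t) (hW : hausdorffWeight p φ < ∞)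
    {b : ℝ → ℂ} (hbm : Measurable b) (hb : eLpNorm b p volume < ∞) :
    ∀ᵐ x : ℝ, IntegrableOn (realHausdorffIntegrand φ b x) (Ioi 0) := by
  have hjoint := aestronglyMeasurable_realHausdorff_joint hφm hbm
  refine ae_restrict_of_forall_Ioo fun R hR => ?_
  have hjR : AEStronglyMeasurable (fun q : ℝ × ℝ => realHausdorffIntegrand φ b q.1 q.2)
      ((volume.restrict (Ioo (-R) R)).prod (volume.restrict (Ioi (0 : ℝ)))) :=
    hjoint.mono_measure (Measure.prod_mono Measure.restrict_le_self le_rfl)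
  have hfin : ∫⁻ x in Ioo (-R) R, ∫⁻ t in Ioi (0 : ℝ), ‖realHausdorffIntegrand φ b x t‖ₑ < ∞ := by
    rw [lintegral_lintegral_swap hjR.enorm]
    refine lt_of_le_of_lt (b := ∫⁻ t in Ioi (0 : ℝ), eLpNorm b p volume *
      ENNReal.ofReal ((2 * R) ^ (1 - p⁻¹.toReal)) * hausdorffDensity p φ t) ?_ ?_
    · refine lintegral_mono_ae ?_
      filter_upwards [hφ0, ae_restrict_mem measurableSet_Ioi] with t ht h0
      simp_rw [realHausdorffIntegrand, enorm_mul]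
      rw [lintegral_mul_const' _ _ (by finiteness), ← enorm_div_eq h0 ht, ← mul_assoc]
      gcongr
      exact lintegral_Ioo_enorm_comp_div_le hp hbm.aestronglyMeasurable hR h0
    · rw [lintegral_const_mul'' _ (aemeasurable_hausdorffDensity hφm)]
      exact ENNReal.mul_lt_top (ENNReal.mul_lt_top hb ENNReal.ofReal_lt_top) hW
  have hfin' := ae_lt_top' (hjR.enorm.lintegral_prod_right') hfin.ne
  filter_upwards [hfin', hjR.prodMk_left] with x hx hxm using ⟨hxm, hx⟩

theorem realHausdorff_congr_ae {b b' : ℝ → ℂ} (h : b =ᵐ[volume] b') :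
    ∀ᵐ x : ℝ, realHausdorffIntegrand φ b x =ᵐ[volume.restrict (Ioi 0)]
      realHausdorffIntegrand φ b' x := by
  filter_upwards [ae_ae_div h] with x hx
  filter_upwards [hx] with t ht
  rw [realHausdorffIntegrand, realHausdorffIntegrand, ht]

theorem tendsto_lintegral_dilate_sub (hp : 1 ≤ p) (hf : MemHardy p f) {b : ℝ → ℂ}
    (hb : boundaryValue f =ᵐ[volume] b) (R : ℝ) {t : ℝ} (ht : 0 < t) :
    Tendsto (fun y : ℝ => ∫⁻ x in Ioo (-R) R, ‖f ((x + y * Complex.I) / t) - b (x / t)‖ₑ)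
      (𝓝[>] 0) (𝓝 0) := by
  have h1 : Tendsto (fun y : ℝ => y / t) (𝓝[>] 0) (𝓝[>] 0) := by
    refine tendsto_nhdsWithin_iff.2 ⟨?_, ?_⟩
    · exact Tendsto.mono_left (Continuous.tendsto' (by fun_prop) _ _ (by simp)) nhdsWithin_le_nhds
    · filter_upwards [self_mem_nhdsWithin] with y hy using div_pos hy ht
  have h2 := ENNReal.Tendsto.const_mul (a := ENNReal.ofReal t)
    ((hf.tendsto_lintegral_boundaryValue hp (R / t)).comp h1) (Or.inr ENNReal.ofReal_ne_top)
  rw [mul_zero] at h2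
  refine h2.congr fun y => ?_
  simp only [Function.comp]
  have h3 : ∀ x : ℝ, ‖f ((x + y * Complex.I) / t) - b (x / t)‖ₑ =
      (fun x : ℝ => ‖f (x + (y / t : ℝ) * Complex.I) - b x‖ₑ) (x / t) := by
    intro x
    simp only
    rw [line_div, inv_mul_eq_div]
  simp_rw [h3]
  rw [lintegral_Ioo_comp_div (fun x : ℝ => ‖f (x + (y / t : ℝ) * Complex.I) - b x‖ₑ) R ht]
  congr 1
  refine lintegral_congr_ae (ae_restrict_of_ae ?_)
  filter_upwards [hb] with x hx
  rw [hx]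

theorem lintegral_dilate_sub_le (hp : 1 ≤ p) (hf : MemHardy p f) {b : ℝ → ℂ}
    (hbm : Measurable b) (hb : eLpNorm b p volume ≤ hardyNorm p f) {R : ℝ} (hR : 0 ≤ R)
    {y t : ℝ} (hy : 0 < y) (ht : 0 < t) :
    ∫⁻ x in Ioo (-R) R, ‖f ((x + y * Complex.I) / t) - b (x / t)‖ₑ ≤
      2 * hardyNorm p f * ENNReal.ofReal ((2 * R) ^ (1 - p⁻¹.toReal)) *
        ENNReal.ofReal (t ^ p⁻¹.toReal) := by
  have hyt : 0 < y / t := div_pos hy ht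
  have hfc := continuous_horizontal_line hf.1.continuousOn hyt
  have h3 : ∀ x : ℝ, ‖f ((x + y * Complex.I) / t) - b (x / t)‖ₑ ≤
      (fun x : ℝ => ‖f (x + (y / t : ℝ) * Complex.I)‖ₑ) (x / t) + ‖b (x / t)‖ₑ := by
    intro x
    simp only
    rw [line_div, inv_mul_eq_div]
    exact enorm_sub_le
  refine (lintegral_mono h3).trans ?_
  have hm : Measurable fun x : ℝ => ‖b (x / t)‖ₑ :=
    (hbm.comp (by fun_prop : Measurable fun x : ℝ => x / t)).enorm
  rw [lintegral_add_right _ hm]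
  have e : 2 * hardyNorm p f * ENNReal.ofReal ((2 * R) ^ (1 - p⁻¹.toReal)) *
        ENNReal.ofReal (t ^ p⁻¹.toReal) =
      hardyNorm p f * ENNReal.ofReal ((2 * R) ^ (1 - p⁻¹.toReal)) *
        ENNReal.ofReal (t ^ p⁻¹.toReal) + hardyNorm p f *
          ENNReal.ofReal ((2 * R) ^ (1 - p⁻¹.toReal)) * ENNReal.ofReal (t ^ p⁻¹.toReal) := by ring
  rw [e]
  refine add_le_add ?_ ?_
  · refine (lintegral_Ioo_enorm_comp_div_le hp hfc.aestronglyMeasurable hR ht).trans ?_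
    gcongr
    exact eLpNorm_line_le_hardyNorm hp f hyt
  · refine (lintegral_Ioo_enorm_comp_div_le hp hbm.aestronglyMeasurable hR ht).trans ?_
    gcongr

/-- For fixed `t` the inner integral tends to `0` with the height `y / t`, and it is at most a
constant times `t^(1/p)`. Integration against `φ(t) / t` is therefore dominated by the density. -/
theorem tendsto_lintegral_complexHausdorff_sub (hp : 1 ≤ p)
    (hφm : AEStronglyMeasurable φ (volume.restrict (Ioi 0)))
    (hφ0 : ∀ᵐ t ∂(volume.restrict (Ioi (0 : ℝ))), 0 ≤ φ t) (hW : hausdorffWeight p φ < ∞)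
    (hf : MemHardy p f) {b : ℝ → ℂ} (hbm : Measurable b) (hb : boundaryValue f =ᵐ[volume] b)
    {R : ℝ} (hR : 0 ≤ R) :
    Tendsto (fun y : ℝ => ∫⁻ x in Ioo (-R) R,
      ‖complexHausdorff φ f (x + y * Complex.I) - realHausdorff φ b x‖ₑ) (𝓝[>] 0) (𝓝 0) := by
  have hbN : eLpNorm b p volume ≤ hardyNorm p f := by
    rw [← eLpNorm_congr_ae hb]
    exact hf.eLpNorm_boundaryValue_le hp
  set D : ℝ → ℝ → ℝ≥0∞ := fun y t =>
    ∫⁻ x in Ioo (-R) R, ‖f ((x + y * Complex.I) / t) - b (x / t)‖ₑ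
  have hjoint : ∀ y : ℝ, 0 < y → AEStronglyMeasurable (fun q : ℝ × ℝ =>
      f ((q.1 + y * Complex.I) / q.2) - b (q.1 / q.2))
      ((volume.restrict (Ioo (-R) R)).prod (volume.restrict (Ioi (0 : ℝ)))) := fun y hy =>
    ((aestronglyMeasurable_plane_div hf.1.continuousOn hy).mono_measure
      (Measure.prod_mono Measure.restrict_le_self le_rfl)).sub
      (measurable_comp_div hbm).aestronglyMeasurable
  have hw := (aestronglyMeasurable_div hφm).enorm
  have hint := ae_integrableOn_realHausdorffIntegrand_of_measurable hp hφm hφ0 hW hbm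
    (hbN.trans_lt hf.2)
  have hle : ∀ y : ℝ, 0 < y → ∫⁻ x in Ioo (-R) R,
      ‖complexHausdorff φ f (x + y * Complex.I) - realHausdorff φ b x‖ₑ ≤
      ∫⁻ t in Ioi (0 : ℝ), D y t * ‖((φ t / t : ℝ) : ℂ)‖ₑ := by
    intro y hy
    calc _ ≤ ∫⁻ x in Ioo (-R) R, ∫⁻ t in Ioi (0 : ℝ),
          ‖f ((x + y * Complex.I) / t) - b (x / t)‖ₑ * ‖((φ t / t : ℝ) : ℂ)‖ₑ := by
          refine lintegral_mono_ae (ae_restrict_of_ae ?_)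
          filter_upwards [hint] with x hx
          rw [complexHausdorff, realHausdorff, ← integral_sub
            (integrableOn_hausdorffIntegrand hp hφm hφ0 hW hf (by simpa using hy)) hx]
          refine (enorm_integral_le_lintegral_enorm _).trans (le_of_eq (lintegral_congr fun t => ?_))
          rw [hausdorffIntegrand, realHausdorffIntegrand, ← sub_mul, enorm_mul]
      _ = ∫⁻ t in Ioi (0 : ℝ), ∫⁻ x in Ioo (-R) R,
          ‖f ((x + y * Complex.I) / t) - b (x / t)‖ₑ * ‖((φ t / t : ℝ) : ℂ)‖ₑ :=
          lintegral_lintegral_swap ((hjoint y hy).enorm.mul hw.comp_snd)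
      _ = _ := by
          refine lintegral_congr fun t => ?_
          rw [lintegral_mul_const' _ _ (by finiteness)]
  have hlim : Tendsto (fun y : ℝ => ∫⁻ t in Ioi (0 : ℝ), D y t * ‖((φ t / t : ℝ) : ℂ)‖ₑ) (𝓝[>] 0)
      (𝓝 (∫⁻ t in Ioi (0 : ℝ), 0)) := by
    refine tendsto_lintegral_filter_of_dominated_convergence' (fun t => 2 * hardyNorm p f *
      ENNReal.ofReal ((2 * R) ^ (1 - p⁻¹.toReal)) * hausdorffDensity p φ t) ?_ ?_ ?_ ?_
    · filter_upwards [self_mem_nhdsWithin] with y hy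
      exact ((hjoint y hy).enorm.lintegral_prod_left').mul hw
    · filter_upwards [self_mem_nhdsWithin] with y hy
      filter_upwards [hφ0, ae_restrict_mem measurableSet_Ioi] with t ht h0
      rw [← enorm_div_eq h0 ht, ← mul_assoc]
      gcongr
      exact lintegral_dilate_sub_le hp hf hbm hbN hR hy h0
    · rw [lintegral_const_mul'' _ (aemeasurable_hausdorffDensity hφm)]
      exact (ENNReal.mul_lt_top (ENNReal.mul_lt_top
        (ENNReal.mul_lt_top (by finiteness) hf.2) ENNReal.ofReal_lt_top) hW).ne
    · refine (ae_restrict_mem measurableSet_Ioi).mono fun t ht => ?_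
      have h1 := ENNReal.Tendsto.mul_const (b := ‖((φ t / t : ℝ) : ℂ)‖ₑ)
        (tendsto_lintegral_dilate_sub hp hf hb R ht) (Or.inr (by finiteness))
      rwa [zero_mul] at h1
  rw [lintegral_zero] at hlim
  refine tendsto_of_tendsto_of_tendsto_of_le_of_le' tendsto_const_nhds hlim
    (Eventually.of_forall fun _ => zero_le) ?_
  filter_upwards [self_mem_nhdsWithin] with y hy using hle y hy

/-- The boundary values of the complex Hausdorff operator are given by the real one. -/
theorem boundaryValue_complexHausdorff (hp : 1 ≤ p)
    (hφm : AEStronglyMeasurable φ (volume.restrict (Ioi 0)))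
    (hφ0 : ∀ᵐ t ∂(volume.restrict (Ioi (0 : ℝ))), 0 ≤ φ t) (hW : hausdorffWeight p φ < ∞)
    (hf : MemHardy p f) :
    (∀ᵐ x : ℝ, IntegrableOn (realHausdorffIntegrand φ (boundaryValue f) x) (Ioi 0)) ∧
      boundaryValue (complexHausdorff φ f) =ᵐ[volume] realHausdorff φ (boundaryValue f) := by
  obtain ⟨b, hbm, hb⟩ := hf.aestronglyMeasurable_boundaryValue hp
  have hbN : eLpNorm b p volume < ∞ := by
    rw [← eLpNorm_congr_ae hb]
    exact (hf.memLp_boundaryValue hp).2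
  have hcongr := realHausdorff_congr_ae (φ := φ) hb
  refine ⟨?_, ?_⟩
  · filter_upwards [hcongr, ae_integrableOn_realHausdorffIntegrand_of_measurable hp hφm hφ0 hW
      hbm.measurable hbN] with x h1 h2
    exact h2.congr h1.symm
  have hH := memHardy_complexHausdorff hp hφm hφ0 hW hf
  have hHb := hH.hasBoundaryValue hp
  have hreal : AEStronglyMeasurable (realHausdorff φ b) :=
    (aestronglyMeasurable_realHausdorff_joint hφm hbm.measurable).integral_prod_right'
  have hseq : Tendsto (fun n : ℕ => 1 / ((n : ℝ) + 1)) atTop (𝓝[>] 0) :=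
    tendsto_nhdsWithin_iff.2 ⟨tendsto_one_div_add_atTop_nhds_zero_nat,
      Eventually.of_forall fun n => show (0 : ℝ) < 1 / ((n : ℝ) + 1) by positivity⟩
  -- The vertical limit and the local `L¹` limit must coincide: along `y = 1 / (n + 1)` Fatou's
  -- lemma makes the integral of their distance vanish.
  have hae : boundaryValue (complexHausdorff φ f) =ᵐ[volume] realHausdorff φ b := by
    refine ae_restrict_of_forall_Ioo fun R hR => ?_
    have h0 : ∫⁻ x in Ioo (-R) R, ‖boundaryValue (complexHausdorff φ f) x - realHausdorff φ b x‖ₑ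
        = 0 := by
      refine le_antisymm ?_ zero_le
      calc _ = ∫⁻ x in Ioo (-R) R, liminf (fun n : ℕ => ‖complexHausdorff φ f
            (x + (1 / ((n : ℝ) + 1) : ℝ) * Complex.I) - realHausdorff φ b x‖ₑ) atTop := by
            refine lintegral_congr_ae (ae_restrict_of_ae ?_)
            filter_upwards [hHb] with x hx
            exact (((continuous_enorm.tendsto _).comp (hx.sub_const _)).comp hseq).liminf_eq.symm
        _ ≤ liminf (fun n : ℕ => ∫⁻ x in Ioo (-R) R, ‖complexHausdorff φ f
            (x + (1 / ((n : ℝ) + 1) : ℝ) * Complex.I) - realHausdorff φ b x‖ₑ) atTop := by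
            refine lintegral_liminf_le' fun n => ?_
            exact ((continuous_horizontal_line hH.1.continuousOn
              (by positivity)).aestronglyMeasurable.sub hreal).restrict.enorm
        _ = 0 := ((tendsto_lintegral_complexHausdorff_sub hp hφm hφ0 hW hf hbm.measurable hb
            hR).comp hseq).liminf_eq
    have h1 := (lintegral_eq_zero_iff'
      ((hH.aestronglyMeasurable_boundaryValue hp).sub hreal).restrict.enorm).1 h0
    filter_upwards [h1] with x hx
    simpa [sub_eq_zero] using hx
  filter_upwards [hae, hcongr] with x h1 h2
  rw [h1, realHausdorff, realHausdorff]
  exact (integral_congr_ae h2).symm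

end Boundary

/-! ### Test functions and lower bounds. -/

/-- The test functions `(z + i)^(-a)`. -/
noncomputable def hardyTest (a : ℝ) (z : ℂ) : ℂ := (z + Complex.I) ^ ((-a : ℝ) : ℂ)

theorem norm_hardyTest (a : ℝ) (z : ℂ) : ‖hardyTest a z‖ = ‖z + Complex.I‖ ^ (-a) :=
  Complex.norm_cpow_real _ _

theorem differentiableOn_hardyTest (a : ℝ) : DifferentiableOn ℂ (hardyTest a) {z | 0 < z.im} := by
  intro z hz
  have hz' : 0 < z.im := hz
  refine DifferentiableAt.differentiableWithinAt ?_
  refine DifferentiableAt.cpow (by fun_prop) (by fun_prop) (Or.inr ?_)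
  simp
  linarith

theorem integral_Ioi_shift_rpow {K R s : ℝ} (hs : 1 < s) (hK : 0 < R + K) :
    ∫⁻ x in Ioi R, ENNReal.ofReal ((x + K) ^ (-s)) =
      ENNReal.ofReal ((R + K) ^ (1 - s) / (s - 1)) := by
  have h1 := (measurePreserving_add_right (volume : Measure ℝ) K).setLIntegral_comp_preimage_emb
    (measurableEmbedding_addRight K) (fun x => ENNReal.ofReal (x ^ (-s))) (Ioi (R + K))
  have hpre : (fun x : ℝ => x + K) ⁻¹' Ioi (R + K) = Ioi R := by ext x; simp
  rw [hpre] at h1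
  rw [h1, ← ofReal_integral_eq_lintegral_ofReal (integrableOn_Ioi_rpow_of_lt (by linarith) hK),
    integral_Ioi_rpow_of_lt (by linarith) hK]
  · congr 1
    rw [neg_div, ← div_neg]
    congr 1 <;> ring_nf
  · exact (ae_restrict_mem measurableSet_Ioi).mono fun x hx => Real.rpow_nonneg (hK.trans hx).le _

theorem lintegral_Iio_eq_Ioi_neg (h : ℝ → ℝ≥0∞) (R : ℝ) :
    ∫⁻ x in Iio (-R), h x = ∫⁻ x in Ioi R, h (-x) := by
  have h1 := (Measure.measurePreserving_neg (volume : Measure ℝ)).setLIntegral_comp_preimage_emb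
    (MeasurableEquiv.neg ℝ).measurableEmbedding h (Iio (-R))
  rw [← h1]
  congr 2
  ext x
  simp

/-- From `|x + iy + i| ≥ max 1 |x|`: the interval `[-1, 1]` contributes `2` and each tail `1 / (a r
- 1)`. The two tails carry the blow-up that the lower bounds must match. -/
theorem lintegral_hardyTest_line_le {a r : ℝ} (hr : 0 < r) (har : 1 < a * r) {y : ℝ} (hy : 0 < y) :
    ∫⁻ x : ℝ, ‖hardyTest a (x + y * Complex.I)‖ₑ ^ r ≤
      ENNReal.ofReal (2 + 2 / (a * r - 1)) := by
  have ha : 0 < a := by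
    by_contra! h
    nlinarith
  have hlow : ∀ x : ℝ, 1 ≤ ‖(x + y * Complex.I + Complex.I : ℂ)‖ ∧
      |x| ≤ ‖(x + y * Complex.I + Complex.I : ℂ)‖ := by
    intro x
    constructor
    · refine le_trans ?_ (one_add_im_le_norm_add_I (z := x + y * Complex.I))
      simp
      exact hy.le
    · refine le_trans (le_of_eq ?_) (Complex.abs_re_le_norm _)
      simp
  have hpt : ∀ x : ℝ, ∀ c : ℝ, 0 < c → c ≤ ‖(x + y * Complex.I + Complex.I : ℂ)‖ →
      ‖hardyTest a (x + y * Complex.I)‖ₑ ^ r ≤ ENNReal.ofReal (c ^ (-(a * r))) := by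
    intro x c hc hcx
    rw [← ofReal_norm, norm_hardyTest, ENNReal.ofReal_rpow_of_nonneg (by positivity) hr.le,
      ← Real.rpow_mul (norm_nonneg _), neg_mul]
    exact ENNReal.ofReal_le_ofReal (Real.rpow_le_rpow_of_nonpos hc hcx (by nlinarith))
  have hcover : (univ : Set ℝ) ⊆ Icc (-1) 1 ∪ (Ioi 1 ∪ Iio (-1)) := by
    intro x _
    rcases lt_or_ge 1 x with h | h
    · exact Or.inr (Or.inl h)
    rcases lt_or_ge x (-1) with h' | h'
    · exact Or.inr (Or.inr h')
    · exact Or.inl ⟨h', h⟩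
  have htail : ∫⁻ x in Ioi (1 : ℝ), ENNReal.ofReal (x ^ (-(a * r))) =
      ENNReal.ofReal (1 / (a * r - 1)) := by
    have := integral_Ioi_shift_rpow (K := 0) (R := 1) har (by norm_num)
    simpa using this
  have hpos : 0 < a * r - 1 := by linarith
  calc ∫⁻ x : ℝ, ‖hardyTest a (x + y * Complex.I)‖ₑ ^ r
      = ∫⁻ x : ℝ in univ, ‖hardyTest a (x + y * Complex.I)‖ₑ ^ r := by rw [Measure.restrict_univ]
    _ ≤ ∫⁻ x : ℝ in Icc (-1) 1 ∪ (Ioi 1 ∪ Iio (-1)), ‖hardyTest a (x + y * Complex.I)‖ₑ ^ r :=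
        lintegral_mono_set hcover
    _ ≤ (∫⁻ x : ℝ in Icc (-1) 1, ‖hardyTest a (x + y * Complex.I)‖ₑ ^ r) +
        ((∫⁻ x : ℝ in Ioi 1, ‖hardyTest a (x + y * Complex.I)‖ₑ ^ r) +
          ∫⁻ x : ℝ in Iio (-1), ‖hardyTest a (x + y * Complex.I)‖ₑ ^ r) := by
        refine (lintegral_union_le _ _ _).trans ?_
        gcongr
        exact lintegral_union_le _ _ _
    _ ≤ ENNReal.ofReal 2 + (ENNReal.ofReal (1 / (a * r - 1)) + ENNReal.ofReal (1 / (a * r - 1))) := by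
        refine add_le_add ?_ (add_le_add ?_ ?_)
        · refine (setLIntegral_mono' (g := fun _ => 1) measurableSet_Icc fun x _ => ?_).trans ?_
          · simpa using hpt x 1 one_pos (hlow x).1
          · rw [setLIntegral_const, Real.volume_Icc]
            norm_num
        · rw [← htail]
          refine setLIntegral_mono' measurableSet_Ioi fun x hx => ?_
          have hx1 : (1 : ℝ) < x := hx
          exact hpt x x (by linarith) ((le_abs_self x).trans (hlow x).2)
        · rw [← htail, lintegral_Iio_eq_Ioi_neg]
          refine setLIntegral_mono' measurableSet_Ioi fun x hx => ?_
          have hx1 : (1 : ℝ) < x := hx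
          refine hpt (-x) x (by linarith) (le_trans ?_ (hlow (-x)).2)
          rw [abs_neg]
          exact le_abs_self x
    _ = _ := by
        rw [← ENNReal.ofReal_add (by positivity) (by positivity),
          ← ENNReal.ofReal_add (by positivity) (by positivity)]
        congr 1
        ring

theorem hardyNorm_hardyTest_rpow_le {p : ℝ≥0∞} (hp : 1 ≤ p) (hp' : p ≠ ∞) {a : ℝ}
    (har : 1 < a * p.toReal) :
    hardyNorm p (hardyTest a) ^ p.toReal ≤ ENNReal.ofReal (2 + 2 / (a * p.toReal - 1)) := by
  have hr : 0 < p.toReal := ENNReal.toReal_pos (by positivity) hp'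
  rw [← ENNReal.le_rpow_inv_iff hr, hardyNorm, if_neg hp']
  refine iSup₂_le fun y hy => ?_
  rw [one_div]
  exact ENNReal.rpow_le_rpow (lintegral_hardyTest_line_le hr har hy) (by positivity)

theorem memHardy_hardyTest {p : ℝ≥0∞} (hp : 1 ≤ p) (hp' : p ≠ ∞) {a : ℝ}
    (har : 1 < a * p.toReal) : MemHardy p (hardyTest a) := by
  have hr : 0 < p.toReal := ENNReal.toReal_pos (by positivity) hp'
  refine ⟨differentiableOn_hardyTest a, ?_⟩
  have h := (hardyNorm_hardyTest_rpow_le hp hp' har).trans_lt ENNReal.ofReal_lt_top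
  exact (ENNReal.rpow_lt_top_iff_of_pos hr).1 h

/-- After rotation by a reference angle `θ`, the real part keeps the full modulus up to the cosine
of the phase error. -/
theorem re_exp_mul_cpow {ζ : ℂ} (hζ : ζ ≠ 0) (a θ : ℝ) :
    (Complex.exp ((a * θ : ℝ) * Complex.I) * ζ ^ ((-a : ℝ) : ℂ)).re =
      ‖ζ‖ ^ (-a) * Real.cos (a * (θ - ζ.arg)) := by
  rw [Complex.cpow_def_of_ne_zero hζ, ← Complex.exp_add, Complex.exp_re,
    Real.rpow_def_of_pos (norm_pos_iff.2 hζ)]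
  congr 2
  · simp [Complex.log_re]
  · simp [Complex.log_im]
    ring

/-- Lower bound for the Hausdorff operator applied to a test function, under a restriction on the
phases that occur in the integral. -/
theorem norm_complexHausdorff_hardyTest_ge {ψ : ℝ → ℝ} {q ε x θ β : ℝ} {n : ℕ}
    (hψ0 : ∀ᵐ t ∂(volume.restrict (Ioi (0 : ℝ))), 0 ≤ ψ t) (hq : 0 ≤ q) (hε : 0 < ε) (hn : 1 ≤ n)
    (hβ0 : 0 ≤ β) (hβ : β ≤ Real.pi / 2)
    (hint : IntegrableOn (hausdorffIntegrand ψ (hardyTest (q + ε)) (x + Complex.I)) (Ioi 0))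
    (hphase : ∀ t : ℝ, 0 < t → ψ t ≠ 0 →
      |(q + ε) * (θ - (x + (1 + t) * Complex.I : ℂ).arg)| ≤ β) :
    Real.cos β * (n : ℝ) ^ (-ε) * (∫ t in Icc (1 / (n : ℝ)) n, t ^ (q - 1) * ψ t) *
        (|x| + (1 + n)) ^ (-(q + ε)) ≤
      ‖complexHausdorff ψ (hardyTest (q + ε)) (x + Complex.I)‖ := by
  set a := q + ε
  have ha : 0 < a := by positivity
  have hn0 : (0 : ℝ) < n := by exact_mod_cast hn
  have hcos : 0 ≤ Real.cos β := Real.cos_nonneg_of_mem_Icc ⟨by linarith, hβ⟩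
  set u : ℂ := Complex.exp ((a * θ : ℝ) * Complex.I)
  set G : ℝ → ℝ := fun t => (u * hausdorffIntegrand ψ (hardyTest a) (x + Complex.I) t).re
  have hS : Icc (1 / (n : ℝ)) n ⊆ Ioi 0 := fun t ht => lt_of_lt_of_le (by positivity) ht.1
  have hGval : ∀ t : ℝ, 0 < t → G t = (‖(x + (1 + t) * Complex.I : ℂ)‖ / t) ^ (-a) *
      Real.cos (a * (θ - (x + (1 + t) * Complex.I : ℂ).arg)) * (ψ t / t) := by
    intro t ht
    have ht' : (t : ℂ) ≠ 0 := Complex.ofReal_ne_zero.2 ht.ne'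
    -- The positive factor `t⁻¹` does not affect the argument, so only the phases of `x + (1 + t) i`
    -- enter.
    have e : ((x : ℂ) + Complex.I) / t + Complex.I =
        ((t⁻¹ : ℝ) : ℂ) * (x + (1 + t) * Complex.I) := by
      push_cast
      field_simp
      ring
    have hw : (x + (1 + t) * Complex.I : ℂ) ≠ 0 := by
      intro h
      have := congrArg Complex.im h
      simp at this
      linarith
    have hζ : ((x : ℂ) + Complex.I) / t + Complex.I ≠ 0 := by
      rw [e]
      exact mul_ne_zero (Complex.ofReal_ne_zero.2 (inv_ne_zero ht.ne')) hw
    have h1 := re_exp_mul_cpow hζ a θ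
    have harg : (((x : ℂ) + Complex.I) / t + Complex.I).arg = (x + (1 + t) * Complex.I : ℂ).arg := by
      rw [e, Complex.arg_real_mul _ (inv_pos.2 ht)]
    have hnorm : ‖((x : ℂ) + Complex.I) / t + Complex.I‖ =
        ‖(x + (1 + t) * Complex.I : ℂ)‖ / t := by
      rw [e, norm_mul, Complex.norm_real, Real.norm_of_nonneg (inv_pos.2 ht).le, inv_mul_eq_div]
    rw [harg, hnorm] at h1
    simp only [G, hausdorffIntegrand, hardyTest]
    rw [← mul_assoc, Complex.re_mul_ofReal, h1]
  have hcosle : ∀ t : ℝ, 0 < t → ψ t ≠ 0 →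
      Real.cos β ≤ Real.cos (a * (θ - (x + (1 + t) * Complex.I : ℂ).arg)) := by
    intro t ht hψt
    rw [← Real.cos_abs (a * _)]
    exact Real.cos_le_cos_of_nonneg_of_le_pi (abs_nonneg _) (by linarith [Real.pi_pos])
      (hphase t ht hψt)
  have hGi : IntegrableOn G (Ioi 0) := (hint.const_mul u).re
  have hG0 : ∀ᵐ t ∂(volume.restrict (Ioi (0 : ℝ))), 0 ≤ G t := by
    filter_upwards [hψ0, ae_restrict_mem measurableSet_Ioi] with t ht h0
    have h0' : (0 : ℝ) < t := h0
    rw [hGval t h0]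
    by_cases hψt : ψ t = 0
    · simp [hψt]
    · have := hcos.trans (hcosle t h0 hψt)
      positivity
  have hle : ∀ᵐ t ∂(volume.restrict (Icc (1 / (n : ℝ)) n)),
      Real.cos β * (n : ℝ) ^ (-ε) * (|x| + (1 + n)) ^ (-a) * (t ^ (q - 1) * ψ t) ≤ G t := by
    filter_upwards [ae_restrict_of_ae_restrict_of_subset hS hψ0, ae_restrict_mem measurableSet_Icc]
      with t hψt ht
    have ht0 : 0 < t := hS ht
    rw [hGval t ht0]
    by_cases hψ : ψ t = 0
    · simp [hψ]
    have h1 := hcosle t ht0 hψ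
    have h2 : ‖(x + (1 + t) * Complex.I : ℂ)‖ ≤ |x| + (1 + n) := by
      refine (norm_add_le _ _).trans ?_
      rw [norm_mul, Complex.norm_I, Complex.norm_real, mul_one, Real.norm_eq_abs]
      have : ‖(1 + t : ℂ)‖ = 1 + t := by
        rw [← Complex.ofReal_one, ← Complex.ofReal_add, Complex.norm_real,
          Real.norm_of_nonneg (by positivity)]
      rw [this]
      linarith [ht.2]
    have hw : 0 < ‖(x + (1 + t) * Complex.I : ℂ)‖ := by
      refine lt_of_lt_of_le (by positivity : 0 < 1 + t) ?_
      refine le_trans ?_ (Complex.abs_im_le_norm _)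
      simp [le_abs_self]
    have h3 : (|x| + (1 + n)) ^ (-a) * t ^ a ≤ (‖(x + (1 + t) * Complex.I : ℂ)‖ / t) ^ (-a) := by
      rw [Real.div_rpow hw.le ht0.le, Real.rpow_neg ht0.le, div_inv_eq_mul]
      gcongr ?_ * _
      exact Real.rpow_le_rpow_of_nonpos hw h2 (by linarith)
    -- The excess `t^ε` of the test exponent is at least `n^(-ε)` because `t ≥ 1 / n`.
    have h4 : (n : ℝ) ^ (-ε) * t ^ (q - 1) ≤ t ^ a * t⁻¹ := by
      have h5 : t ^ a * t⁻¹ = t ^ ε * t ^ (q - 1) := by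
        rw [← Real.rpow_add ht0, ← Real.rpow_neg_one, ← Real.rpow_add ht0]
        congr 1
        simp only [a]
        ring
      rw [h5]
      gcongr
      rw [Real.rpow_neg hn0.le, ← Real.inv_rpow hn0.le]
      gcongr
      simpa using ht.1
    calc Real.cos β * (n : ℝ) ^ (-ε) * (|x| + (1 + n)) ^ (-a) * (t ^ (q - 1) * ψ t)
        = Real.cos β * (|x| + (1 + n)) ^ (-a) * ((n : ℝ) ^ (-ε) * t ^ (q - 1)) * ψ t := by ring
      _ ≤ Real.cos β * (|x| + (1 + n)) ^ (-a) * (t ^ a * t⁻¹) * ψ t := by gcongr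
      _ = ((|x| + (1 + n)) ^ (-a) * t ^ a) * Real.cos β * (ψ t / t) := by
          rw [div_eq_mul_inv]; ring
      _ ≤ _ := by gcongr
  calc _ = ∫ t in Icc (1 / (n : ℝ)) n,
        Real.cos β * (n : ℝ) ^ (-ε) * (|x| + (1 + n)) ^ (-a) * (t ^ (q - 1) * ψ t) := by
        rw [integral_const_mul]; ring
    _ ≤ ∫ t in Icc (1 / (n : ℝ)) n, G t := by
        refine integral_mono_of_nonneg ?_ (hGi.mono_set hS) hle
        filter_upwards [ae_restrict_of_ae_restrict_of_subset hS hψ0,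
          ae_restrict_mem measurableSet_Icc] with t hψt ht
        have ht0 : 0 < t := hS ht
        simp only [Pi.zero_apply]
        positivity
    _ ≤ ∫ t in Ioi 0, G t := setIntegral_mono_set hGi hG0 hS.eventuallyLE
    _ = (u * complexHausdorff ψ (hardyTest a) (x + Complex.I)).re := by
        rw [complexHausdorff, ← integral_const_mul]
        exact integral_re (hint.const_mul u)
    _ ≤ ‖u * complexHausdorff ψ (hardyTest a) (x + Complex.I)‖ := Complex.re_le_norm _
    _ = _ := by
        rw [norm_mul, Complex.norm_exp_ofReal_mul_I, one_mul]

theorem ofReal_le_lintegral_Ioi_rpow {T : ℝ → ℂ} {a r c R K : ℝ} (hr : 0 < r) (har : 1 < a * r)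
    (hc : 0 ≤ c) (hK : 0 < R + K) (h : ∀ x, R < x → c * (x + K) ^ (-a) ≤ ‖T x‖) :
    ENNReal.ofReal (c ^ r * ((R + K) ^ (1 - a * r) / (a * r - 1))) ≤
      ∫⁻ x in Ioi R, ‖T x‖ₑ ^ r := by
  rw [ENNReal.ofReal_mul (by positivity), ← integral_Ioi_shift_rpow har hK,
    ← lintegral_const_mul' _ _ ENNReal.ofReal_ne_top]
  refine setLIntegral_mono' measurableSet_Ioi fun x hx => ?_
  have hx' : R < x := hx
  have h0 : 0 < x + K := by linarith
  rw [← ENNReal.ofReal_mul (by positivity), ← ofReal_norm,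
    ENNReal.ofReal_rpow_of_nonneg (norm_nonneg _) hr.le]
  refine ENNReal.ofReal_le_ofReal (le_trans (le_of_eq ?_)
    (Real.rpow_le_rpow (by positivity) (h x hx') hr.le))
  rw [Real.mul_rpow hc (by positivity), ← Real.rpow_mul h0.le, neg_mul]

/-- Both sides blow up like `1 / ε`; after multiplication by `ε r` only the leading coefficients
survive as `ε → 0`. -/
theorem le_of_eventually_scaled_rpow_le {k D r K c₀ : ℝ} {c : ℝ → ℝ} (hr : 0 < r) (hK : 0 < K)
    (hc : Tendsto c (𝓝[>] 0) (𝓝 c₀))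
    (h : ∀ᶠ ε in 𝓝[>] (0 : ℝ),
      k * (c ε ^ r * (K ^ (-(ε * r)) / (ε * r))) ≤ D * (2 + 2 / (ε * r))) :
    k * c₀ ^ r ≤ 2 * D := by
  have hid : Tendsto (fun ε : ℝ => ε) (𝓝[>] 0) (𝓝 0) := nhdsWithin_le_nhds
  have hlim1 : Tendsto (fun ε : ℝ => k * (c ε ^ r * K ^ (-(ε * r)))) (𝓝[>] 0)
      (𝓝 (k * (c₀ ^ r * K ^ (-((0 : ℝ) * r))))) := by
    refine ((hc.rpow_const (Or.inr hr.le)).mul ?_).const_mul k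
    exact tendsto_const_nhds.rpow ((hid.mul_const r).neg) (Or.inl hK.ne')
  have hlim2 : Tendsto (fun ε : ℝ => D * (2 * (ε * r) + 2)) (𝓝[>] 0)
      (𝓝 (D * (2 * ((0 : ℝ) * r) + 2))) :=
    (((hid.mul_const r).const_mul 2).add_const 2).const_mul D
  have hle := le_of_tendsto_of_tendsto hlim1 hlim2 <| by
    filter_upwards [h, self_mem_nhdsWithin] with ε hε h0
    have hε0 : ε ≠ 0 := ne_of_gt h0
    have h0' : 0 < ε * r := mul_pos h0 hr
    have := mul_le_mul_of_nonneg_right hε h0'.le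
    calc k * (c ε ^ r * K ^ (-(ε * r)))
        = k * (c ε ^ r * (K ^ (-(ε * r)) / (ε * r))) * (ε * r) := by field_simp
      _ ≤ _ := this
      _ = _ := by field_simp
  simp only [zero_mul, neg_zero, Real.rpow_zero, mul_one, mul_zero, zero_add] at hle
  linarith

theorem tendsto_cos_mul_rpow_neg {q γ A : ℝ} {n : ℕ} (hn : 1 ≤ n) :
    Tendsto (fun ε : ℝ => Real.cos ((q + ε) * γ) * (n : ℝ) ^ (-ε) * A) (𝓝[>] 0)
      (𝓝 (Real.cos (q * γ) * A)) := by
  have hn0 : (n : ℝ) ≠ 0 := by positivity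
  have h : ContinuousAt (fun ε : ℝ => Real.cos ((q + ε) * γ) * (n : ℝ) ^ (-ε) * A) 0 := by
    refine ContinuousAt.mul (ContinuousAt.mul (by fun_prop) ?_) continuousAt_const
    exact continuousAt_const.rpow continuousAt_neg (Or.inl hn0)
  have h2 := h.tendsto.mono_left (nhdsWithin_le_nhds (s := Ioi 0))
  simpa using h2

section LowerBound

variable {ψ : ℝ → ℝ} {q r D : ℝ} {n : ℕ}

theorem integral_weight_nonneg (hψ0 : ∀ᵐ t ∂(volume.restrict (Ioi (0 : ℝ))), 0 ≤ ψ t) (hn : 1 ≤ n) :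
    0 ≤ ∫ t in Icc (1 / (n : ℝ)) n, t ^ (q - 1) * ψ t := by
  have hS : Icc (1 / (n : ℝ)) n ⊆ Ioi 0 := fun t ht => lt_of_lt_of_le (by positivity) ht.1
  refine integral_nonneg_of_ae ?_
  filter_upwards [ae_restrict_of_ae_restrict_of_subset hS hψ0, ae_restrict_mem measurableSet_Icc]
    with t hψt ht
  exact mul_nonneg (Real.rpow_nonneg (hS ht).le _) hψt

theorem arg_mem_of_pos {x s : ℝ} (hx : 0 < x) (hs : 0 < s) :
    0 ≤ (x + s * Complex.I : ℂ).arg ∧ (x + s * Complex.I : ℂ).arg ≤ Real.pi / 2 := by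
  refine ⟨Complex.arg_nonneg_iff.2 (by simpa using hs.le), ?_⟩
  exact (abs_le.1 (Complex.abs_arg_le_pi_div_two_iff.2 (by simpa using hx.le))).2

/-- Jordan's inequality `(2/π) θ ≤ sin θ`, with the sine of the argument at most `s / x`. -/
theorem arg_le_of_pos {x s : ℝ} (hx : 0 < x) (hs : 0 < s) :
    (x + s * Complex.I : ℂ).arg ≤ Real.pi / 2 * (s / x) := by
  obtain ⟨h0, h1⟩ := arg_mem_of_pos hx hs
  have h2 := Real.mul_le_sin h0 h1
  have hx2 : x ≤ ‖(x + s * Complex.I : ℂ)‖ := by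
    refine le_trans (le_of_eq ?_) (Complex.re_le_norm _)
    simp
  rw [Complex.sin_arg] at h2
  have h3 : (x + s * Complex.I : ℂ).im / ‖(x + s * Complex.I : ℂ)‖ ≤ s / x := by
    have : (x + s * Complex.I : ℂ).im = s := by simp
    rw [this]
    gcongr
  have h4 := h2.trans h3
  have hpi := Real.pi_pos
  calc (x + s * Complex.I : ℂ).arg = Real.pi / 2 * (2 / Real.pi * (x + s * Complex.I : ℂ).arg) := by
        field_simp
    _ ≤ _ := by gcongr

theorem arg_of_neg {x s : ℝ} (hs : 0 < s) :
    ((-x : ℝ) + s * Complex.I : ℂ).arg = Real.pi - (x + s * Complex.I : ℂ).arg := by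
  have e : ((-x : ℝ) + s * Complex.I : ℂ) = -(starRingEnd ℂ) (x + s * Complex.I) := by
    simp [add_comm]
  have him : 0 < (x + s * Complex.I : ℂ).im := by simpa using hs
  rw [e, Complex.arg_neg_eq_arg_add_pi_of_im_neg (by simpa using hs), Complex.arg_conj, if_neg]
  · ring
  · intro h
    rw [Complex.arg_eq_pi_iff] at h
    exact him.ne' h.2

/-- A one-sided estimate, without support condition, losing a constant factor. -/
theorem cos_mul_integral_weight_rpow_le
    (hψ0 : ∀ᵐ t ∂(volume.restrict (Ioi (0 : ℝ))), 0 ≤ ψ t) (hq : 0 ≤ q) (hq1 : q ≤ 1) (hr : 0 < r)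
    (hqr : q * r = 1) (hn : 1 ≤ n)
    (hint : ∀ ε : ℝ, 0 < ε → ∀ x : ℝ,
      IntegrableOn (hausdorffIntegrand ψ (hardyTest (q + ε)) (x + Complex.I)) (Ioi 0))
    (hD : ∀ ε : ℝ, 0 < ε →
      ∫⁻ x : ℝ, ‖complexHausdorff ψ (hardyTest (q + ε)) (x + Complex.I)‖ₑ ^ r ≤
        ENNReal.ofReal (D * (2 + 2 / (ε * r)))) (hD0 : 0 ≤ D) :
    (Real.cos (q * (Real.pi / 4)) * ∫ t in Icc (1 / (n : ℝ)) n, t ^ (q - 1) * ψ t) ^ r ≤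
      2 * D := by
  set A := ∫ t in Icc (1 / (n : ℝ)) n, t ^ (q - 1) * ψ t
  have hA : 0 ≤ A := integral_weight_nonneg hψ0 hn
  have hpi := Real.pi_pos
  rw [← one_mul ((_ : ℝ) ^ r)]
  refine le_of_eventually_scaled_rpow_le (K := 0 + (1 + n)) hr (by positivity)
    (tendsto_cos_mul_rpow_neg hn) ?_
  filter_upwards [Ioo_mem_nhdsGT one_pos] with ε hε
  obtain ⟨hε0, hε1⟩ := hε
  -- For `x > 0` every phase lies in `[0, π/2]`, so centring at `π/4` needs no support condition.
  -- The cosine stays nonnegative because `q + ε < 2`.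
  have hβ : (q + ε) * (Real.pi / 4) ≤ Real.pi / 2 := by nlinarith
  have hcos : 0 ≤ Real.cos ((q + ε) * (Real.pi / 4)) :=
    Real.cos_nonneg_of_mem_Icc ⟨by nlinarith [mul_nonneg (add_nonneg hq hε0.le) hpi.le], hβ⟩
  have e1 : (q + ε) * r = 1 + ε * r := by rw [add_mul, hqr]
  have h := ofReal_le_lintegral_Ioi_rpow (a := q + ε) (r := r) (R := 0) (K := 1 + n)
    (c := Real.cos ((q + ε) * (Real.pi / 4)) * (n : ℝ) ^ (-ε) * A)
    (T := fun x : ℝ => complexHausdorff ψ (hardyTest (q + ε)) (x + Complex.I)) hr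
    (by rw [e1]; nlinarith [mul_pos hε0 hr]) (by positivity) (by positivity) fun x hx => by
      have := norm_complexHausdorff_hardyTest_ge (θ := Real.pi / 4) (x := x) hψ0 hq hε0 hn
        (by positivity) hβ (hint ε hε0 x) fun t ht _ => by
          have h1 := arg_mem_of_pos (s := 1 + t) hx (by positivity)
          push_cast at h1
          rw [abs_mul, abs_of_nonneg (by positivity : 0 ≤ q + ε)]
          gcongr
          rw [abs_le]
          constructor <;> linarith [h1.1, h1.2]
      rwa [abs_of_pos hx] at this
  have h2 := (h.trans (setLIntegral_le_lintegral _ _)).trans (hD ε hε0)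
  have h3 : 0 < ε * r := mul_pos hε0 hr
  rw [ENNReal.ofReal_le_ofReal_iff (by positivity), e1] at h2
  rw [one_mul]
  convert h2 using 4 <;> ring

/-- The two-sided estimate for compactly supported weights. -/
theorem integral_weight_le
    (hψ0 : ∀ᵐ t ∂(volume.restrict (Ioi (0 : ℝ))), 0 ≤ ψ t) (hq : 0 ≤ q) (hq1 : q ≤ 1) (hr : 0 < r)
    (hqr : q * r = 1) (hn : 1 ≤ n) (hsupp : ∀ t, ψ t ≠ 0 → t ≤ n)
    (hint : ∀ ε : ℝ, 0 < ε → ∀ x : ℝ,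
      IntegrableOn (hausdorffIntegrand ψ (hardyTest (q + ε)) (x + Complex.I)) (Ioi 0))
    (hD0 : 0 ≤ D)
    (hD : ∀ ε : ℝ, 0 < ε →
      ∫⁻ x : ℝ, ‖complexHausdorff ψ (hardyTest (q + ε)) (x + Complex.I)‖ₑ ^ r ≤
        ENNReal.ofReal (D ^ r * (2 + 2 / (ε * r)))) :
    ∫ t in Icc (1 / (n : ℝ)) n, t ^ (q - 1) * ψ t ≤ D := by
  set A := ∫ t in Icc (1 / (n : ℝ)) n, t ^ (q - 1) * ψ t
  have hA : 0 ≤ A := integral_weight_nonneg hψ0 hn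
  have hpi := Real.pi_pos
  -- For `|x| > R` and `t ≤ n` the phases lie within `η R` of `0` or of `π`, according to the sign
  -- of `x`.
  set η : ℝ → ℝ := fun R => Real.pi / 2 * ((1 + n) / R)
  have hη : Tendsto η atTop (𝓝 0) := by
    have := (tendsto_const_nhds (x := (1 + n : ℝ))).div_atTop (tendsto_id (α := ℝ) (x := atTop))
    simpa using this.const_mul (Real.pi / 2)
  have hlim : Tendsto (fun R => Real.cos (q * η R) * A) atTop (𝓝 A) := by
    have h := ((Real.continuous_cos.tendsto _).comp (hη.const_mul q)).mul_const A
    simpa using h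
  refine le_of_tendsto hlim ?_
  filter_upwards [eventually_gt_atTop 0,
    hη.eventually (gt_mem_nhds (by positivity : 0 < Real.pi / 4))] with R hR hηR
  have hη0 : 0 ≤ η R := by positivity
  have hcosq : 0 ≤ Real.cos (q * η R) := by
    refine Real.cos_nonneg_of_mem_Icc ⟨by nlinarith [mul_nonneg hq hη0], ?_⟩
    nlinarith
  -- The left factor `2` counts the half-lines `x > R` and `x < -R` and matches the two tails in the
  -- norm of the test function; one half-line alone would lose `2^(1/p)`.
  suffices h : 2 * (Real.cos (q * η R) * A) ^ r ≤ 2 * D ^ r by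
    exact (Real.rpow_le_rpow_iff (by positivity) hD0 hr).1 (by linarith)
  refine le_of_eventually_scaled_rpow_le (K := R + (1 + n)) hr (by positivity)
    (tendsto_cos_mul_rpow_neg hn) ?_
  filter_upwards [Ioo_mem_nhdsGT one_pos] with ε hε
  obtain ⟨hε0, hε1⟩ := hε
  have hβ0 : 0 ≤ (q + ε) * η R := by positivity
  have hβ : (q + ε) * η R ≤ Real.pi / 2 := by nlinarith
  have hcos : 0 ≤ Real.cos ((q + ε) * η R) :=
    Real.cos_nonneg_of_mem_Icc ⟨by linarith, hβ⟩
  have e1 : (q + ε) * r = 1 + ε * r := by rw [add_mul, hqr]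
  have h3 : 0 < ε * r := mul_pos hε0 hr
  have hphase : ∀ x, R < x → ∀ t, 0 < t → ψ t ≠ 0 →
      0 ≤ (x + (1 + t) * Complex.I : ℂ).arg ∧ (x + (1 + t) * Complex.I : ℂ).arg ≤ η R := by
    intro x hx t ht hψt
    have hx0 : 0 < x := hR.trans hx
    have h1 := arg_mem_of_pos (s := 1 + t) hx0 (by positivity)
    have h2 := arg_le_of_pos (s := 1 + t) hx0 (by positivity)
    push_cast at h1 h2
    refine ⟨h1.1, h2.trans ?_⟩
    simp only [η]
    have := hsupp t hψt
    gcongr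
  have hpos := ofReal_le_lintegral_Ioi_rpow (a := q + ε) (r := r) (R := R) (K := 1 + n)
    (c := Real.cos ((q + ε) * η R) * (n : ℝ) ^ (-ε) * A)
    (T := fun x : ℝ => complexHausdorff ψ (hardyTest (q + ε)) (x + Complex.I)) hr
    (by rw [e1]; linarith) (by positivity) (by positivity) fun x hx => by
      have := norm_complexHausdorff_hardyTest_ge (θ := 0) (x := x) hψ0 hq hε0 hn
        hβ0 hβ (hint ε hε0 x) fun t ht hψt => by
          have h1 := hphase x hx t ht hψt
          rw [abs_mul, abs_of_nonneg (by positivity : 0 ≤ q + ε)]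
          gcongr
          rw [abs_le]
          constructor <;> linarith [h1.1, h1.2]
      rwa [abs_of_pos (hR.trans hx)] at this
  have hneg := ofReal_le_lintegral_Ioi_rpow (a := q + ε) (r := r) (R := R) (K := 1 + n)
    (c := Real.cos ((q + ε) * η R) * (n : ℝ) ^ (-ε) * A)
    (T := fun x : ℝ => complexHausdorff ψ (hardyTest (q + ε)) ((-x : ℝ) + Complex.I)) hr
    (by rw [e1]; linarith) (by positivity) (by positivity) fun x hx => by
      have := norm_complexHausdorff_hardyTest_ge (θ := Real.pi) (x := -x) hψ0 hq hε0 hn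
        hβ0 hβ (hint ε hε0 (-x)) fun t ht hψt => by
          have h1 := hphase x hx t ht hψt
          have h2 := arg_of_neg (x := x) (s := 1 + t) (by positivity)
          push_cast at h2 ⊢
          rw [h2, abs_mul, abs_of_nonneg (by positivity : 0 ≤ q + ε)]
          gcongr
          rw [abs_le]
          constructor <;> linarith [h1.1, h1.2]
      rwa [abs_neg, abs_of_pos (hR.trans hx)] at this
  rw [← lintegral_Iio_eq_Ioi_neg
    (fun x : ℝ => ‖complexHausdorff ψ (hardyTest (q + ε)) (x + Complex.I)‖ₑ ^ r)] at hneg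
  have hdisj : Disjoint (Ioi R) (Iio (-R)) := by
    rw [Set.disjoint_left]
    intro x hx hx'
    have h1 : R < x := hx
    have h2 : x < -R := hx'
    linarith
  have h2 := (add_le_add hpos hneg).trans ((lintegral_union measurableSet_Iio hdisj).symm.le.trans
    (setLIntegral_le_lintegral _ _)) |>.trans (hD ε hε0)
  rw [e1] at h2
  have e2 : 1 + ε * r - 1 = ε * r := by ring
  have e3 : 1 - (1 + ε * r) = -(ε * r) := by ring
  rw [e2, e3, ← ENNReal.ofReal_add (by positivity) (by positivity),
    ENNReal.ofReal_le_ofReal_iff (by positivity)] at h2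
  rw [two_mul]
  exact h2

end LowerBound

/-! ### Truncation of the weight. -/

section Truncation

variable {p : ℝ≥0∞} {φ : ℝ → ℝ} {n : ℕ}

theorem Icc_inv_subset_Ioi (hn : 1 ≤ n) : Icc (1 / (n : ℝ)) n ⊆ Ioi 0 :=
  fun _ ht => lt_of_lt_of_le (by positivity) ht.1

theorem integrableOn_rpow_mul (hφ : LocallyIntegrableOn φ (Ioi (0 : ℝ))) (s : ℝ) (hn : 1 ≤ n) :
    IntegrableOn (fun t : ℝ => t ^ s * φ t) (Icc (1 / (n : ℝ)) n) :=
  (hφ.integrableOn_compact_subset (Icc_inv_subset_Ioi hn) isCompact_Icc).continuousOn_mul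
    ((continuousOn_rpow_Ioi s).mono (Icc_inv_subset_Ioi hn)) isCompact_Icc

theorem setLIntegral_hausdorffDensity_eq
    (hφ0 : ∀ᵐ t ∂(volume.restrict (Ioi (0 : ℝ))), 0 ≤ φ t)
    (hφ : LocallyIntegrableOn φ (Ioi (0 : ℝ))) (hn : 1 ≤ n) :
    ∫⁻ t in Icc (1 / (n : ℝ)) n, hausdorffDensity p φ t =
      ENNReal.ofReal (∫ t in Icc (1 / (n : ℝ)) n, t ^ (p⁻¹.toReal - 1) * φ t) := by
  rw [ofReal_integral_eq_lintegral_ofReal (integrableOn_rpow_mul hφ _ hn)]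
  · rfl
  · filter_upwards [ae_restrict_of_ae_restrict_of_subset (Icc_inv_subset_Ioi hn) hφ0,
      ae_restrict_mem measurableSet_Icc] with t h1 ht
    exact mul_nonneg (Real.rpow_nonneg (Icc_inv_subset_Ioi hn ht).le _) h1

theorem hausdorffWeight_le_of_forall_Icc {B : ℝ≥0∞}
    (h : ∀ n : ℕ, 1 ≤ n → ∫⁻ t in Icc (1 / (n : ℝ)) n, hausdorffDensity p φ t ≤ B) :
    hausdorffWeight p φ ≤ B := by
  have hmono : Monotone fun n : ℕ => Icc (1 / ((n + 1 : ℕ) : ℝ)) ((n + 1 : ℕ) : ℝ) := by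
    intro m n hmn
    refine Icc_subset_Icc ?_ ?_
    · gcongr
    · exact_mod_cast Nat.add_le_add_right hmn 1
  have hU : Ioi (0 : ℝ) = ⋃ n : ℕ, Icc (1 / ((n + 1 : ℕ) : ℝ)) ((n + 1 : ℕ) : ℝ) := by
    refine Subset.antisymm (fun t ht => ?_) (iUnion_subset fun n => Icc_inv_subset_Ioi (by simp))
    have ht' : (0 : ℝ) < t := ht
    obtain ⟨n, hn⟩ := exists_nat_ge (max t⁻¹ t)
    refine mem_iUnion.2 ⟨n, ?_, ?_⟩
    · rw [one_div, inv_le_comm₀ (by positivity) ht']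
      push_cast
      linarith [(le_max_left t⁻¹ t).trans hn]
    · push_cast
      linarith [(le_max_right t⁻¹ t).trans hn]
  rw [hausdorffWeight_eq_lintegral, hU, setLIntegral_iUnion_of_directed _ hmono.directed_le]
  exact iSup_le fun n => h (n + 1) (by simp)

theorem hausdorffWeight_indicator {S : Set ℝ} (hS : MeasurableSet S) (hS0 : S ⊆ Ioi 0) :
    hausdorffWeight p (S.indicator φ) = ∫⁻ t in S, hausdorffDensity p φ t := by
  have e : hausdorffDensity p (S.indicator φ) = S.indicator (hausdorffDensity p φ) := by
    ext t
    by_cases ht : t ∈ S <;> simp [hausdorffDensity, ht]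
  rw [hausdorffWeight_eq_lintegral, e, setLIntegral_indicator hS, inter_eq_left.2 hS0]

theorem complexHausdorff_add {φ ψ : ℝ → ℝ} {f : ℂ → ℂ} {z : ℂ}
    (hφ : IntegrableOn (hausdorffIntegrand φ f z) (Ioi 0))
    (hψ : IntegrableOn (hausdorffIntegrand ψ f z) (Ioi 0)) :
    complexHausdorff (φ + ψ) f z = complexHausdorff φ f z + complexHausdorff ψ f z := by
  rw [complexHausdorff, complexHausdorff, complexHausdorff, ← integral_add hφ hψ]
  refine integral_congr_ae (Eventually.of_forall fun t => ?_)
  simp only [hausdorffIntegrand, Pi.add_apply]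
  push_cast
  ring

end Truncation

/-! ### Necessity and the sharp constant. -/

section Necessity

variable {p : ℝ≥0∞} {φ : ℝ → ℝ}

theorem ofReal_toReal_rpow_mul {E : ℝ≥0∞} (hE : E ≠ ∞) {r : ℝ} (hr : 0 ≤ r) (b : ℝ) :
    ENNReal.ofReal (E.toReal ^ r * b) = E ^ r * ENNReal.ofReal b := by
  rw [ENNReal.ofReal_mul (by positivity), ← ENNReal.ofReal_rpow_of_nonneg (by positivity) hr,
    ENNReal.ofReal_toReal hE]

theorem toReal_inv_add_mul_toReal (hp : 1 ≤ p) (hp' : p ≠ ∞) (ε : ℝ) :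
    (p⁻¹.toReal + ε) * p.toReal = 1 + ε * p.toReal := by
  have hr : 0 < p.toReal := ENNReal.toReal_pos (by positivity) hp'
  rw [add_mul, toReal_inv_eq_one_div, one_div_mul_cancel hr.ne']

theorem memHardy_hardyTest_add (hp : 1 ≤ p) (hp' : p ≠ ∞) {ε : ℝ} (hε : 0 < ε) :
    MemHardy p (hardyTest (p⁻¹.toReal + ε)) := by
  have hr : 0 < p.toReal := ENNReal.toReal_pos (by positivity) hp'
  refine memHardy_hardyTest hp hp' ?_
  rw [toReal_inv_add_mul_toReal hp hp']
  linarith [mul_pos hε hr]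

theorem rpow_hardyNorm_hardyTest_add_le (hp : 1 ≤ p) (hp' : p ≠ ∞) {ε : ℝ} (hε : 0 < ε) :
    hardyNorm p (hardyTest (p⁻¹.toReal + ε)) ^ p.toReal ≤
      ENNReal.ofReal (2 + 2 / (ε * p.toReal)) := by
  have hr : 0 < p.toReal := ENNReal.toReal_pos (by positivity) hp'
  have h := hardyNorm_hardyTest_rpow_le hp hp' (a := p⁻¹.toReal + ε)
    (by rw [toReal_inv_add_mul_toReal hp hp']; linarith [mul_pos hε hr])
  rwa [toReal_inv_add_mul_toReal hp hp', add_sub_cancel_left] at h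

theorem lintegral_rpow_le_of_eLpNorm_le (hp : 1 ≤ p) (hp' : p ≠ ∞) {E : ℝ≥0∞} (hE : E ≠ ∞)
    {ε : ℝ} (hε : 0 < ε) {T : ℝ → ℂ}
    (h : eLpNorm T p volume ≤ E * hardyNorm p (hardyTest (p⁻¹.toReal + ε))) :
    ∫⁻ x : ℝ, ‖T x‖ₑ ^ p.toReal ≤
      ENNReal.ofReal (E.toReal ^ p.toReal * (2 + 2 / (ε * p.toReal))) := by
  have hr : 0 < p.toReal := ENNReal.toReal_pos (by positivity) hp'
  rw [eLpNorm_eq_lintegral_rpow_enorm_toReal (by positivity) hp', one_div,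
    ENNReal.rpow_inv_le_iff hr, ENNReal.mul_rpow_of_nonneg _ _ hr.le] at h
  rw [ofReal_toReal_rpow_mul hE hr.le]
  refine h.trans ?_
  gcongr
  exact rpow_hardyNorm_hardyTest_add_le hp hp' hε

theorem eLpNorm_line_one_le (hp : 1 ≤ p) (f : ℂ → ℂ) :
    eLpNorm (fun x : ℝ => f (x + Complex.I)) p volume ≤ hardyNorm p f := by
  simpa using eLpNorm_line_le_hardyNorm hp f one_pos

/-- A bound on the operator is not yet a bound on its truncations, so the lossy one-sided estimate
is applied to `φ` itself; it controls the integrals over `[1/n, n]` uniformly in `n`. -/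
theorem hausdorffWeight_lt_top_of_bounded (hp : 1 ≤ p) (hp' : p ≠ ∞)
    (hφ0 : ∀ᵐ t ∂(volume.restrict (Ioi (0 : ℝ))), 0 ≤ φ t)
    (hφ : LocallyIntegrableOn φ (Ioi (0 : ℝ))) (hb : HausdorffBoundedOnHardy p φ) :
    hausdorffWeight p φ < ∞ := by
  obtain ⟨hf, C, hC⟩ := hb
  have hr : 0 < p.toReal := ENNReal.toReal_pos (by positivity) hp'
  set q := p⁻¹.toReal
  have hq0 : 0 ≤ q := ENNReal.toReal_nonneg
  have hq1 : q ≤ 1 := toReal_inv_le_one hp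
  have hqr : q * p.toReal = 1 := by
    simpa [q] using toReal_inv_add_mul_toReal hp hp' 0
  have hpi := Real.pi_pos
  have hcos : 0 < Real.cos (q * (Real.pi / 4)) :=
    Real.cos_pos_of_mem_Ioo ⟨by nlinarith [mul_nonneg hq0 hpi.le], by nlinarith⟩
  set D := (C : ℝ) ^ p.toReal
  have key : ∀ n : ℕ, 1 ≤ n → ∫ t in Icc (1 / (n : ℝ)) n, t ^ (q - 1) * φ t ≤
      (2 * D) ^ (p.toReal)⁻¹ / Real.cos (q * (Real.pi / 4)) := by
    intro n hn
    have h := cos_mul_integral_weight_rpow_le (D := D) hφ0 hq0 hq1 hr hqr hn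
      (fun ε hε x => (hf _ (memHardy_hardyTest_add hp hp' hε)).1 _
        (by simp [upperHalfPlaneSet]))
      (fun ε hε => lintegral_rpow_le_of_eLpNorm_le hp hp' (E := C) ENNReal.coe_ne_top hε
        ((eLpNorm_line_one_le hp _).trans (hC _ (memHardy_hardyTest_add hp hp' hε))))
      (by positivity)
    rw [le_div_iff₀' hcos]
    exact (Real.le_rpow_inv_iff_of_pos
      (mul_nonneg hcos.le (integral_weight_nonneg hφ0 hn)) (by positivity) hr).2 h
  refine lt_of_le_of_lt (hausdorffWeight_le_of_forall_Icc fun n hn => ?_)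
    (ENNReal.ofReal_lt_top (r := (2 * D) ^ (p.toReal)⁻¹ / Real.cos (q * (Real.pi / 4))))
  rw [setLIntegral_hausdorffDensity_eq hφ0 hφ hn]
  exact ENNReal.ofReal_le_ofReal (key n hn)

theorem hausdorffWeight_le_of_isHardyBound (hp : 1 ≤ p) (hp' : p ≠ ∞)
    (hφ0 : ∀ᵐ t ∂(volume.restrict (Ioi (0 : ℝ))), 0 ≤ φ t)
    (hφ : LocallyIntegrableOn φ (Ioi (0 : ℝ))) (hW : hausdorffWeight p φ < ∞) {C : ℝ≥0}
    (hC : IsHardyBound p (complexHausdorff φ) C) : hausdorffWeight p φ ≤ C := by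
  have hφm := hφ.aestronglyMeasurable
  have hr : 0 < p.toReal := ENNReal.toReal_pos (by positivity) hp'
  set q := p⁻¹.toReal
  have hq0 : 0 ≤ q := ENNReal.toReal_nonneg
  have hqr : q * p.toReal = 1 := by
    simpa [q] using toReal_inv_add_mul_toReal hp hp' 0
  set W := hausdorffWeight p φ
  -- The truncated operator is the full one minus the remainder, so it has bound `C` plus the weight
  -- of the remainder; the sharp estimate for truncated weights compares this with the weight on
  -- `[1/n, n]`.
  have key : ∀ n : ℕ, 1 ≤ n →
      2 * ∫⁻ t in Icc (1 / (n : ℝ)) n, hausdorffDensity p φ t ≤ C + W := by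
    intro n hn
    set S := Icc (1 / (n : ℝ)) n
    have hS : MeasurableSet S := measurableSet_Icc
    have hS0 : S ⊆ Ioi 0 := Icc_inv_subset_Ioi hn
    have hsplit : (∫⁻ t in S, hausdorffDensity p φ t) +
        ∫⁻ t in Ioi 0 \ S, hausdorffDensity p φ t = W := by
      have h := lintegral_inter_add_sdiff (μ := volume) (hausdorffDensity p φ) (Ioi 0) hS
      rw [inter_eq_right.2 hS0] at h
      exact h
    set φ₁ := S.indicator φ
    set φ₂ := (Ioi 0 \ S).indicator φ
    have hS' : MeasurableSet (Ioi (0 : ℝ) \ S) := measurableSet_Ioi.diff hS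
    have hW1 : hausdorffWeight p φ₁ = ∫⁻ t in S, hausdorffDensity p φ t :=
      hausdorffWeight_indicator hS hS0
    have hW2 : hausdorffWeight p φ₂ = ∫⁻ t in Ioi 0 \ S, hausdorffDensity p φ t :=
      hausdorffWeight_indicator hS' sdiff_subset
    rw [← hW1, ← hW2] at hsplit
    have hW1' : hausdorffWeight p φ₁ < ∞ := lt_of_le_of_lt (hsplit ▸ le_self_add) hW
    have hW2' : hausdorffWeight p φ₂ < ∞ := lt_of_le_of_lt (hsplit ▸ le_add_self) hW
    have hm1 : AEStronglyMeasurable φ₁ (volume.restrict (Ioi 0)) := hφm.indicator hS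
    have hm2 : AEStronglyMeasurable φ₂ (volume.restrict (Ioi 0)) := hφm.indicator hS'
    have h01 : ∀ᵐ t ∂(volume.restrict (Ioi (0 : ℝ))), 0 ≤ φ₁ t :=
      hφ0.mono fun t ht => indicator_apply_nonneg fun _ => ht
    have h02 : ∀ᵐ t ∂(volume.restrict (Ioi (0 : ℝ))), 0 ≤ φ₂ t :=
      hφ0.mono fun t ht => indicator_apply_nonneg fun _ => ht
    have hadd : ∀ t ∈ Ioi (0 : ℝ), (φ₁ + φ₂) t = φ t := by
      intro t ht
      have ht' : (0 : ℝ) < t := ht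
      by_cases hts : t ∈ S <;> simp [φ₁, φ₂, hts, ht']
    have hzI : ∀ x : ℝ, 0 < (x + Complex.I : ℂ).im := fun x => by simp
    have hline : ∀ f : ℂ → ℂ, MemHardy p f →
        eLpNorm (fun x : ℝ => complexHausdorff φ₁ f (x + Complex.I)) p volume ≤
          (C + hausdorffWeight p φ₂) * hardyNorm p f := by
      intro f hf
      have hcont : ∀ {ψ : ℝ → ℝ}, MemHardy p (complexHausdorff ψ f) →
          AEStronglyMeasurable fun x : ℝ => complexHausdorff ψ f (x + Complex.I) := by
        intro ψ hψ
        have := (continuous_horizontal_line hψ.1.continuousOn one_pos).aestronglyMeasurable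
          (μ := volume)
        simpa using this
      have e : (fun x : ℝ => complexHausdorff φ₁ f (x + Complex.I)) =
          (fun x : ℝ => complexHausdorff φ f (x + Complex.I)) -
            fun x : ℝ => complexHausdorff φ₂ f (x + Complex.I) := by
        ext x
        have h1 := complexHausdorff_add (integrableOn_hausdorffIntegrand hp hm1 h01 hW1' hf (hzI x))
          (integrableOn_hausdorffIntegrand hp hm2 h02 hW2' hf (hzI x))
        have h2 : complexHausdorff (φ₁ + φ₂) f (x + Complex.I) =
            complexHausdorff φ f (x + Complex.I) := by
          refine setIntegral_congr_fun measurableSet_Ioi fun t ht => ?_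
          simp only [hausdorffIntegrand, hadd t ht]
        rw [Pi.sub_apply, ← h2, h1, add_sub_cancel_right]
      rw [e, add_mul]
      refine (eLpNorm_sub_le (hcont (memHardy_complexHausdorff hp hφm hφ0 hW hf))
        (hcont (memHardy_complexHausdorff hp hm2 h02 hW2' hf)) hp).trans (add_le_add ?_ ?_)
      · exact (eLpNorm_line_one_le hp _).trans (hC f hf)
      · exact (eLpNorm_line_one_le hp _).trans (hardyNorm_complexHausdorff_le hp hm2 h02 hf)
    have hE : C + hausdorffWeight p φ₂ ≠ ∞ := ENNReal.add_ne_top.2 ⟨ENNReal.coe_ne_top, hW2'.ne⟩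
    have hA := integral_weight_le (ψ := φ₁) (q := q) (r := p.toReal)
      (D := (C + hausdorffWeight p φ₂).toReal) h01 hq0 (toReal_inv_le_one hp) hr hqr hn
      (fun t ht => (mem_of_indicator_ne_zero ht).2)
      (fun ε hε x => integrableOn_hausdorffIntegrand hp hm1 h01 hW1'
        (memHardy_hardyTest_add hp hp' hε) (hzI x))
      ENNReal.toReal_nonneg
      (fun ε hε => lintegral_rpow_le_of_eLpNorm_le hp hp' hE hε
        (hline _ (memHardy_hardyTest_add hp hp' hε)))
    have hA' : ∫⁻ t in S, hausdorffDensity p φ t ≤ C + hausdorffWeight p φ₂ := by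
      rw [setLIntegral_hausdorffDensity_eq hφ0 hφ hn, ← ENNReal.ofReal_toReal hE]
      refine ENNReal.ofReal_le_ofReal (le_trans (le_of_eq ?_) hA)
      refine setIntegral_congr_fun hS fun t ht => ?_
      simp only [φ₁, q]
      rw [indicator_of_mem ht]
    rw [two_mul, ← hsplit, hW1, add_left_comm, add_comm (∫⁻ t in S, _)]
    rw [add_comm (∫⁻ t in S, _)]
    gcongr
  -- Exhaustion turns `key` into `2 W ≤ C + W`, and finiteness of `W` permits cancellation.
  have h2 : W ≤ (C + W) / 2 := hausdorffWeight_le_of_forall_Icc fun n hn =>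
    (ENNReal.le_div_iff_mul_le (by simp) (by simp)).2 (by rw [mul_comm]; exact key n hn)
  rw [ENNReal.le_div_iff_mul_le (by simp) (by simp), mul_two] at h2
  exact (ENNReal.add_le_add_iff_right hW.ne).1 h2

/-- The constant function is extremal for `p = ∞`: the operator multiplies it by the integral of
`φ(t) / t`, which is the weight. -/
theorem memHardy_top_one : MemHardy ∞ fun _ => 1 := by
  refine ⟨differentiableOn_const _, lt_of_le_of_lt ?_ ENNReal.one_lt_top⟩
  rw [hardyNorm, if_pos rfl]
  exact iSup₂_le fun z _ => by simp

theorem hardyNorm_top_one_le : hardyNorm ∞ (fun _ => 1) ≤ 1 := by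
  rw [hardyNorm, if_pos rfl]
  exact iSup₂_le fun z _ => by simp

theorem hausdorffIntegrand_one (φ : ℝ → ℝ) (z : ℂ) :
    hausdorffIntegrand φ (fun _ => 1) z = fun t => ((t ^ ((∞ : ℝ≥0∞)⁻¹.toReal - 1) * φ t : ℝ) : ℂ) := by
  ext t
  simp only [hausdorffIntegrand, one_mul, ENNReal.inv_top, ENNReal.toReal_zero, zero_sub,
    Real.rpow_neg_one]
  rw [inv_mul_eq_div]

theorem hausdorffWeight_top_lt_top
    (hφ0 : ∀ᵐ t ∂(volume.restrict (Ioi (0 : ℝ))), 0 ≤ φ t) (hb : HausdorffBoundedOnHardy ∞ φ) :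
    hausdorffWeight ∞ φ < ∞ := by
  have h := (hb.1 _ memHardy_top_one).1 Complex.I (by simp [upperHalfPlaneSet])
  rw [hausdorffIntegrand_one] at h
  have h2 := h.re.hasFiniteIntegral
  rw [hasFiniteIntegral_iff_ofReal] at h2
  · simpa [hausdorffWeight] using h2
  · filter_upwards [hφ0, ae_restrict_mem measurableSet_Ioi] with t ht h0
    have h0' : (0 : ℝ) < t := h0
    simp only [Pi.zero_apply, RCLike.re_to_complex, Complex.ofReal_re]
    positivity

theorem hausdorffWeight_top_le_of_isHardyBound
    (hφm : AEStronglyMeasurable φ (volume.restrict (Ioi 0)))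
    (hφ0 : ∀ᵐ t ∂(volume.restrict (Ioi (0 : ℝ))), 0 ≤ φ t) (hW : hausdorffWeight ∞ φ < ∞) {C : ℝ≥0}
    (hC : IsHardyBound ∞ (complexHausdorff φ) C) : hausdorffWeight ∞ φ ≤ C := by
  have hnn : ∀ᵐ t ∂(volume.restrict (Ioi (0 : ℝ))),
      0 ≤ t ^ ((∞ : ℝ≥0∞)⁻¹.toReal - 1) * φ t := by
    filter_upwards [hφ0, ae_restrict_mem measurableSet_Ioi] with t ht h0
    exact mul_nonneg (Real.rpow_nonneg (le_of_lt h0) _) ht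
  have h1 : ‖complexHausdorff φ (fun _ => 1) Complex.I‖ₑ = hausdorffWeight ∞ φ := by
    rw [complexHausdorff, hausdorffIntegrand_one, integral_complex_ofReal, ← ofReal_norm,
      Complex.norm_real, Real.norm_of_nonneg (integral_nonneg_of_ae hnn),
      ofReal_integral_eq_lintegral_ofReal (integrable_weight hφm hφ0 hW) hnn]
    rfl
  rw [← h1]
  refine le_trans ?_ ((hC _ memHardy_top_one).trans
    ((mul_le_mul_right hardyNorm_top_one_le _).trans (mul_one _).le))
  rw [hardyNorm, if_pos rfl]
  exact le_iSup₂ (f := fun z (_ : z ∈ upperHalfPlaneSet) =>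
    ‖complexHausdorff φ (fun _ => 1) z‖ₑ) Complex.I (by simp [upperHalfPlaneSet])

end Necessity

/-! ### The operator norm and the theorem. -/

theorem hardyOpNorm_complexHausdorff {p : ℝ≥0∞} (hp : 1 ≤ p) {φ : ℝ → ℝ}
    (hφ0 : ∀ᵐ t ∂(volume.restrict (Ioi (0 : ℝ))), 0 ≤ φ t)
    (hφ : LocallyIntegrableOn φ (Ioi (0 : ℝ))) (hW : hausdorffWeight p φ < ∞) :
    hardyOpNorm p (complexHausdorff φ) = hausdorffWeight p φ := by
  have hφm := hφ.aestronglyMeasurable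
  refine le_antisymm ?_ (le_iInf₂ fun C hC => ?_)
  · refine (iInf₂_le _ (isHardyBound_hausdorffWeight hp hφm hφ0 hW)).trans ?_
    rw [ENNReal.coe_toNNReal hW.ne]
  · by_cases hp' : p = ∞
    · subst hp'
      exact hausdorffWeight_top_le_of_isHardyBound hφm hφ0 hW hC
    · exact hausdorffWeight_le_of_isHardyBound hp hp' hφ0 hφ hW hC

theorem theorem1p1 (p : ℝ≥0∞) (hp : 1 ≤ p) (φ : ℝ → ℝ)
    (hφ_nonneg : ∀ᵐ t ∂(volume.restrict (Ioi (0 : ℝ))), 0 ≤ φ t)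
    (hφ_loc : LocallyIntegrableOn φ (Ioi (0 : ℝ))) :
    (HausdorffBoundedOnHardy p φ ↔ hausdorffWeight p φ < ∞) ∧
    (hausdorffWeight p φ < ∞ →
      hardyOpNorm p (complexHausdorff φ) = hausdorffWeight p φ ∧
      ∀ f : ℂ → ℂ, MemHardy p f →
        (HasBoundaryValue f ∧ MemLp (boundaryValue f) p) ∧
        HasBoundaryValue (complexHausdorff φ f) ∧
        (∀ᵐ x : ℝ, IntegrableOn (realHausdorffIntegrand φ (boundaryValue f) x) (Ioi 0)) ∧
        boundaryValue (complexHausdorff φ f) =ᵐ[volume] realHausdorff φ (boundaryValue f)) := by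
  have hφm := hφ_loc.aestronglyMeasurable
  refine ⟨⟨fun hb => ?_, fun hW => ⟨fun f hf => ⟨fun z hz => ?_, ?_⟩, _,
    isHardyBound_hausdorffWeight hp hφm hφ_nonneg hW⟩⟩, fun hW => ⟨?_, fun f hf => ?_⟩⟩
  · by_cases hp' : p = ∞
    · subst hp'
      exact hausdorffWeight_top_lt_top hφ_nonneg hb
    · exact hausdorffWeight_lt_top_of_bounded hp hp' hφ_nonneg hφ_loc hb
  · exact integrableOn_hausdorffIntegrand hp hφm hφ_nonneg hW hf hz
  · exact memHardy_complexHausdorff hp hφm hφ_nonneg hW hf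
  · exact hardyOpNorm_complexHausdorff hp hφ_nonneg hφ_loc hW
  · exact ⟨⟨hf.hasBoundaryValue hp, hf.memLp_boundaryValue hp⟩,
      (memHardy_complexHausdorff hp hφm hφ_nonneg hW hf).hasBoundaryValue hp,
      boundaryValue_complexHausdorff hp hφm hφ_nonneg hW hf⟩
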